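/- Let $\alpha>1/2$ and $C\in\mathbb{R}$. For $n\in\mathbb{N}$ set $R=2\log n+C$. The random hyperbolic graph $G_{\alpha,C}(n)$ has $n$ vertices; every vertex $v$ independently receives polar coordinates $(r_v,\theta_v)$, where $r_v\in[0,R]$ has density $\alpha\sinh(\alpha r)/(\cosh(\alpha R)-1)$ and $\theta_v$ is independent of $r_v$ and uniform on $[-\pi,\pi]$. Two distinct vertices $u,v$ are adjacent if and only if their hyperbolic distance $d\ge 0$, given by $\cosh d=\cosh r_u\cosh r_v-\sinh r_u\sinh r_v\cos(\theta_u-\theta_v)$, is at most $R$. "With high probability" means with probability tending to $1$ as $n\to\infty$. Set $$\delta=\min\Bigl\{\frac{2\alpha-1}{4(2\alpha+1)\alpha},\ \frac{2(2\alpha-1)}{5(2\alpha+1)}\Bigr\},\qquad \xi=\frac{2\alpha}{\pi(\alpha-1/2)}e^{-C/2}.$$ (1) Let $\delta'<\delta$ be fixed. With high probability, simultaneously for all integers $0\le k\le n^{\delta'}$, the fraction of vertices of degree exactly $k$ in $G_{\alpha,C}(n)$ is $$(1+o(1))\,\frac{2\alpha e^{-\alpha C}}{k!}\Bigl(\frac{2\alpha}{\pi(\alpha-1/2)}\Bigr)^{2\alpha}\Bigl(\Gamma(k-2\alpha)-\int_0^{\xi}t^{k-2\alpha-1}e^{-t}\,dt\Bigr),$$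 where $\Gamma(x)=\int_0^\infty t^{x-1}e^{-t}\,dt$, the last bracket is understood as $\int_\xi^\infty t^{k-2\alpha-1}e^{-t}\,dt$ (it equals this for $k>2\alpha$, and for $k\le 2\alpha$ this is its meaning), and the $o(1)$ is uniform in $k$. (2) If $k=k(n)$ is an integer with $n^{\delta}\le k\le n^{1/(2\alpha)}/\log n$ for all large $n$, then with high probability the fraction of vertices of degree at least $k$ in $G_{\alpha,C}(n)$ is $$(1+o(1))\Bigl(\frac{2\alpha}{\pi(\alpha-1/2)}\Bigr)^{2\alpha}e^{-\alpha C}k^{-2\alpha}.$$ -/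

import Mathlib

open MeasureTheory Set Filter Topology

noncomputable section

namespace HypGraph

/-- The disc radius `R = 2 log n + C`. -/
def discRadius (C : ℝ) (n : ℕ) : ℝ := 2 * Real.log n + C

/-- The hyperbolic distance of two points with radial coordinates `r`, `r'` and angle difference `φ`:
the solution `d ≥ 0` of `cosh d = cosh r cosh r' - sinh r sinh r' cos φ`. -/
def hypDist (r r' φ : ℝ) : ℝ :=
  Real.arcosh (Real.cosh r * Real.cosh r' - Real.sinh r * Real.sinh r' * Real.cos φ)

/-- The law of the radial coordinate: density `α sinh(α r) / (cosh(α R) - 1)` on `[0, R]`. -/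
def radialLaw (α R : ℝ) : Measure ℝ :=
  (volume.restrict (Icc 0 R)).withDensity
    fun r => ENNReal.ofReal (α * Real.sinh (α * r) / (Real.cosh (α * R) - 1))

/-- The law of the angular coordinate: the uniform distribution on `[-π, π]`. -/
def angularLaw : Measure ℝ :=
  ENNReal.ofReal (1 / (2 * Real.pi)) • volume.restrict (Icc (-Real.pi) Real.pi)

/-- The joint law of the polar coordinates `(r_v, θ_v)` of `n` independent vertices. -/
def coordLaw (α C : ℝ) (n : ℕ) : Measure (Fin n → ℝ × ℝ) :=
  Measure.pi fun _ => (radialLaw α (discRadius C n)).prod angularLaw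

/-- The graph on `n` vertices with polar coordinates `x v = (r_v, θ_v)`: distinct vertices are
adjacent when their hyperbolic distance is at most `R`. -/
def graph (C : ℝ) (n : ℕ) (x : Fin n → ℝ × ℝ) : SimpleGraph (Fin n) where
  Adj u v := u ≠ v ∧ hypDist (x u).1 (x v).1 ((x u).2 - (x v).2) ≤ discRadius C n
  symm := ⟨fun u v h => by
    refine ⟨h.1.symm, ?_⟩
    have h2 := h.2
    unfold hypDist at h2 ⊢
    rw [← Real.cos_neg, neg_sub, mul_comm (Real.cosh (x v).1), mul_comm (Real.sinh (x v).1)]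
    exact h2⟩
  loopless := ⟨fun _ h => h.1 rfl⟩

/-- The random hyperbolic graph with parameters `α`, `C` has the property `P` with high
probability, i.e. with probability tending to `1` as `n → ∞`. -/
def WHP (α C : ℝ) (P : (n : ℕ) → SimpleGraph (Fin n) → Prop) : Prop :=
  Tendsto (fun n : ℕ => coordLaw α C n {x | P n (graph C n x)}) atTop (𝓝 1)

open Classical in
/-- The fraction of vertices of degree exactly `k`. -/
def fracDegEq {n : ℕ} (G : SimpleGraph (Fin n)) (k : ℕ) : ℝ :=
  ((Finset.univ.filter fun v => G.degree v = k).card : ℝ) / n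

open Classical in
/-- The fraction of vertices of degree at least `k`. -/
def fracDegGe {n : ℕ} (G : SimpleGraph (Fin n)) (k : ℕ) : ℝ :=
  ((Finset.univ.filter fun v => k ≤ G.degree v).card : ℝ) / n

/-- The constant `2α / (π (α - 1/2))`. -/
def kappa (α : ℝ) : ℝ := 2 * α / (Real.pi * (α - 1 / 2))

/-- The constant `ξ = 2α / (π (α - 1/2)) · e^{-C/2}`. -/
def xi (α C : ℝ) : ℝ := kappa α * Real.exp (-C / 2)

/-- `Γ(s) - ∫_0^x t^{s-1} e^{-t} dt` (with `Γ(s) = ∫_0^∞ t^{s-1} e^{-t} dt`), understood as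
`∫_x^∞ t^{s-1} e^{-t} dt`, which makes sense for `x > 0` and all real `s`. -/
def upperGamma (s x : ℝ) : ℝ := ∫ t in Ioi x, t ^ (s - 1) * Real.exp (-t)

/-- For `s > 0` this is literally the difference. -/
theorem upperGamma_eq_sub {s x : ℝ} (hs : 0 < s) (hx : 0 ≤ x) :
    upperGamma s x = Real.Gamma s - ∫ t in (0 : ℝ)..x, t ^ (s - 1) * Real.exp (-t) := by
  have h : IntegrableOn (fun t : ℝ => t ^ (s - 1) * Real.exp (-t)) (Ioi 0) := by
    simpa only [mul_comm] using Real.GammaIntegral_convergent hs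
  have h2 := intervalIntegral.integral_interval_add_Ioi h (h.mono_set (Ioi_subset_Ioi hx))
  have h3 : Real.Gamma s = ∫ t in Ioi (0 : ℝ), t ^ (s - 1) * Real.exp (-t) := by
    rw [Real.Gamma_eq_integral hs]
    simp only [mul_comm]
  rw [h3, ← h2, upperGamma]
  ring

/-- The limiting fraction of vertices of degree exactly `k`. -/
def degEqLimit (α C : ℝ) (k : ℕ) : ℝ :=
  2 * α * Real.exp (-α * C) / (k.factorial : ℝ) * kappa α ^ (2 * α)
    * upperGamma (k - 2 * α) (xi α C)

/-- The limiting fraction of vertices of degree at least `k`. -/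
def degGeLimit (α C : ℝ) (k : ℕ) : ℝ :=
  kappa α ^ (2 * α) * Real.exp (-α * C) * (k : ℝ) ^ (-2 * α)

/-- The exponent `δ`. -/
def delta (α : ℝ) : ℝ :=
  min ((2 * α - 1) / (4 * (2 * α + 1) * α)) (2 * (2 * α - 1) / (5 * (2 * α + 1)))

end HypGraph

end

/-!
# Degrees in random hyperbolic graphs

**One vertex.** A vertex at radius `r` is adjacent to a random vertex with probability
`κ e^{-r/2}` up to an error `O(e^{-γ r})` with `γ > 1/2` (`abs_nbrProb_pointLaw_sub_le`). Given
the position of a vertex its degree is binomial (`lintegral_degCount`), hence nearly Poisson with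
mean `κ n e^{-r/2}`, while `R - r` is nearly exponential with parameter `α`. The limiting fraction
of vertices of degree `k` is exactly the resulting mixture of Poisson weights
(`degEqLimit_eq_integral`), which is at least of order `k^{-(2α+1)}` (`exists_le_degEqLimit`). The
comparison of the two mixtures is relative where the mean degree is at most `n^d` with `d < 1/2`.
At the remaining radii a degree as small as `k ≤ n^{d'}`, `d' < d`, is exponentially unlikely,
except near the centre, where there is only mass of order `n^{-2α}`. So the probability of degree `k` has the right asymptotics, uniformly in `k`
(`eventually_abs_integral_binomWeight_sub_le`).

**Degree exactly `k`.** Deleting a vertex `i` changes the number of vertices of degree `k` by at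
most `1 + deg i`. By the Efron–Stein inequality (`integral_sq_sub_sq_integral_le_sum`) the variance
of this number is therefore at most `n E (1 + deg)²`, which is at most of order `n^{3-β}` for every
`1 ≤ β ≤ 2` with `β < 2α`. Chebyshev's inequality and a union bound over `k ≤ n^{d'}` suffice as
soon as `d' (4α + 3) < β - 1`. A suitable `β` exists because `δ (4α + 3) < min 1 (2α - 1)`
(`delta_bounds`, `whp_fracDegEq`).

**Degree at least `k`.** When `k` is at least a power of `n`, Chernoff bounds show that, up to a
factor `1 ± ρ` in the mean degree, a vertex has degree at least `k` precisely when its mean degree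
`κ n e^{-r/2}` is at least `k`, simultaneously for all vertices
(`exists_tendsto_coordLaw_exists_atypical`). The number of vertices whose radius lies below the
corresponding threshold is a sum of independent indicators. Its mean is asymptotically `n` times
the limiting fraction and tends to infinity when `k ≤ n^{1/(2α)} / log n`, so it is concentrated
(`tendsto_coordLaw_card_meanDegRadius`, `whp_fracDegGe`).
-/

namespace HypGraph

/-! ### The Efron–Stein inequality on a finite power of a probability space -/

section EfronStein

variable {X : Type*} [MeasurableSpace X] (μ : Measure X) [IsProbabilityMeasure μ]

lemma integrable_of_abs_le {Y : Type*} [MeasurableSpace Y] {ν : Measure Y} [IsFiniteMeasure ν]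
    {f : Y → ℝ} (hf : Measurable f) {c : ℝ} (hc : ∀ y, |f y| ≤ c) : Integrable f ν :=
  Integrable.of_bound hf.aestronglyMeasurable c (ae_of_all _ hc)

lemma integral_pi_succ {n : ℕ} {f : (Fin (n + 1) → X) → ℝ} (hf : Measurable f) {c : ℝ}
    (hc : ∀ x, |f x| ≤ c) :
    ∫ x, f x ∂(Measure.pi fun _ : Fin (n + 1) => μ)
      = ∫ y, ∫ a, f (Fin.cons a y) ∂μ ∂(Measure.pi fun _ : Fin n => μ) := by
  have h := (measurePreserving_piFinSuccAbove (fun _ : Fin (n + 1) => μ) 0).symm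
  have h2 := h.integral_comp' (g := f)
  rw [← h2, integral_prod_symm]
  · simp [Fin.insertNthEquiv]
  · exact integrable_of_abs_le (hf.comp (MeasurableEquiv.measurable _)) fun x => hc _

lemma measurable_cons {n : ℕ} :
    Measurable fun z : X × (Fin n → X) => (Fin.cons z.1 z.2 : Fin (n + 1) → X) := by
  have h := (MeasurableEquiv.piFinSuccAbove (fun _ : Fin (n + 1) => X) 0).symm.measurable
  simpa [Fin.insertNthEquiv, MeasurableEquiv.piFinSuccAbove] using h

lemma integral_sub_sq {f : X → ℝ} (hf : Measurable f) {c : ℝ} (hc : ∀ x, |f x| ≤ c) (b : ℝ) :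
    ∫ a, (f a - b) ^ 2 ∂μ = ∫ a, f a ^ 2 ∂μ - 2 * b * ∫ a, f a ∂μ + b ^ 2 := by
  have h1 : Integrable f μ := integrable_of_abs_le hf hc
  have h2 : Integrable (fun a => f a ^ 2) μ :=
    integrable_of_abs_le (c := c ^ 2) (hf.pow_const 2) fun x => by
      rw [abs_pow]; exact pow_le_pow_left₀ (abs_nonneg _) (hc x) 2
  have h3 : Integrable (fun a => 2 * b * f a) μ := h1.const_mul _
  have h4 : Integrable (fun a => f a ^ 2 - 2 * b * f a) μ := h2.sub h3
  have : ∀ a, (f a - b) ^ 2 = f a ^ 2 - 2 * b * f a + b ^ 2 := fun a => by ring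
  simp_rw [this]
  rw [integral_add h4 (integrable_const _), integral_sub h2 h3, integral_const_mul]
  simp

/-- The second moment minus the squared mean is at most the second moment about any point. -/
lemma integral_sq_sub_le {f : X → ℝ} (hf : Measurable f) {c : ℝ} (hc : ∀ x, |f x| ≤ c) (b : ℝ) :
    ∫ a, f a ^ 2 ∂μ - (∫ a, f a ∂μ) ^ 2 ≤ ∫ a, (f a - b) ^ 2 ∂μ := by
  rw [integral_sub_sq μ hf hc]
  nlinarith [sq_nonneg (∫ a, f a ∂μ - b)]

lemma sq_integral_le {f : X → ℝ} (hf : Measurable f) {c : ℝ} (hc : ∀ x, |f x| ≤ c) :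
    (∫ a, f a ∂μ) ^ 2 ≤ ∫ a, f a ^ 2 ∂μ := by
  have h1 := integral_sub_sq μ hf hc (∫ a, f a ∂μ)
  have h2 : 0 ≤ ∫ a, (f a - ∫ a, f a ∂μ) ^ 2 ∂μ := integral_nonneg fun a => sq_nonneg _
  nlinarith

/-- **Efron–Stein inequality.** If `g i` does not depend on the `i`-th coordinate, the variance of
`f` is at most the sum of the mean squares of `f - g i`. -/
theorem integral_sq_sub_sq_integral_le_sum {n : ℕ} {f : (Fin n → X) → ℝ}
    {g : Fin n → (Fin n → X) → ℝ} (hf : Measurable f) (hg : ∀ i, Measurable (g i)) {c : ℝ}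
    (hfc : ∀ x, |f x| ≤ c) (hgc : ∀ i x, |g i x| ≤ c)
    (hgi : ∀ i x a, g i (Function.update x i a) = g i x) :
    ∫ x, f x ^ 2 ∂(Measure.pi fun _ : Fin n => μ)
        - (∫ x, f x ∂(Measure.pi fun _ : Fin n => μ)) ^ 2
      ≤ ∑ i, ∫ x, (f x - g i x) ^ 2 ∂(Measure.pi fun _ : Fin n => μ) := by
  have habs : ∀ u : ℝ, |u| ≤ c → |u ^ 2| ≤ c ^ 2 := fun u hu => by
    rw [abs_pow]; exact pow_le_pow_left₀ (abs_nonneg _) hu 2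
  have habs2 : ∀ u v : ℝ, |u| ≤ c → |v| ≤ c → |(u - v) ^ 2| ≤ (2 * c) ^ 2 := fun u v hu hv => by
    rw [abs_pow]
    exact pow_le_pow_left₀ (abs_nonneg _) ((abs_sub _ _).trans (by linarith)) 2
  induction n with
  | zero =>
    have hx : ∀ x, f x = f default := fun x => by rw [Subsingleton.elim x default]
    simp [hx]
  | succ n ih =>
    set π := Measure.pi fun _ : Fin n => μ
    obtain ⟨a₀⟩ : Nonempty X := nonempty_of_isProbabilityMeasure μ
    have hfm : Measurable fun z : X × (Fin n → X) => f (Fin.cons z.1 z.2) := hf.comp measurable_cons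
    have hgm : ∀ i, Measurable fun z : X × (Fin n → X) => g i (Fin.cons z.1 z.2) :=
      fun i => (hg i).comp measurable_cons
    have hslice : ∀ {h : X × (Fin n → X) → ℝ}, Measurable h → ∀ y, Measurable fun a => h (a, y) :=
      fun hh y => hh.comp (measurable_id.prodMk measurable_const)
    have hmarg : ∀ {h : X × (Fin n → X) → ℝ}, Measurable h →
        Measurable fun y => ∫ a, h (a, y) ∂μ := fun {h} hh =>
      hh.stronglyMeasurable.integral_prod_left'.measurable
    have hbdd : ∀ {h : X → ℝ} {d : ℝ}, (∀ a, |h a| ≤ d) → |∫ a, h a ∂μ| ≤ d := fun {h d} hh => by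
      have := norm_integral_le_of_norm_le_const (μ := μ) (f := h) (C := d) (ae_of_all _ hh)
      simpa using this
    set F : (Fin n → X) → ℝ := fun y => ∫ a, f (Fin.cons a y) ∂μ
    set G : Fin n → (Fin n → X) → ℝ := fun i y => ∫ a, g i.succ (Fin.cons a y) ∂μ
    have hF : Measurable F := hmarg hfm
    have hG : ∀ i, Measurable (G i) := fun i => hmarg (hgm i.succ)
    have hFc : ∀ y, |F y| ≤ c := fun y => hbdd fun a => hfc _
    have hGc : ∀ i y, |G i y| ≤ c := fun i y => hbdd fun a => hgc _ _
    have ih' := ih hF hG hFc hGc (fun i y b => by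
      refine integral_congr_ae (ae_of_all _ fun a => ?_)
      simpa [Fin.cons_update] using hgi i.succ (Fin.cons a y) b)
    rw [integral_pi_succ μ (hf.pow_const 2) (fun x => habs _ (hfc x)), integral_pi_succ μ hf hfc,
      Fin.sum_univ_succ]
    have hsucc : ∀ i, ∫ x, (f x - g i x) ^ 2 ∂(Measure.pi fun _ : Fin (n + 1) => μ)
        = ∫ y, ∫ a, (f (Fin.cons a y) - g i (Fin.cons a y)) ^ 2 ∂μ ∂π := fun i =>
      integral_pi_succ μ ((hf.sub (hg i)).pow_const 2) (fun x => habs2 _ _ (hfc x) (hgc i x))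
    have hd2 : ∀ i, Measurable fun z : X × (Fin n → X) =>
        (f (Fin.cons z.1 z.2) - g i (Fin.cons z.1 z.2)) ^ 2 := fun i =>
      ((hfm.sub (hgm i)).pow_const 2)
    have hint : ∀ i, Integrable
        (fun y => ∫ a, (f (Fin.cons a y) - g i (Fin.cons a y)) ^ 2 ∂μ) π := fun i =>
      integrable_of_abs_le (hmarg (hd2 i)) (fun y => hbdd fun a => habs2 _ _ (hfc _) (hgc i _))
    have hf2int : Integrable (fun y => ∫ a, f (Fin.cons a y) ^ 2 ∂μ) π :=
      integrable_of_abs_le (hmarg (hfm.pow_const 2)) (fun y => hbdd fun a => habs _ (hfc _))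
    have hF2int : Integrable (fun y => F y ^ 2) π :=
      integrable_of_abs_le (hF.pow_const 2) (fun y => habs _ (hFc y))
    -- the variance in the first coordinate, the others being fixed
    have hzero : ∫ y, ∫ a, f (Fin.cons a y) ^ 2 ∂μ ∂π - ∫ y, F y ^ 2 ∂π
        ≤ ∫ y, ∫ a, (f (Fin.cons a y) - g 0 (Fin.cons a y)) ^ 2 ∂μ ∂π := by
      rw [← integral_sub hf2int hF2int]
      refine integral_mono (hf2int.sub hF2int) (hint 0) fun y => ?_
      have hconst : ∀ a, g 0 (Fin.cons a y) = g 0 (Fin.cons a₀ y) := fun a => by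
        simpa using (hgi 0 (Fin.cons a y) a₀).symm
      simp only [hconst]
      exact integral_sq_sub_le μ (hslice hfm y) (fun a => hfc _) _
    have hpos : ∀ i : Fin n, ∫ y, (F y - G i y) ^ 2 ∂π
        ≤ ∫ y, ∫ a, (f (Fin.cons a y) - g i.succ (Fin.cons a y)) ^ 2 ∂μ ∂π := fun i => by
      refine integral_mono (integrable_of_abs_le ((hF.sub (hG i)).pow_const 2)
        (fun y => habs2 _ _ (hFc y) (hGc i y))) (hint i.succ) fun y => ?_
      have hsub : F y - G i y = ∫ a, (f (Fin.cons a y) - g i.succ (Fin.cons a y)) ∂μ :=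
        (integral_sub (integrable_of_abs_le (hslice hfm y) fun a => hfc _)
          (integrable_of_abs_le (hslice (hgm i.succ) y) fun a => hgc _ _)).symm
      have := sq_integral_le μ ((hslice hfm y).sub (hslice (hgm i.succ) y)) (c := 2 * c)
        (fun a => (abs_sub _ _).trans (by linarith [hfc (Fin.cons a y), hgc i.succ (Fin.cons a y)]))
      simpa [hsub] using this
    have hsum := Finset.sum_le_sum fun i (_ : i ∈ Finset.univ) => hpos i
    simp only [hsucc]
    linarith

end EfronStein

/-! ### Binomial weights -/

section Binomial

/-- The probability that a binomial variable with parameters `m` and `p` equals `j`. -/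
noncomputable def binomWeight (m j : ℕ) (p : ℝ) : ℝ := m.choose j * p ^ j * (1 - p) ^ (m - j)

lemma binomWeight_nonneg {m j : ℕ} {p : ℝ} (hp0 : 0 ≤ p) (hp1 : p ≤ 1) :
    0 ≤ binomWeight m j p := by
  have : 0 ≤ 1 - p := by linarith
  unfold binomWeight; positivity

lemma measurable_binomWeight (m j : ℕ) : Measurable (binomWeight m j) := by
  unfold binomWeight; fun_prop

lemma sum_binomWeight (m : ℕ) (p : ℝ) : ∑ j ∈ Finset.range (m + 1), binomWeight m j p = 1 := by
  have h := add_pow p (1 - p) m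
  rw [add_sub_cancel, one_pow] at h
  rw [h]
  exact Finset.sum_congr rfl fun j _ => by unfold binomWeight; ring

lemma binomWeight_le_one {m j : ℕ} {p : ℝ} (hp0 : 0 ≤ p) (hp1 : p ≤ 1) :
    binomWeight m j p ≤ 1 := by
  by_cases hj : j ∈ Finset.range (m + 1)
  · rw [← sum_binomWeight m p]
    exact Finset.single_le_sum (f := fun j => binomWeight m j p)
      (fun j _ => binomWeight_nonneg hp0 hp1) hj
  · have : m < j := by simpa using hj
    simp [binomWeight, Nat.choose_eq_zero_of_lt this]

lemma sum_sq_mul_binomWeight (m : ℕ) (p : ℝ) :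
    ∑ j ∈ Finset.range (m + 1), (j : ℝ) ^ 2 * binomWeight m j p
      = m * p * (1 - p) + (m * p) ^ 2 := by
  have h1 := congrArg (Polynomial.eval p) (bernsteinPolynomial.sum_smul ℝ m)
  have h2 := congrArg (Polynomial.eval p) (bernsteinPolynomial.sum_mul_smul ℝ m)
  have hm : ((m * (m - 1) : ℕ) : ℝ) = m * (m - 1) := by
    cases m <;> simp
  have hj : ∀ j : ℕ, ((j * (j - 1) : ℕ) : ℝ) = j * (j - 1) := fun j => by
    cases j <;> simp
  simp only [Polynomial.eval_finsetSum, bernsteinPolynomial, Polynomial.eval_mul, nsmul_eq_mul,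
    Polynomial.eval_natCast, Polynomial.eval_pow, Polynomial.eval_X, Polynomial.eval_sub,
    Polynomial.eval_one, hm, hj] at h1 h2
  have : ∑ j ∈ Finset.range (m + 1), (j : ℝ) ^ 2 * binomWeight m j p
      = ∑ j ∈ Finset.range (m + 1),
          (j : ℝ) * ((j : ℝ) - 1) * (m.choose j * p ^ j * (1 - p) ^ (m - j))
        + ∑ j ∈ Finset.range (m + 1), (j : ℝ) * (m.choose j * p ^ j * (1 - p) ^ (m - j)) := by
    rw [← Finset.sum_add_distrib]
    exact Finset.sum_congr rfl fun j _ => by unfold binomWeight; ring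
  rw [this, h1, h2]; ring

/-- The exponential Markov inequality for the binomial distribution; `l` may have either sign. -/
lemma sum_binomWeight_le_exp {m k : ℕ} {p : ℝ} (hp0 : 0 ≤ p) (hp1 : p ≤ 1) (l : ℝ)
    {S : Finset ℕ} (hS : S ⊆ Finset.range (m + 1)) (hl : ∀ j ∈ S, l * k ≤ l * j) :
    ∑ j ∈ S, binomWeight m j p ≤ Real.exp (m * p * (Real.exp l - 1) - l * k) := by
  have h := add_pow (p * Real.exp l) (1 - p) m
  have h1 : ∑ j ∈ S, binomWeight m j p
      ≤ ∑ j ∈ Finset.range (m + 1), Real.exp (-(l * k)) * (Real.exp (l * j) * binomWeight m j p) := by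
    refine (Finset.sum_le_sum fun j hj => ?_).trans
      (Finset.sum_le_sum_of_subset_of_nonneg hS fun j _ _ => ?_)
    · rw [← mul_assoc, ← Real.exp_add]
      refine le_mul_of_one_le_left (binomWeight_nonneg hp0 hp1) (Real.one_le_exp ?_)
      linarith [hl j hj]
    · exact mul_nonneg (Real.exp_pos _).le (mul_nonneg (Real.exp_pos _).le
        (binomWeight_nonneg hp0 hp1))
  refine h1.trans ?_
  have h2 : ∑ j ∈ Finset.range (m + 1), Real.exp (-(l * k)) * (Real.exp (l * j) * binomWeight m j p)
      = Real.exp (-(l * k)) * (p * Real.exp l + (1 - p)) ^ m := by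
    rw [h, Finset.mul_sum]
    refine Finset.sum_congr rfl fun j _ => ?_
    unfold binomWeight
    rw [mul_comm l (j : ℝ), Real.exp_nat_mul, mul_pow]; ring
  rw [h2]
  have h3 : p * Real.exp l + (1 - p) ≤ Real.exp (p * (Real.exp l - 1)) := by
    linarith [Real.add_one_le_exp (p * (Real.exp l - 1))]
  have h4 : 0 ≤ p * Real.exp l + (1 - p) := by
    have := mul_nonneg hp0 (Real.exp_pos l).le; linarith
  calc Real.exp (-(l * k)) * (p * Real.exp l + (1 - p)) ^ m
      ≤ Real.exp (-(l * k)) * Real.exp (p * (Real.exp l - 1)) ^ m := by gcongr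
    _ = Real.exp (m * p * (Real.exp l - 1) - l * k) := by
      rw [← Real.exp_nat_mul, ← Real.exp_add]; ring_nf

lemma binomWeight_le_exp {m k : ℕ} {p : ℝ} (hp0 : 0 ≤ p) (hp1 : p ≤ 1) :
    binomWeight m k p ≤ Real.exp (k - m * p / 2) := by
  by_cases hk : k ∈ Finset.range (m + 1)
  · have h := sum_binomWeight_le_exp (m := m) (k := k) hp0 hp1 (-1) (S := {k}) (by simpa using hk)
      (by simp)
    rw [Finset.sum_singleton] at h
    refine h.trans (Real.exp_le_exp.2 ?_)
    have he : Real.exp (-1) ≤ 1 / 2 := by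
      rw [Real.exp_neg, inv_eq_one_div]
      exact one_div_le_one_div_of_le two_pos (by linarith [Real.add_one_le_exp 1])
    have : 0 ≤ (m : ℝ) * p := by positivity
    nlinarith
  · have : m < k := by simpa using hk
    simpa [binomWeight, Nat.choose_eq_zero_of_lt this] using (Real.exp_pos _).le

end Binomial

/-! ### Degrees in a random geometric graph -/

section RandomGraph

variable {X : Type*}

open Classical in
/-- The number of vertices other than `v` whose position is related by `A` to that of `v`: the
degree of `v` in the geometric graph of the relation `A` on the points `x`. -/
noncomputable def degCount {n : ℕ} (A : Set (X × X)) (x : Fin n → X) (v : Fin n) : ℕ :=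
  (Finset.univ.filter fun w => w ≠ v ∧ (x v, x w) ∈ A).card

open Classical in
lemma degCount_insertNth {m : ℕ} (A : Set (X × X)) (v : Fin (m + 1)) (a : X) (y : Fin m → X) :
    degCount A (Fin.insertNth v a y : Fin (m + 1) → X) v
      = (Finset.univ.filter fun w => y w ∈ {b | (a, b) ∈ A}).card := by
  unfold degCount
  rw [← Finset.card_map v.succAboveEmb]
  congr 1
  ext w
  simp only [Finset.mem_filter, Finset.mem_univ, true_and, Finset.mem_map, Fin.insertNth_apply_same]
  constructor
  · rintro ⟨h1, h2⟩
    obtain ⟨j, rfl⟩ := Fin.exists_succAbove_eq h1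
    exact ⟨j, by simpa using h2, rfl⟩
  · rintro ⟨j, h1, rfl⟩
    exact ⟨Fin.succAbove_ne v j, by simpa using h1⟩

variable [MeasurableSpace X] (μ : Measure X)

/-- The probability that a random point is related to `a`. -/
noncomputable def nbrProb (A : Set (X × X)) (a : X) : ℝ := μ.real {b | (a, b) ∈ A}

lemma nbrProb_nonneg (A : Set (X × X)) (a : X) : 0 ≤ nbrProb μ A a := measureReal_nonneg

lemma nbrProb_le_one [IsProbabilityMeasure μ] (A : Set (X × X)) (a : X) : nbrProb μ A a ≤ 1 :=
  measureReal_le_one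

lemma measurable_nbrProb [IsProbabilityMeasure μ] {A : Set (X × X)} (hA : MeasurableSet A) :
    Measurable (nbrProb μ A) :=
  (measurable_measure_prodMk_left hA).ennreal_toReal

open Classical in
/-- The number of hits of a set by independent points has a binomial law. -/
lemma lintegral_pi_card [IsProbabilityMeasure μ] {m : ℕ} {B : Set X} (hB : MeasurableSet B)
    (F : ℕ → ENNReal) :
    ∫⁻ y, F (Finset.univ.filter fun w => y w ∈ B).card ∂(Measure.pi fun _ : Fin m => μ)
      = ∑ j ∈ Finset.range (m + 1), ENNReal.ofReal (binomWeight m j (μ.real B)) * F j := by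
  have hp0 : 0 ≤ μ.real B := measureReal_nonneg
  have hp1 : μ.real B ≤ 1 := measureReal_le_one
  have hsets : ∀ S : Finset (Fin m), {y : Fin m → X | (Finset.univ.filter fun w => y w ∈ B) = S}
      = univ.pi fun w => if w ∈ S then B else Bᶜ := fun S => by
    ext y
    simp only [mem_ofPred_eq, Set.mem_pi, mem_univ, true_imp_iff, Finset.ext_iff, Finset.mem_filter,
      Finset.mem_univ, true_and]
    refine forall_congr' fun w => ?_
    by_cases h : w ∈ S <;> simp [h]
  have hmeas : ∀ S : Finset (Fin m),
      MeasurableSet {y : Fin m → X | (Finset.univ.filter fun w => y w ∈ B) = S} := fun S => by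
    rw [hsets]
    refine MeasurableSet.univ_pi fun w => ?_
    split_ifs
    exacts [hB, hB.compl]
  have hvol : ∀ S : Finset (Fin m), (Measure.pi fun _ : Fin m => μ)
      {y : Fin m → X | (Finset.univ.filter fun w => y w ∈ B) = S}
      = ENNReal.ofReal (μ.real B ^ S.card * (1 - μ.real B) ^ (m - S.card)) := fun S => by
    have h1 : μ B = ENNReal.ofReal (μ.real B) := by simp
    have h2 : μ Bᶜ = ENNReal.ofReal (1 - μ.real B) := by
      rw [← probReal_compl_eq_one_sub hB]; simp
    rw [hsets, Measure.pi_pi]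
    simp only [apply_ite μ]
    rw [Finset.prod_ite, Finset.prod_const, Finset.prod_const, h1, h2,
      ENNReal.ofReal_mul (by positivity), ENNReal.ofReal_pow hp0,
      ENNReal.ofReal_pow (by linarith)]
    simp [Finset.filter_not, ← Finset.compl_eq_univ_sdiff, Finset.card_compl]
  have hpt : ∀ y : Fin m → X, F (Finset.univ.filter fun w => y w ∈ B).card
      = ∑ S : Finset (Fin m),
        {y : Fin m → X | (Finset.univ.filter fun w => y w ∈ B) = S}.indicator
          (fun _ => F S.card) y := fun y => by
    simp [indicator_apply]
  simp_rw [hpt]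
  rw [lintegral_finsetSum _ fun S _ => measurable_const.indicator (hmeas S)]
  simp_rw [lintegral_indicator_const (hmeas _), hvol]
  have hU : (Finset.univ : Finset (Finset (Fin m))) = (Finset.univ : Finset (Fin m)).powerset := by
    simp
  rw [hU, Finset.sum_powerset_apply_card
    (fun j => F j * ENNReal.ofReal (μ.real B ^ j * (1 - μ.real B) ^ (m - j)))]
  simp only [Finset.card_univ, Fintype.card_fin, nsmul_eq_mul]
  refine Finset.sum_congr rfl fun j _ => ?_
  unfold binomWeight
  rw [mul_assoc, ENNReal.ofReal_mul (Nat.cast_nonneg _), ENNReal.ofReal_natCast]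
  ring

lemma measurable_degCount {n : ℕ} {A : Set (X × X)} (hA : MeasurableSet A) (v : Fin n) :
    Measurable fun x : Fin n → X => degCount A x v := by
  classical
  unfold degCount
  simp_rw [Finset.card_filter]
  refine Finset.measurable_sum _ fun w _ => Measurable.ite ?_ measurable_const measurable_const
  refine (MeasurableSet.const _).inter ?_
  exact ((measurable_pi_apply v).prodMk (measurable_pi_apply w)) hA

/-- Given the position `a` of a vertex, its degree is binomial with success probability
`nbrProb μ A a`. -/
theorem lintegral_degCount [IsProbabilityMeasure μ] {m : ℕ} {A : Set (X × X)}
    (hA : MeasurableSet A) (v : Fin (m + 1)) {F : X → ℕ → ENNReal}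
    (hF : ∀ j, Measurable fun a => F a j) :
    ∫⁻ x, F (x v) (degCount A x v) ∂(Measure.pi fun _ : Fin (m + 1) => μ)
      = ∫⁻ a, ∑ j ∈ Finset.range (m + 1),
          ENNReal.ofReal (binomWeight m j (nbrProb μ A a)) * F a j ∂μ := by
  have hF' : Measurable fun z : X × ℕ => F z.1 z.2 := measurable_from_prod_countable_left hF
  have hG : Measurable fun x : Fin (m + 1) → X => F (x v) (degCount A x v) :=
    hF'.comp ((measurable_pi_apply v).prodMk (measurable_degCount hA v))
  have h := (measurePreserving_piFinSuccAbove (fun _ : Fin (m + 1) => μ) v).symm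
  rw [← h.lintegral_comp hG]
  refine (lintegral_prod _ (hG.comp h.measurable).aemeasurable).trans ?_
  refine lintegral_congr fun a => ?_
  rw [nbrProb, ← lintegral_pi_card μ (B := {b | (a, b) ∈ A}) (measurable_prodMk_left hA) (F a)]
  refine lintegral_congr fun y => ?_
  rw [← degCount_insertNth A v]
  simp [Fin.insertNthEquiv]

end RandomGraph

/-! ### Concentration of vertex counts -/

section Concentration

variable {X : Type*}

open Classical in
/-- The number of vertices of degree `k`. -/
noncomputable def degEqCount {n : ℕ} (A : Set (X × X)) (k : ℕ) (x : Fin n → X) : ℕ :=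
  (Finset.univ.filter fun v => degCount A x v = k).card

open Classical in
/-- The number of vertices of degree `k` once the vertex `i` has been deleted. -/
noncomputable def degEqCountErase {n : ℕ} (A : Set (X × X)) (k : ℕ) (i : Fin n)
    (x : Fin n → X) : ℕ :=
  (Finset.univ.filter fun v => v ≠ i ∧
    (Finset.univ.filter fun w => (w ≠ v ∧ w ≠ i) ∧ (x v, x w) ∈ A).card = k).card

open Classical in
lemma degEqCountErase_update {n : ℕ} (A : Set (X × X)) (k : ℕ) (i : Fin n) (x : Fin n → X)
    (a : X) : degEqCountErase A k i (Function.update x i a) = degEqCountErase A k i x := by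
  unfold degEqCountErase
  congr 1
  refine Finset.filter_congr fun v _ => and_congr_right fun hv => ?_
  rw [Function.update_of_ne hv]
  suffices h : ∀ w : Fin n, ((w ≠ v ∧ w ≠ i) ∧ (x v, Function.update x i a w) ∈ A)
      ↔ ((w ≠ v ∧ w ≠ i) ∧ (x v, x w) ∈ A) by simp only [h]
  exact fun w => and_congr_right fun hw => by rw [Function.update_of_ne hw.2]

open Classical in
/-- Deleting a vertex changes only its own degree and those of its neighbours. -/
lemma abs_degEqCount_sub_erase_le {n : ℕ} {A : Set (X × X)}
    (hsymm : ∀ a b, (a, b) ∈ A → (b, a) ∈ A) (k : ℕ) (i : Fin n) (x : Fin n → X) :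
    |(degEqCount A k x : ℝ) - degEqCountErase A k i x| ≤ 1 + degCount A x i := by
  set D := insert i (Finset.univ.filter fun w => w ≠ i ∧ (x i, x w) ∈ A)
  have hD : D.card ≤ degCount A x i + 1 := Finset.card_insert_le _ _
  have key : ∀ v ∉ D, (degCount A x v = k ↔ v ≠ i ∧
      (Finset.univ.filter fun w => (w ≠ v ∧ w ≠ i) ∧ (x v, x w) ∈ A).card = k) := fun v hv => by
    simp only [D, Finset.mem_insert, Finset.mem_filter, Finset.mem_univ, true_and, not_or,
      not_and] at hv
    have : (Finset.univ.filter fun w => (w ≠ v ∧ w ≠ i) ∧ (x v, x w) ∈ A)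
        = Finset.univ.filter fun w => w ≠ v ∧ (x v, x w) ∈ A := by
      refine Finset.filter_congr fun w _ => ?_
      refine ⟨fun h => ⟨h.1.1, h.2⟩, fun h => ⟨⟨h.1, ?_⟩, h.2⟩⟩
      rintro rfl
      exact hv.2 hv.1 (hsymm _ _ h.2)
    rw [this]
    exact (and_iff_right hv.1).symm
  have h1 : degEqCount A k x ≤ degEqCountErase A k i x + D.card := by
    refine (Finset.card_le_card ?_).trans (Finset.card_union_le _ _)
    intro v hv
    by_cases hvD : v ∈ D
    · exact Finset.mem_union_right _ hvD
    · refine Finset.mem_union_left _ ?_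
      simp only [Finset.mem_filter, Finset.mem_univ, true_and] at hv ⊢
      exact (key v hvD).1 hv
  have h2 : degEqCountErase A k i x ≤ degEqCount A k x + D.card := by
    refine (Finset.card_le_card ?_).trans (Finset.card_union_le _ _)
    intro v hv
    by_cases hvD : v ∈ D
    · exact Finset.mem_union_right _ hvD
    · refine Finset.mem_union_left _ ?_
      simp only [Finset.mem_filter, Finset.mem_univ, true_and] at hv ⊢
      exact (key v hvD).2 hv
  have h1' : (degEqCount A k x : ℝ) ≤ degEqCountErase A k i x + (degCount A x i + 1) := by
    exact_mod_cast h1.trans (by omega)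
  have h2' : (degEqCountErase A k i x : ℝ) ≤ degEqCount A k x + (degCount A x i + 1) := by
    exact_mod_cast h2.trans (by omega)
  rw [abs_le]; constructor <;> linarith

lemma degCount_le {n : ℕ} (A : Set (X × X)) (x : Fin n → X) (v : Fin n) : degCount A x v ≤ n :=
  (Finset.card_le_univ _).trans (by simp)

variable [MeasurableSpace X] (μ : Measure X) [IsProbabilityMeasure μ]

lemma measurable_degEqCount {n : ℕ} {A : Set (X × X)} (hA : MeasurableSet A) (k : ℕ) :
    Measurable fun x : Fin n → X => (degEqCount A k x : ℝ) := by
  unfold degEqCount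
  simp_rw [Finset.card_filter]
  refine Measurable.comp (measurable_from_top (f := fun j : ℕ => (j : ℝ))) ?_
  refine Finset.measurable_sum _ fun v _ => Measurable.ite ?_ measurable_const measurable_const
  exact measurableSet_eq_fun (measurable_degCount hA v) measurable_const

lemma measurable_degEqCountErase {n : ℕ} {A : Set (X × X)} (hA : MeasurableSet A) (k : ℕ)
    (i : Fin n) : Measurable fun x : Fin n → X => (degEqCountErase A k i x : ℝ) := by
  unfold degEqCountErase
  simp_rw [Finset.card_filter]
  refine Measurable.comp (measurable_from_top (f := fun j : ℕ => (j : ℝ))) ?_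
  refine Finset.measurable_sum _ fun v _ => Measurable.ite ?_ measurable_const measurable_const
  refine (MeasurableSet.const _).inter (measurableSet_eq_fun ?_ measurable_const)
  refine Finset.measurable_sum _ fun w _ => Measurable.ite ?_ measurable_const measurable_const
  exact (MeasurableSet.const _).inter (((measurable_pi_apply v).prodMk (measurable_pi_apply w)) hA)

/-- The second moment of `1 + deg v`, bounded through the binomial law of the degree by the first two
moments of the neighbourhood probability. -/
lemma integral_sq_degCount_le {m : ℕ} {A : Set (X × X)} (hA : MeasurableSet A) (v : Fin (m + 1)) :
    ∫ x, (1 + degCount A x v : ℝ) ^ 2 ∂(Measure.pi fun _ : Fin (m + 1) => μ)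
      ≤ 2 + 2 * ((m + 1 : ℕ) * ∫ a, nbrProb μ A a ∂μ)
        + 2 * (((m + 1 : ℕ) : ℝ) ^ 2 * ∫ a, nbrProb μ A a ^ 2 ∂μ) := by
  have hp0 := nbrProb_nonneg μ A
  have hp1 := nbrProb_le_one μ A
  have hpm := measurable_nbrProb μ hA
  have hI1 : Integrable (nbrProb μ A) μ := integrable_of_abs_le (c := 1) hpm fun a => by
    rw [abs_of_nonneg (hp0 a)]; exact hp1 a
  have hI2 : Integrable (fun a => nbrProb μ A a ^ 2) μ :=
    integrable_of_abs_le (c := 1) (hpm.pow_const 2) fun a => by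
      rw [abs_of_nonneg (sq_nonneg _)]; exact pow_le_one₀ (hp0 a) (hp1 a)
  have hmeas : Measurable fun x : Fin (m + 1) → X => (1 + degCount A x v : ℝ) ^ 2 :=
    ((measurable_from_top (f := fun j : ℕ => (j : ℝ))).comp
      (measurable_degCount hA v)).const_add 1 |>.pow_const 2
  rw [integral_eq_lintegral_of_nonneg_ae (ae_of_all _ fun x => sq_nonneg _)
    hmeas.aestronglyMeasurable]
  have h := lintegral_degCount μ hA v (F := fun _ j => ENNReal.ofReal ((1 + j : ℝ) ^ 2))
    (fun j => measurable_const)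
  rw [h]
  set q : X → ℝ := fun a => 2 + 2 * ((m + 1 : ℕ) * nbrProb μ A a)
    + 2 * (((m + 1 : ℕ) : ℝ) ^ 2 * nbrProb μ A a ^ 2)
  have hq : ∀ a, ∑ j ∈ Finset.range (m + 1), ENNReal.ofReal (binomWeight m j (nbrProb μ A a))
      * ENNReal.ofReal ((1 + j : ℝ) ^ 2) ≤ ENNReal.ofReal (q a) := fun a => by
    simp_rw [← ENNReal.ofReal_mul (binomWeight_nonneg (hp0 a) (hp1 a))]
    rw [← ENNReal.ofReal_sum_of_nonneg fun j _ => mul_nonneg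
      (binomWeight_nonneg (hp0 a) (hp1 a)) (sq_nonneg _)]
    refine ENNReal.ofReal_le_ofReal ?_
    have h1 : ∀ j ∈ Finset.range (m + 1), binomWeight m j (nbrProb μ A a) * (1 + j : ℝ) ^ 2
        ≤ 2 * binomWeight m j (nbrProb μ A a)
          + 2 * ((j : ℝ) ^ 2 * binomWeight m j (nbrProb μ A a)) := fun j _ => by
      have := binomWeight_nonneg (m := m) (j := j) (hp0 a) (hp1 a)
      nlinarith [mul_nonneg this (sq_nonneg ((j : ℝ) - 1))]
    refine (Finset.sum_le_sum h1).trans ?_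
    rw [Finset.sum_add_distrib, ← Finset.mul_sum, ← Finset.mul_sum, sum_binomWeight,
      sum_sq_mul_binomWeight]
    simp only [q]
    push_cast
    have := hp0 a
    have := hp1 a
    have hm : (0 : ℝ) ≤ m := Nat.cast_nonneg m
    nlinarith [mul_nonneg hm (sq_nonneg (nbrProb μ A a)), sq_nonneg (nbrProb μ A a)]
  have hqint : ∫ a, q a ∂μ = 2 + 2 * ((m + 1 : ℕ) * ∫ a, nbrProb μ A a ∂μ)
        + 2 * (((m + 1 : ℕ) : ℝ) ^ 2 * ∫ a, nbrProb μ A a ^ 2 ∂μ) := by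
    have e1 : Integrable (fun a => 2 * (((m + 1 : ℕ) : ℝ) * nbrProb μ A a)) μ :=
      (hI1.const_mul _).const_mul _
    have e2 : Integrable (fun a => 2 * (((m + 1 : ℕ) : ℝ) ^ 2 * nbrProb μ A a ^ 2)) μ :=
      (hI2.const_mul _).const_mul _
    have e3 : Integrable (fun a => 2 + 2 * (((m + 1 : ℕ) : ℝ) * nbrProb μ A a)) μ :=
      (integrable_const _).add e1
    simp only [q]
    rw [integral_add e3 e2, integral_add (integrable_const _) e1]
    simp only [integral_const_mul]
    simp
  have hq0 : ∀ a, 0 ≤ q a := fun a => by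
    have := hp0 a
    simp only [q]; positivity
  have hqI : Integrable q μ :=
    ((integrable_const _).add ((hI1.const_mul _).const_mul _)).add ((hI2.const_mul _).const_mul _)
  rw [← hqint, integral_eq_lintegral_of_nonneg_ae (ae_of_all _ hq0) hqI.aestronglyMeasurable]
  refine ENNReal.toReal_mono ?_ (lintegral_mono hq)
  rw [← ofReal_integral_eq_lintegral_ofReal hqI (ae_of_all _ hq0)]
  exact ENNReal.ofReal_ne_top

lemma measureReal_degCount_eq {m : ℕ} {A : Set (X × X)} (hA : MeasurableSet A) (v : Fin (m + 1))
    (k : ℕ) :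
    (Measure.pi fun _ : Fin (m + 1) => μ).real {x | degCount A x v = k}
      = ∫ a, binomWeight m k (nbrProb μ A a) ∂μ := by
  have hp0 := nbrProb_nonneg μ A
  have hp1 := nbrProb_le_one μ A
  have h := lintegral_degCount μ hA v (F := fun _ j => if j = k then 1 else 0)
    (fun j => measurable_const)
  have hms : MeasurableSet {x : Fin (m + 1) → X | degCount A x v = k} :=
    measurableSet_eq_fun (measurable_degCount hA v) measurable_const
  have h1 : ∫⁻ x, (if degCount A x v = k then 1 else 0)
        ∂(Measure.pi fun _ : Fin (m + 1) => μ)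
      = (Measure.pi fun _ : Fin (m + 1) => μ) {x | degCount A x v = k} := by
    rw [← lintegral_indicator_one hms]
    refine lintegral_congr fun x => ?_
    simp [indicator_apply]
  rw [measureReal_def, ← h1, h, integral_eq_lintegral_of_nonneg_ae
    (ae_of_all _ fun a => binomWeight_nonneg (hp0 a) (hp1 a))
    ((measurable_binomWeight m k).comp (measurable_nbrProb μ hA)).aestronglyMeasurable]
  congr 1
  refine lintegral_congr fun a => ?_
  simp only [mul_ite, mul_one, mul_zero, Finset.sum_ite_eq', Finset.mem_range]
  split_ifs with hk
  · rfl
  · rw [binomWeight, Nat.choose_eq_zero_of_lt (by omega)]; simp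

lemma integral_degEqCount {m : ℕ} {A : Set (X × X)} (hA : MeasurableSet A) (k : ℕ) :
    ∫ x, (degEqCount A k x : ℝ) ∂(Measure.pi fun _ : Fin (m + 1) => μ)
      = (m + 1 : ℕ) * ∫ a, binomWeight m k (nbrProb μ A a) ∂μ := by
  have hms : ∀ v, MeasurableSet {x : Fin (m + 1) → X | degCount A x v = k} := fun v =>
    measurableSet_eq_fun (measurable_degCount hA v) measurable_const
  have h1 : ∀ x : Fin (m + 1) → X, (degEqCount A k x : ℝ)
      = ∑ v, {x : Fin (m + 1) → X | degCount A x v = k}.indicator (fun _ => (1 : ℝ)) x := fun x => by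
    simp [degEqCount, indicator_apply, Finset.sum_boole]
  simp_rw [h1]
  rw [integral_finsetSum _ fun v _ => (integrable_const _).indicator (hms v)]
  simp_rw [integral_indicator_const _ (hms _), measureReal_degCount_eq μ hA]
  simp

/-- Chebyshev's inequality for a bounded function. -/
lemma measureReal_abs_sub_integral_ge_le {Y : Type*} [MeasurableSpace Y] {ν : Measure Y}
    [IsProbabilityMeasure ν] {f : Y → ℝ} (hf : Measurable f) {c : ℝ} (hc : ∀ y, |f y| ≤ c) {V : ℝ}
    (hV : ∫ y, f y ^ 2 ∂ν - (∫ y, f y ∂ν) ^ 2 ≤ V) {t : ℝ} (ht : 0 < t) :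
    ν.real {y | t ≤ |f y - ∫ y, f y ∂ν|} ≤ V / t ^ 2 := by
  have h1 := integral_sub_sq ν hf hc (∫ y, f y ∂ν)
  have h2 := mul_meas_ge_le_integral_of_nonneg (μ := ν) (f := fun y => (f y - ∫ y, f y ∂ν) ^ 2)
    (ae_of_all _ fun y => sq_nonneg _)
    (integrable_of_abs_le (c := (2 * c) ^ 2) ((hf.sub_const _).pow_const 2) fun y => by
      rw [abs_pow]
      refine pow_le_pow_left₀ (abs_nonneg _) ((abs_sub _ _).trans ?_) 2
      have := norm_integral_le_of_norm_le_const (μ := ν) (f := f) (C := c) (ae_of_all _ hc)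
      simp only [Real.norm_eq_abs, probReal_univ, mul_one] at this
      linarith [hc y]) (t ^ 2)
  have h3 : {y | t ^ 2 ≤ (f y - ∫ y, f y ∂ν) ^ 2} = {y | t ≤ |f y - ∫ y, f y ∂ν|} := by
    ext y
    simp only [mem_ofPred_eq]
    rw [← sq_abs (f y - _)]
    exact pow_le_pow_iff_left₀ ht.le (abs_nonneg _) two_ne_zero
  rw [h3] at h2
  rw [le_div_iff₀ (by positivity)]
  nlinarith

/-- The number of vertices of degree `k` is concentrated around its mean. By the Efron–Stein
inequality its variance is controlled by the second moment of the degrees. -/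
theorem measureReal_degEqCount_sub_ge_le {m : ℕ} {A : Set (X × X)} (hA : MeasurableSet A)
    (hsymm : ∀ a b, (a, b) ∈ A → (b, a) ∈ A) (k : ℕ) {t : ℝ} (ht : 0 < t) :
    (Measure.pi fun _ : Fin (m + 1) => μ).real
        {x | t ≤ |(degEqCount A k x : ℝ)
          - (m + 1 : ℕ) * ∫ a, binomWeight m k (nbrProb μ A a) ∂μ|}
      ≤ ((m + 1 : ℕ) * (2 + 2 * ((m + 1 : ℕ) * ∫ a, nbrProb μ A a ∂μ)
        + 2 * (((m + 1 : ℕ) : ℝ) ^ 2 * ∫ a, nbrProb μ A a ^ 2 ∂μ))) / t ^ 2 := by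
  have hb : ∀ x : Fin (m + 1) → X, |(degEqCount A k x : ℝ)| ≤ (m + 1 : ℕ) := fun x => by
    rw [abs_of_nonneg (Nat.cast_nonneg _)]
    exact_mod_cast (Finset.card_le_univ _).trans (by simp)
  have hb' : ∀ i, ∀ x : Fin (m + 1) → X, |(degEqCountErase A k i x : ℝ)| ≤ (m + 1 : ℕ) :=
    fun i x => by
    rw [abs_of_nonneg (Nat.cast_nonneg _)]
    exact_mod_cast (Finset.card_le_univ _).trans (by simp)
  rw [← integral_degEqCount μ hA]
  refine measureReal_abs_sub_integral_ge_le (measurable_degEqCount hA k) hb ?_ ht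
  refine (integral_sq_sub_sq_integral_le_sum μ (measurable_degEqCount hA k)
    (measurable_degEqCountErase hA k) hb hb' fun i x a => by
      rw [degEqCountErase_update]).trans ?_
  refine (Finset.sum_le_card_nsmul _ _ _ fun i _ => ?_).trans_eq (by
    rw [Finset.card_univ, Fintype.card_fin, nsmul_eq_mul])
  refine le_trans ?_ (integral_sq_degCount_le μ hA i)
  have hmeas : Measurable fun x : Fin (m + 1) → X => (1 + degCount A x i : ℝ) :=
    ((measurable_from_top (f := fun j : ℕ => (j : ℝ))).comp
      (measurable_degCount hA i)).const_add 1
  refine integral_mono (integrable_of_abs_le (c := (2 * (m + 1 : ℕ)) ^ 2)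
    (((measurable_degEqCount hA k).sub (measurable_degEqCountErase hA k i)).pow_const 2) fun x => ?_)
    (integrable_of_abs_le (c := (1 + (m + 1 : ℕ)) ^ 2) (hmeas.pow_const 2) fun x => ?_) fun x => ?_
  · rw [abs_pow]
    exact pow_le_pow_left₀ (abs_nonneg _)
      ((abs_sub _ _).trans (by linarith [hb x, hb' i x])) 2
  · rw [abs_pow, abs_of_nonneg (by positivity)]
    have : (degCount A x i : ℝ) ≤ (m + 1 : ℕ) := by exact_mod_cast degCount_le A x i
    gcongr
  · exact sq_le_sq' (by linarith [abs_le.1 (abs_degEqCount_sub_erase_le hsymm k i x)])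
      (abs_le.1 (abs_degEqCount_sub_erase_le hsymm k i x)).2

open Classical in
/-- The number of independent points falling in a set is concentrated around its mean. -/
theorem measureReal_card_sub_ge_le {n : ℕ} {E : Set X} (hE : MeasurableSet E) {t : ℝ}
    (ht : 0 < t) :
    (Measure.pi fun _ : Fin n => μ).real
        {x | t ≤ |((Finset.univ.filter fun v => x v ∈ E).card : ℝ) - n * μ.real E|}
      ≤ n * μ.real E / t ^ 2 := by
  set π := Measure.pi fun _ : Fin n => μ
  set f : (Fin n → X) → ℝ := fun x => ((Finset.univ.filter fun v => x v ∈ E).card : ℝ)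
  set e : Fin n → (Fin n → X) → ℝ := fun v x => E.indicator (fun _ => (1 : ℝ)) (x v)
  have he : ∀ v, Measurable (e v) := fun v =>
    (measurable_const.indicator hE).comp (measurable_pi_apply v)
  have he01 : ∀ v x, 0 ≤ e v x ∧ e v x ≤ 1 := fun v x => by
    by_cases h : x v ∈ E <;> simp [e, h]
  have hfe : ∀ x, f x = ∑ v, e v x := fun x => by
    simp [f, e, indicator_apply, Finset.sum_boole]
  have hf : Measurable f := by
    simp_rw [funext hfe]
    exact Finset.measurable_sum _ fun v _ => he v
  have hsum : ∀ S : Finset (Fin n), ∀ x, |∑ v ∈ S, e v x| ≤ n := fun S x => by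
    rw [abs_of_nonneg (Finset.sum_nonneg fun v _ => (he01 v x).1)]
    refine (Finset.sum_le_card_nsmul _ _ 1 fun v _ => (he01 v x).2).trans ?_
    have : S.card ≤ n := (Finset.card_le_univ _).trans (by simp)
    simpa using this
  have hemean : ∀ v, ∫ x, e v x ∂π = μ.real E := fun v => by
    have hmp := measurePreserving_eval (fun _ : Fin n => μ) v
    have h := integral_map (μ := π) hmp.measurable.aemeasurable (f := E.indicator fun _ => (1 : ℝ))
      (measurable_const.indicator hE).aestronglyMeasurable
    rw [hmp.map_eq, integral_indicator_const _ hE] at h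
    simpa using h.symm
  have hint : ∀ v, Integrable (e v) π := fun v => integrable_of_abs_le (c := 1) (he v) fun x => by
    rw [abs_of_nonneg (he01 v x).1]; exact (he01 v x).2
  have hmean : ∫ x, f x ∂π = n * μ.real E := by
    simp_rw [hfe]
    rw [integral_finsetSum _ fun v _ => hint v]
    simp [hemean]
  rw [← hmean]
  refine measureReal_abs_sub_integral_ge_le hf (c := n) (fun x => by rw [hfe]; exact hsum _ x) ?_ ht
  refine (integral_sq_sub_sq_integral_le_sum μ hf
    (g := fun i x => ∑ v ∈ Finset.univ.erase i, e v x)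
    (fun i => Finset.measurable_sum _ fun v _ => he v) (c := n)
    (fun x => by rw [hfe]; exact hsum _ x) (fun i x => hsum _ x) fun i x a => ?_).trans ?_
  · refine Finset.sum_congr rfl fun v hv => ?_
    simp only [e]
    rw [Function.update_of_ne (Finset.ne_of_mem_erase hv)]
  · rw [hmean]
    refine (Finset.sum_le_card_nsmul _ _ (μ.real E) fun i _ => ?_).trans_eq (by simp)
    rw [← hemean i]
    refine integral_mono_of_nonneg (ae_of_all _ fun x => sq_nonneg _) (hint i)
      (ae_of_all _ fun x => ?_)
    simp only [hfe]
    rw [← Finset.add_sum_erase _ _ (Finset.mem_univ i), add_sub_cancel_right]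
    nlinarith [he01 i x]

/-- A union bound: if the degree of a vertex placed in `E` lies in `S` with probability at most
`q`, then there is such a vertex with probability at most `n q`. -/
theorem measure_exists_degCount_mem_le {m : ℕ} {A : Set (X × X)} (hA : MeasurableSet A)
    {E : Set X} (hE : MeasurableSet E) (S : Set ℕ) [DecidablePred (· ∈ S)] {q : ℝ}
    (hq : ∀ a ∈ E, ∑ j ∈ Finset.range (m + 1) with j ∈ S, binomWeight m j (nbrProb μ A a) ≤ q) :
    (Measure.pi fun _ : Fin (m + 1) => μ) {x | ∃ v, x v ∈ E ∧ degCount A x v ∈ S}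
      ≤ ENNReal.ofReal ((m + 1 : ℕ) * q) := by
  classical
  have hp0 := nbrProb_nonneg μ A
  have hp1 := nbrProb_le_one μ A
  have h1 : {x : Fin (m + 1) → X | ∃ v, x v ∈ E ∧ degCount A x v ∈ S}
      = ⋃ v, {x | x v ∈ E ∧ degCount A x v ∈ S} := by
    ext x; simp
  have h2 : ∀ v, (Measure.pi fun _ : Fin (m + 1) => μ) {x | x v ∈ E ∧ degCount A x v ∈ S}
      ≤ ENNReal.ofReal q := fun v => by
    have hms : MeasurableSet {x : Fin (m + 1) → X | x v ∈ E ∧ degCount A x v ∈ S} :=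
      (measurable_pi_apply v hE).inter (measurable_degCount hA v (MeasurableSet.of_discrete))
    have h := lintegral_degCount μ hA v
      (F := fun a j => if a ∈ E ∧ j ∈ S then 1 else 0)
      (fun j => Measurable.ite (hE.inter (MeasurableSet.const _)) measurable_const measurable_const)
    rw [← one_mul (Measure.pi _ _), ← lintegral_indicator_const hms]
    have h3 : ∀ x : Fin (m + 1) → X,
        {x : Fin (m + 1) → X | x v ∈ E ∧ degCount A x v ∈ S}.indicator (fun _ => (1 : ENNReal)) x
          = if x v ∈ E ∧ degCount A x v ∈ S then 1 else 0 := fun x => by simp [indicator_apply]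
    simp_rw [h3]
    rw [h]
    calc ∫⁻ a, ∑ j ∈ Finset.range (m + 1), ENNReal.ofReal (binomWeight m j (nbrProb μ A a))
          * (if a ∈ E ∧ j ∈ S then 1 else 0) ∂μ ≤ ∫⁻ _, ENNReal.ofReal q ∂μ := by
          refine lintegral_mono fun a => ?_
          by_cases ha : a ∈ E
          · simp only [ha, true_and, mul_ite, mul_one, mul_zero]
            rw [← Finset.sum_filter, ← ENNReal.ofReal_sum_of_nonneg fun j _ =>
              binomWeight_nonneg (hp0 a) (hp1 a)]
            exact ENNReal.ofReal_le_ofReal (hq a ha)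
          · simp [ha]
      _ = ENNReal.ofReal q := by simp
  rw [h1]
  refine (measure_iUnion_le _).trans ((ENNReal.tsum_le_tsum h2).trans_eq ?_)
  rw [tsum_fintype, Finset.sum_const, Finset.card_univ, Fintype.card_fin, nsmul_eq_mul,
    ENNReal.ofReal_mul (Nat.cast_nonneg _), ENNReal.ofReal_natCast]

end Concentration

/-! ### The connection probability of two vertices with given radii -/

section Angle

/-- The probability that two vertices at radii `r` and `r'` are adjacent, in terms of the sine
of half the largest admissible angle between them. -/
noncomputable def angleProb (R r r' : ℝ) : ℝ :=
  2 / Real.pi * Real.arcsin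
    (√((Real.cosh R - Real.cosh (r - r')) / (2 * (Real.sinh r * Real.sinh r'))))

lemma angleProb_nonneg (R r r' : ℝ) : 0 ≤ angleProb R r r' := by
  have := Real.pi_pos
  have := Real.arcsin_nonneg.2
    (Real.sqrt_nonneg ((Real.cosh R - Real.cosh (r - r')) / (2 * (Real.sinh r * Real.sinh r'))))
  unfold angleProb; positivity

lemma angleProb_le_one (R r r' : ℝ) : angleProb R r r' ≤ 1 := by
  have hpi := Real.pi_pos
  have := Real.arcsin_le_pi_div_two
    (√((Real.cosh R - Real.cosh (r - r')) / (2 * (Real.sinh r * Real.sinh r'))))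
  unfold angleProb
  calc _ ≤ 2 / Real.pi * (Real.pi / 2) := by gcongr
    _ = 1 := by field_simp

lemma measurable_angleProb (R r : ℝ) : Measurable (angleProb R r) := by
  unfold angleProb
  refine measurable_const.mul (Real.continuous_arcsin.measurable.comp ?_)
  fun_prop

lemma cosh_sub_le_cosh {R r r' : ℝ} (hr : 0 < r) (hr' : 0 < r') (hrR : r ≤ R) (hrR' : r' ≤ R) :
    Real.cosh (r - r') ≤ Real.cosh R := by
  rw [Real.cosh_le_cosh, abs_of_pos (hr.trans_le hrR), abs_le]
  constructor <;> linarith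

lemma hypDist_le_iff {R r r' φ : ℝ} (hr : 0 < r) (hr' : 0 < r') (hrR : r ≤ R) (hrR' : r' ≤ R) :
    hypDist r r' φ ≤ R ↔ |Real.sin (φ / 2)|
      ≤ √((Real.cosh R - Real.cosh (r - r')) / (2 * (Real.sinh r * Real.sinh r'))) := by
  have hs : 0 < Real.sinh r * Real.sinh r' :=
    mul_pos (Real.sinh_pos_iff.2 hr) (Real.sinh_pos_iff.2 hr')
  have hR : 0 ≤ R := hr.le.trans hrR
  have hD := cosh_sub_le_cosh hr hr' hrR hrR'
  have hcos : Real.cos φ = 1 - 2 * Real.sin (φ / 2) ^ 2 := by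
    have h := Real.cos_two_mul (φ / 2)
    rw [mul_div_cancel₀ _ (two_ne_zero' ℝ)] at h
    have := Real.sin_sq_add_cos_sq (φ / 2)
    linarith
  have h1 : Real.cosh r * Real.cosh r' - Real.sinh r * Real.sinh r' * Real.cos φ
      = Real.cosh (r - r') + 2 * (Real.sinh r * Real.sinh r') * Real.sin (φ / 2) ^ 2 := by
    rw [Real.cosh_sub, hcos]; ring
  have h2 : 1 ≤ Real.cosh r * Real.cosh r' - Real.sinh r * Real.sinh r' * Real.cos φ := by
    rw [h1]
    have := Real.one_le_cosh (r - r')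
    have : 0 ≤ 2 * (Real.sinh r * Real.sinh r') * Real.sin (φ / 2) ^ 2 := by positivity
    linarith
  unfold hypDist
  rw [← Real.arcosh_cosh hR, Real.arcosh_le_arcosh (by linarith) (by positivity),
    Real.arcosh_cosh hR, h1, Real.le_sqrt (abs_nonneg _), sq_abs, le_div_iff₀ (by positivity)]
  · constructor <;> intro h <;> linarith
  · exact div_nonneg (sub_nonneg.2 hD) (by positivity)

lemma volume_abs_sin_half_le {s : ℝ} (hs : 0 ≤ s) :
    (volume.restrict (Icc (-Real.pi) Real.pi)).real {φ | |Real.sin (φ / 2)| ≤ s}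
      = 4 * Real.arcsin s := by
  have hpi := Real.pi_pos
  have h0 := Real.arcsin_nonneg.2 hs
  have h1 := Real.arcsin_le_pi_div_two s
  have hset : {φ | |Real.sin (φ / 2)| ≤ s} ∩ Icc (-Real.pi) Real.pi
      = Icc (-(2 * Real.arcsin s)) (2 * Real.arcsin s) := by
    ext φ
    simp only [mem_inter_iff, mem_ofPred_eq, mem_Icc, ← abs_le]
    have key : |φ| ≤ Real.pi → (|Real.sin (φ / 2)| ≤ s ↔ |φ| ≤ 2 * Real.arcsin s) := fun h => by
      have hh : |φ / 2| = |φ| / 2 := by rw [abs_div, abs_two]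
      have : |Real.sin (φ / 2)| = Real.sin (|φ| / 2) := by
        rw [← hh, Real.abs_sin_eq_sin_abs_of_abs_le_pi (by rw [hh]; linarith)]
      rw [this, ← Real.le_arcsin_iff_sin_le' ⟨by linarith [abs_nonneg φ], by linarith⟩]
      constructor <;> intro <;> linarith
    constructor
    · rintro ⟨h2, h3⟩; exact (key h3).1 h2
    · intro h2
      have h3 : |φ| ≤ Real.pi := by linarith
      exact ⟨(key h3).2 h2, h3⟩
  rw [measureReal_restrict_apply' measurableSet_Icc, hset, Real.volume_real_Icc_of_le (by linarith)]
  ring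

instance : IsProbabilityMeasure angularLaw := ⟨by
  have := Real.pi_pos
  rw [angularLaw, Measure.smul_apply, Measure.restrict_apply_univ, Real.volume_Icc, smul_eq_mul,
    ← ENNReal.ofReal_mul (by positivity)]
  rw [← ENNReal.ofReal_one]; congr 1; field_simp; ring⟩

/-- The uniform law on `[-π, π]` is invariant under rotations and reflections of the circle. -/
lemma angularLaw_real_sub {S : Set ℝ} (hS : MeasurableSet S)
    (hper : ∀ φ, φ + 2 * Real.pi ∈ S ↔ φ ∈ S) (θ : ℝ) :
    angularLaw.real {θ' | θ - θ' ∈ S} = angularLaw.real S := by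
  have hpi := Real.pi_pos
  classical
  have h1 : ∀ T : Set ℝ, MeasurableSet T → angularLaw.real T
      = 1 / (2 * Real.pi) * ∫ t in (-Real.pi)..Real.pi, T.indicator (fun _ => (1 : ℝ)) t := by
    intro T hT
    rw [intervalIntegral.integral_of_le (by linarith), ← integral_Icc_eq_integral_Ioc,
      integral_indicator_const _ hT, angularLaw, measureReal_ennreal_smul_apply]
    simp [hpi.le]
  have hP : Function.Periodic (S.indicator fun _ => (1 : ℝ)) (2 * Real.pi) := fun φ => by
    simp only [indicator_apply, hper]
  rw [h1 _ hS, h1 {θ' | θ - θ' ∈ S} ((measurable_const_sub θ) hS)]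
  congr 1
  have h2 : ∀ t, ({θ' | θ - θ' ∈ S}.indicator (fun _ => (1 : ℝ)) t)
      = S.indicator (fun _ => (1 : ℝ)) (θ - t) := fun t => by simp [indicator_apply]
  simp_rw [h2]
  rw [intervalIntegral.integral_comp_sub_left (fun t => S.indicator (fun _ => (1 : ℝ)) t) θ]
  have h3 := hP.intervalIntegral_add_eq (θ - Real.pi) (-Real.pi)
  rw [show θ - Real.pi + 2 * Real.pi = θ - -Real.pi by ring,
    show -Real.pi + 2 * Real.pi = Real.pi by ring] at h3
  exact h3

lemma angularLaw_real_hypDist_le {R r r' : ℝ} (hr : 0 < r) (hr' : 0 < r') (hrR : r ≤ R)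
    (hrR' : r' ≤ R) (θ : ℝ) :
    angularLaw.real {θ' | hypDist r r' (θ - θ') ≤ R} = angleProb R r r' := by
  have hpi := Real.pi_pos
  simp_rw [hypDist_le_iff hr hr' hrR hrR']
  set s := √((Real.cosh R - Real.cosh (r - r')) / (2 * (Real.sinh r * Real.sinh r')))
  have hS : MeasurableSet {φ : ℝ | |Real.sin (φ / 2)| ≤ s} :=
    measurableSet_le (by fun_prop) measurable_const
  have h1 := angularLaw_real_sub hS (fun φ => by
    simp only [mem_ofPred_eq]
    rw [show (φ + 2 * Real.pi) / 2 = φ / 2 + Real.pi by ring, Real.sin_add_pi, abs_neg]) θ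
  refine h1.trans ?_
  rw [angularLaw, measureReal_ennreal_smul_apply, volume_abs_sin_half_le (Real.sqrt_nonneg _),
    ENNReal.toReal_ofReal (by positivity), angleProb]
  field_simp
  norm_num

lemma le_arcsin {s : ℝ} (h0 : 0 ≤ s) (h1 : s ≤ 1) : s ≤ Real.arcsin s := by
  have := Real.sin_le (Real.arcsin_nonneg.2 h0)
  rwa [Real.sin_arcsin (by linarith) h1] at this

lemma arcsin_le {s : ℝ} (h0 : 0 ≤ s) (h1 : s ≤ 1) : Real.arcsin s ≤ s + 3 * s ^ 2 := by
  set y := Real.arcsin s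
  have hy0 : 0 ≤ y := Real.arcsin_nonneg.2 h0
  have hy1 : y ≤ Real.pi / 2 := Real.arcsin_le_pi_div_two s
  have hsin : Real.sin y = s := Real.sin_arcsin (by linarith) h1
  have h2 := Real.mul_le_sin hy0 hy1
  have h3 := Real.sin_ge_sub_cube hy0
  rw [hsin] at h2 h3
  have hpi : Real.pi < 4 := Real.pi_lt_four
  have hpi0 := Real.pi_pos
  have h4 : y ≤ 1.6 * s := by
    have : y ≤ Real.pi / 2 * s := by
      calc y = Real.pi / 2 * (2 / Real.pi * y) := by field_simp
        _ ≤ _ := by gcongr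
    nlinarith [Real.pi_lt_d2]
  have h5 : y ^ 3 ≤ (1.6 * s) ^ 3 := pow_le_pow_left₀ hy0 h4 3
  have h6 : s ^ 3 ≤ s ^ 2 := by nlinarith [sq_nonneg s]
  nlinarith

/-- Bounds for the squared sine of half the largest admissible angle, at `x = r + r' - R ≥ 0`. -/
lemma cosh_ratio_bounds {R r r' x b : ℝ} (hr : 0 < r) (hr' : 0 < r') (hrR : r ≤ R) (hrR' : r' ≤ R)
    (hx : x = r + r' - R) (hx0 : 0 ≤ x) (hb : b = Real.exp (-x)) :
    (b - 2 * b ^ 2) * (Real.cosh (r + r') - Real.cosh (r - r'))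
        ≤ Real.cosh R - Real.cosh (r - r') ∧
      Real.cosh R - Real.cosh (r - r') ≤ b * (Real.cosh (r + r') - Real.cosh (r - r')) := by
  have hb0 : 0 < b := hb ▸ Real.exp_pos _
  have hb1 : b ≤ 1 := hb ▸ Real.exp_le_one_iff.2 (by linarith)
  have hS : Real.cosh (r - r') ≤ Real.cosh (r + r') := by
    rw [Real.cosh_le_cosh, abs_of_pos (by linarith : 0 < r + r'), abs_le]
    constructor <;> linarith
  have hDR := cosh_sub_le_cosh hr hr' hrR hrR'
  have hD1 := Real.one_le_cosh (r - r')
  have hDx : Real.cosh (r - r') ≤ Real.cosh (R - x) := by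
    rw [Real.cosh_le_cosh, abs_of_nonneg (by linarith : 0 ≤ R - x), abs_le]
    constructor <;> linarith
  -- in terms of `E = e^R`, `F = e^{-R}` and `G = e^{x-R}` both bounds are polynomial
  obtain ⟨E, hE⟩ : ∃ E, E = Real.exp R := ⟨_, rfl⟩
  obtain ⟨F, hF⟩ : ∃ F, F = Real.exp (-R) := ⟨_, rfl⟩
  obtain ⟨G, hG⟩ : ∃ G, G = Real.exp (x - R) := ⟨_, rfl⟩
  have hF0 : 0 < F := hF ▸ Real.exp_pos _
  have hF1 : F ≤ 1 := hF ▸ Real.exp_le_one_iff.2 (by linarith)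
  have hcR : Real.cosh R = (E + F) / 2 := by rw [hE, hF, Real.cosh_eq]
  have hRx : Real.exp (R - x) = E * b := by rw [hb, hE, ← Real.exp_add]; rfl
  have hGE : G ≤ E * b := by rw [← hRx, hG]; exact Real.exp_le_exp.2 (by linarith)
  have hcx : Real.cosh (R - x) = (E * b + G) / 2 := by
    rw [Real.cosh_eq, hRx, neg_sub, hG]
  have hcS : b * Real.cosh (r + r') = (E + F * b ^ 2) / 2 := by
    have e1 : b * Real.exp (r + r') = E := by
      rw [hb, hE, ← Real.exp_add]; congr 1; rw [hx]; ring
    have e2 : Real.exp (-(r + r')) = F * b := by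
      rw [hb, hF, ← Real.exp_add]; congr 1; rw [hx]; ring
    rw [Real.cosh_eq, e2]; linear_combination e1 / 2
  rw [hcx] at hDx
  rw [hcR] at hDR ⊢
  generalize Real.cosh (r - r') = D at *
  constructor
  · rcases le_total (b - 2 * b ^ 2) 0 with h | h
    · exact (mul_nonpos_of_nonpos_of_nonneg h (sub_nonneg.2 hS)).trans (by linarith)
    · have h1 : (b - 2 * b ^ 2) * (Real.cosh (r + r') - D)
          = (1 - 2 * b) * ((E + F * b ^ 2) / 2) - (b - 2 * b ^ 2) * D := by
        rw [← hcS]; ring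
      have h2 : 0 ≤ (b - 2 * b ^ 2) * D := mul_nonneg h (by linarith)
      have h3 : (1 - 2 * b) * (F * b ^ 2) ≤ F := by
        have h4 : F * b ^ 2 ≤ F := mul_le_of_le_one_right hF0.le (pow_le_one₀ hb0.le hb1)
        have h5 : 0 ≤ 2 * b * (F * b ^ 2) := by positivity
        linarith
      rw [h1]
      linarith
  · rw [mul_sub, hcS]
    have h1 : 0 ≤ (1 - b) * (D - F * (1 + b) / 2) :=
      mul_nonneg (by linarith) (by nlinarith)
    linarith

/-- With `x = r + r' - R`, the connection probability is `(2 / π) e^{-x/2}` up to an error of order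
`e^{-x}` for `x ≥ 0`, and it is `1` for `x ≤ 0`; both cases are covered by one bound. -/
lemma abs_angleProb_sub_le {R r r' γ : ℝ} (hγ : 1 / 2 ≤ γ) (hγ1 : γ ≤ 1) (hr : 0 < r)
    (hr' : 0 < r') (hrR : r ≤ R) (hrR' : r' ≤ R) :
    |angleProb R r r' - 2 / Real.pi * Real.exp (-(r + r' - R) / 2)|
      ≤ 4 * Real.exp (-γ * (r + r' - R)) := by
  have hpi := Real.pi_pos
  have h2pi : 2 / Real.pi ≤ 1 := by
    rw [div_le_one hpi]; exact Real.two_le_pi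
  have h2pi0 : 0 < 2 / Real.pi := by positivity
  set x := r + r' - R with hx
  set q := (Real.cosh R - Real.cosh (r - r')) / (2 * (Real.sinh r * Real.sinh r')) with hq
  have hss : 2 * (Real.sinh r * Real.sinh r') = Real.cosh (r + r') - Real.cosh (r - r') := by
    rw [Real.cosh_add, Real.cosh_sub]; ring
  have hs : 0 < Real.cosh (r + r') - Real.cosh (r - r') := by
    rw [← hss]
    have := mul_pos (Real.sinh_pos_iff.2 hr) (Real.sinh_pos_iff.2 hr')
    positivity
  rw [hss] at hq
  rcases le_total x 0 with hx0 | hx0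
  · have hq1 : 1 ≤ q := by
      rw [hq, le_div_iff₀ hs]
      have : Real.cosh (r + r') ≤ Real.cosh R := by
        rw [Real.cosh_le_cosh, abs_of_pos (by linarith), abs_of_pos (by linarith)]; linarith
      linarith
    have h1 : angleProb R r r' = 1 := by
      rw [angleProb, hss, ← hq, Real.arcsin_of_one_le (Real.one_le_sqrt.2 hq1)]
      field_simp
    have h3 : Real.exp (-x / 2) ≤ Real.exp (-γ * x) := Real.exp_le_exp.2 (by nlinarith)
    have h4 : 1 ≤ Real.exp (-γ * x) := Real.one_le_exp (by nlinarith)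
    have h5 := Real.exp_pos (-x / 2)
    rw [h1, abs_le]
    constructor <;> nlinarith
  · set a := Real.exp (-x / 2) with ha
    have ha0 : 0 < a := Real.exp_pos _
    have ha1 : a ≤ 1 := Real.exp_le_one_iff.2 (by linarith)
    have ha2 : a ^ 2 = Real.exp (-x) := by rw [ha, ← Real.exp_nat_mul]; congr 1; push_cast; ring
    have hγa : a ^ 2 ≤ Real.exp (-γ * x) := by
      rw [ha2]; exact Real.exp_le_exp.2 (by nlinarith)
    obtain ⟨hql, hqu⟩ := cosh_ratio_bounds hr hr' hrR hrR' hx hx0 ha2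
    rw [← le_div_iff₀ hs, ← hq] at hql
    rw [← div_le_iff₀ hs, ← hq] at hqu
    have hsu : √q ≤ a := by
      rw [← Real.sqrt_sq ha0.le]; exact Real.sqrt_le_sqrt hqu
    have hsl : a - 2 * a ^ 2 ≤ √q := by
      rcases le_total (1 / 2) a with h | h
      · exact le_trans (by nlinarith) (Real.sqrt_nonneg q)
      · refine Real.le_sqrt_of_sq_le (le_trans ?_ hql)
        nlinarith [pow_pos ha0 3]
    have hs0 := Real.sqrt_nonneg q
    have hs1 : √q ≤ 1 := hsu.trans ha1
    have h1 := le_arcsin hs0 hs1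
    have h2 := arcsin_le hs0 hs1
    have h3 : √q ^ 2 ≤ a ^ 2 := pow_le_pow_left₀ hs0 hsu 2
    rw [angleProb, hss, ← hq, ← mul_sub, abs_mul, abs_of_pos h2pi0]
    have h4 : |Real.arcsin √q - a| ≤ 4 * Real.exp (-γ * x) := by
      rw [abs_le]; constructor <;> nlinarith
    calc _ ≤ 1 * (4 * Real.exp (-γ * x)) := by gcongr
      _ = _ := one_mul _

end Angle

/-! ### The radial law and the neighbourhood of a vertex -/

section Radial

/-- The density of the radial law. -/
noncomputable def radDens (α R r : ℝ) : ℝ := α * Real.sinh (α * r) / (Real.cosh (α * R) - 1)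

lemma continuous_radDens (α R : ℝ) : Continuous (radDens α R) := by
  unfold radDens; fun_prop

lemma cosh_sub_one_pos {α R : ℝ} (hα : 0 < α) (hR : 0 < R) : 0 < Real.cosh (α * R) - 1 :=
  sub_pos.2 (Real.one_lt_cosh.2 (mul_pos hα hR).ne')

lemma radDens_nonneg {α R r : ℝ} (hα : 0 < α) (hR : 0 < R) (hr : 0 ≤ r) : 0 ≤ radDens α R r :=
  div_nonneg (mul_nonneg hα.le (Real.sinh_nonneg_iff.2 (by positivity)))
    (cosh_sub_one_pos hα hR).le

lemma integral_radDens {α R : ℝ} (ρ : ℝ) :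
    ∫ r in (0 : ℝ)..ρ, radDens α R r = (Real.cosh (α * ρ) - 1) / (Real.cosh (α * R) - 1) := by
  have hd : ∀ r ∈ uIcc 0 ρ, HasDerivAt (fun r => Real.cosh (α * r) / (Real.cosh (α * R) - 1))
      (radDens α R r) r := fun r _ => by
    have h := ((Real.hasDerivAt_cosh (α * r)).comp r ((hasDerivAt_id r).const_mul α)).div_const
      (Real.cosh (α * R) - 1)
    refine h.congr_deriv ?_
    unfold radDens; ring
  rw [intervalIntegral.integral_eq_sub_of_hasDerivAt hd
    ((continuous_radDens α R).intervalIntegrable _ _)]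
  simp [sub_div]

lemma radialLaw_Iic {α R ρ : ℝ} (hα : 0 < α) (hR : 0 < R) (hρ : 0 ≤ ρ) (hρR : ρ ≤ R) :
    radialLaw α R (Iic ρ)
      = ENNReal.ofReal ((Real.cosh (α * ρ) - 1) / (Real.cosh (α * R) - 1)) := by
  have hset : Iic ρ ∩ Icc 0 R = Icc 0 ρ := by
    ext r; simp only [mem_inter_iff, mem_Iic, mem_Icc]
    exact ⟨fun h => ⟨h.2.1, h.1⟩, fun h => ⟨h.2, h.1, h.2.trans hρR⟩⟩
  rw [radialLaw, withDensity_apply _ measurableSet_Iic, Measure.restrict_restrict measurableSet_Iic,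
    hset, ← integral_radDens, intervalIntegral.integral_of_le hρ, ← integral_Icc_eq_integral_Ioc,
    ofReal_integral_eq_lintegral_ofReal]
  · rfl
  · exact (continuous_radDens α R).integrableOn_Icc
  · exact (ae_restrict_iff' measurableSet_Icc).2 (ae_of_all _ fun r hr => radDens_nonneg hα hR hr.1)

lemma radialLaw_ae_mem (α R : ℝ) : ∀ᵐ r ∂(radialLaw α R), r ∈ Ioc 0 R := by
  have h1 : ∀ᵐ r ∂(volume.restrict (Icc (0 : ℝ) R)), r ∈ Ioc 0 R := by
    rw [← restrict_Ioc_eq_restrict_Icc]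
    exact ae_restrict_mem measurableSet_Ioc
  exact (withDensity_absolutelyContinuous _ _).ae_le h1

lemma isProbabilityMeasure_radialLaw {α R : ℝ} (hα : 0 < α) (hR : 0 < R) :
    IsProbabilityMeasure (radialLaw α R) := ⟨by
  have h1 : radialLaw α R univ = radialLaw α R (Iic R) := by
    refine measure_congr ?_
    filter_upwards [radialLaw_ae_mem α R] with r hr
    exact propext ⟨fun _ => hr.2, fun _ => trivial⟩
  rw [h1, radialLaw_Iic hα hR hR.le le_rfl, div_self (cosh_sub_one_pos hα hR).ne',
    ENNReal.ofReal_one]⟩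

lemma integral_radialLaw {α R : ℝ} (hα : 0 < α) (hR : 0 < R) (f : ℝ → ℝ) :
    ∫ r, f r ∂(radialLaw α R) = ∫ r in (0 : ℝ)..R, radDens α R r * f r := by
  rw [radialLaw, integral_withDensity_eq_integral_toReal_smul _ (ae_of_all _ fun _ => by simp),
    intervalIntegral.integral_of_le hR.le, ← integral_Icc_eq_integral_Ioc]
  · refine setIntegral_congr_fun measurableSet_Icc fun r hr => ?_
    have := radDens_nonneg hα hR hr.1
    exact congrArg (· * f r) (ENNReal.toReal_ofReal this)
  · exact (continuous_radDens α R).measurable.ennreal_ofReal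

lemma abs_radDens_sub_le {α R r : ℝ} (hα : 0 < α) (hR : 4 ≤ Real.exp (α * R)) (hr : 0 ≤ r)
    (hrR : r ≤ R) :
    |radDens α R r - α * Real.exp (α * (r - R))| ≤ 4 * α * Real.exp (-(α * R)) := by
  obtain ⟨E, hE⟩ : ∃ E, E = Real.exp (α * R) := ⟨_, rfl⟩
  obtain ⟨F, hF⟩ : ∃ F, F = Real.exp (α * r) := ⟨_, rfl⟩
  have hE4 : 4 ≤ E := hE ▸ hR
  have hF1 : 1 ≤ F := hF ▸ Real.one_le_exp (by positivity)
  have hFE : F ≤ E := by rw [hE, hF]; exact Real.exp_le_exp.2 (by gcongr)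
  have h1 : Real.exp (α * (r - R)) = F / E := by rw [mul_sub, Real.exp_sub, hE, hF]
  have h2 : radDens α R r = α * ((F - F⁻¹) / (E + E⁻¹ - 2)) := by
    rw [radDens, Real.sinh_eq, Real.cosh_eq, Real.exp_neg, Real.exp_neg, ← hE, ← hF,
      mul_div_assoc]
    congr 1
    rw [show (E + E⁻¹) / 2 - 1 = (E + E⁻¹ - 2) / 2 by ring]
    rw [div_div_div_cancel_right₀ two_ne_zero]
  have hEi : 0 < E⁻¹ := by positivity
  have hD : E / 2 ≤ E + E⁻¹ - 2 := by linarith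
  have hD0 : 0 < E + E⁻¹ - 2 := by linarith
  rw [h1, h2, Real.exp_neg, ← hE, ← mul_sub, abs_mul, abs_of_pos hα, mul_comm 4 α, mul_assoc]
  refine mul_le_mul_of_nonneg_left ?_ hα.le
  have h3 : (F - F⁻¹) / (E + E⁻¹ - 2) - F / E
      = (2 * (F / E) - F⁻¹ - F / E * E⁻¹) / (E + E⁻¹ - 2) := by
    rw [div_sub' hD0.ne']
    congr 1
    field_simp
    ring
  have hFE0 : 0 < F / E := by positivity
  have hFE1 : F / E ≤ 1 := (div_le_one (by linarith)).2 hFE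
  have hFi : F⁻¹ ≤ 1 := inv_le_one_of_one_le₀ hF1
  have hFi0 : 0 < F⁻¹ := by positivity
  have hEi1 : E⁻¹ ≤ 1 := inv_le_one_of_one_le₀ (by linarith)
  have h4 : F / E * E⁻¹ ≤ 1 := mul_le_one₀ hFE1 hEi.le hEi1
  have h5 : 0 < F / E * E⁻¹ := by positivity
  have h6 : |2 * (F / E) - F⁻¹ - F / E * E⁻¹| ≤ 2 := by rw [abs_le]; constructor <;> linarith
  rw [h3, abs_div, abs_of_pos hD0, div_le_iff₀ hD0]
  calc _ ≤ (2 : ℝ) := h6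
    _ = 4 * E⁻¹ * (E / 2) := by field_simp; norm_num
    _ ≤ _ := by gcongr

lemma radDens_le {α R r : ℝ} (hα : 0 < α) (hR : 4 ≤ Real.exp (α * R)) (hr : 0 ≤ r)
    (hrR : r ≤ R) : radDens α R r ≤ 5 * α * Real.exp (α * (r - R)) := by
  have h1 := (abs_le.1 (abs_radDens_sub_le hα hR hr hrR)).2
  have h2 : Real.exp (-(α * R)) ≤ Real.exp (α * (r - R)) := Real.exp_le_exp.2 (by nlinarith)
  nlinarith

lemma integral_exp_mul_sub (c R : ℝ) (hc : c ≠ 0) :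
    ∫ r in (0 : ℝ)..R, Real.exp (c * (r - R)) = (1 - Real.exp (-(c * R))) / c := by
  have hd : ∀ r ∈ uIcc 0 R, HasDerivAt (fun r => Real.exp (c * (r - R)) / c)
      (Real.exp (c * (r - R))) r := fun r _ => by
    have h := (((hasDerivAt_id r).sub_const R).const_mul c).exp.div_const c
    refine h.congr_deriv ?_
    field_simp
    rfl
  rw [intervalIntegral.integral_eq_sub_of_hasDerivAt hd
    (Continuous.intervalIntegrable (by fun_prop) _ _)]
  simp [sub_div]

lemma integral_exp_mul_sub_le {c R : ℝ} (hc : 0 < c) :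
    ∫ r in (0 : ℝ)..R, Real.exp (c * (r - R)) ≤ 1 / c := by
  rw [integral_exp_mul_sub c R hc.ne']
  gcongr
  linarith [Real.exp_pos (-(c * R))]

/-- Upper bound for the exponential moments of the radial law. -/
lemma integral_radialLaw_exp_le {α R β : ℝ} (hα : 0 < α) (hR : 0 < R)
    (hR4 : 4 ≤ Real.exp (α * R)) (hβ : β < 2 * α) :
    ∫ r, Real.exp (-β * r / 2) ∂(radialLaw α R)
      ≤ 5 * α / (α - β / 2) * Real.exp (-β * R / 2) := by
  have hc : 0 < α - β / 2 := by linarith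
  rw [integral_radialLaw hα hR]
  have h1 : ∀ r ∈ Icc 0 R, radDens α R r * Real.exp (-β * r / 2)
      ≤ 5 * α * Real.exp (-β * R / 2) * Real.exp ((α - β / 2) * (r - R)) := fun r hr => by
    calc _ ≤ 5 * α * Real.exp (α * (r - R)) * Real.exp (-β * r / 2) := by
          gcongr; exact radDens_le hα hR4 hr.1 hr.2
      _ = _ := by
          rw [mul_assoc (5 * α), ← Real.exp_add, mul_assoc (5 * α), ← Real.exp_add]; congr 2; ring
  refine (intervalIntegral.integral_mono_on hR.le
    (((continuous_radDens α R).mul (by fun_prop)).intervalIntegrable _ _)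
    (Continuous.intervalIntegrable (by fun_prop) _ _) h1).trans ?_
  rw [intervalIntegral.integral_const_mul]
  calc _ ≤ 5 * α * Real.exp (-β * R / 2) * (1 / (α - β / 2)) := by
        gcongr; exact integral_exp_mul_sub_le hc
    _ = _ := by ring

/-- Two points of the disc of radius `R`, in polar coordinates, at hyperbolic distance at most
`R`. -/
def hypRel (R : ℝ) : Set ((ℝ × ℝ) × (ℝ × ℝ)) :=
  {z | hypDist z.1.1 z.2.1 (z.1.2 - z.2.2) ≤ R}

lemma measurableSet_hypRel (R : ℝ) : MeasurableSet (hypRel R) := by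
  refine measurableSet_le ?_ measurable_const
  unfold hypDist Real.arcosh
  refine Real.measurable_log.comp ?_
  fun_prop

lemma hypRel_symm (R : ℝ) (a b : ℝ × ℝ) (h : (a, b) ∈ hypRel R) : (b, a) ∈ hypRel R := by
  simp only [hypRel, mem_ofPred_eq, hypDist] at h ⊢
  rwa [← Real.cos_neg, neg_sub, mul_comm (Real.cosh b.1), mul_comm (Real.sinh b.1)]

/-- The joint law of the polar coordinates of one vertex. -/
noncomputable def pointLaw (α R : ℝ) : Measure (ℝ × ℝ) := (radialLaw α R).prod angularLaw

lemma nbrProb_pointLaw {α R r : ℝ} (hα : 0 < α) (hR : 0 < R) (hr : 0 < r) (hrR : r ≤ R) (θ : ℝ) :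
    nbrProb (pointLaw α R) (hypRel R) (r, θ)
      = ∫ r' in (0 : ℝ)..R, radDens α R r' * angleProb R r r' := by
  have := isProbabilityMeasure_radialLaw hα hR
  have hS : MeasurableSet {b : ℝ × ℝ | ((r, θ), b) ∈ hypRel R} :=
    measurable_prodMk_left (measurableSet_hypRel R)
  rw [← integral_radialLaw hα hR, nbrProb, measureReal_def, pointLaw, Measure.prod_apply hS,
    integral_eq_lintegral_of_nonneg_ae (ae_of_all _ fun r' => angleProb_nonneg R r r')
      (measurable_angleProb R r).aestronglyMeasurable]
  congr 1
  refine lintegral_congr_ae ?_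
  filter_upwards [radialLaw_ae_mem α R] with r' hr'
  rw [← angularLaw_real_hypDist_le hr hr'.1 hrR hr'.2 θ, ofReal_measureReal]
  rfl

/-- A vertex at radius `r` is joined to a random vertex with probability `κ e^{-r/2}`, up to an
error of smaller exponential order in `r`. -/
theorem abs_nbrProb_pointLaw_sub_le {α R r γ : ℝ} (hα : 1 / 2 < α) (hγ : 1 / 2 ≤ γ) (hγ1 : γ ≤ 1)
    (hγα : γ < α) (hR : 0 < R) (hR4 : 4 ≤ Real.exp (α * R)) (hr : 0 < r) (hrR : r ≤ R) (θ : ℝ) :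
    |nbrProb (pointLaw α R) (hypRel R) (r, θ) - kappa α * Real.exp (-r / 2)|
      ≤ (20 * α / (α - γ) + 8 * α + kappa α) * Real.exp (-γ * r) := by
  have hα0 : 0 < α := by linarith
  have hpi := Real.pi_pos
  have hαγ : 0 < α - γ := by linarith
  have hα2 : 0 < α - 1 / 2 := by linarith
  have h2pi : 2 / Real.pi ≤ 1 := by
    rw [div_le_one hpi]; exact Real.two_le_pi
  have h2pi0 : 0 < 2 / Real.pi := by positivity
  have hκ : 0 < kappa α := by unfold kappa; positivity
  rw [nbrProb_pointLaw hα0 hR hr hrR]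
  set L : ℝ → ℝ := fun r' => 2 / Real.pi * Real.exp (-(r + r' - R) / 2) with hL
  have hLc : Continuous L := by simp only [hL]; fun_prop
  have hρc := continuous_radDens α R
  have hI1 : IntervalIntegrable (fun r' => radDens α R r' * angleProb R r r') volume 0 R := by
    refine IntervalIntegrable.continuousOn_mul ?_ hρc.continuousOn
    have : IsFiniteMeasure (volume.restrict (uIoc 0 R)) := by
      rw [uIoc_of_le hR.le]; infer_instance
    rw [intervalIntegrable_iff]
    refine Integrable.of_bound (measurable_angleProb R r).aestronglyMeasurable 1
      (ae_of_all _ fun r' => ?_)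
    rw [Real.norm_of_nonneg (angleProb_nonneg _ _ _)]; exact angleProb_le_one _ _ _
  have hI2 : IntervalIntegrable (fun r' => radDens α R r' * L r') volume 0 R :=
    (hρc.mul hLc).intervalIntegrable _ _
  have hI3 : IntervalIntegrable (fun r' => α * Real.exp (α * (r' - R)) * L r') volume 0 R :=
    Continuous.intervalIntegrable (by fun_prop) _ _
  -- the angle is replaced by its leading term
  have hA : |(∫ r' in (0 : ℝ)..R, radDens α R r' * angleProb R r r')
      - ∫ r' in (0 : ℝ)..R, radDens α R r' * L r'| ≤ 20 * α / (α - γ) * Real.exp (-γ * r) := by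
    rw [← intervalIntegral.integral_sub hI1 hI2, ← Real.norm_eq_abs]
    have hb : ∀ r' ∈ Ioc 0 R, ‖radDens α R r' * angleProb R r r' - radDens α R r' * L r'‖
        ≤ 20 * α * Real.exp (-γ * r) * Real.exp ((α - γ) * (r' - R)) := fun r' hr' => by
      have hρ0 := radDens_nonneg hα0 hR hr'.1.le
      rw [← mul_sub, norm_mul, Real.norm_of_nonneg hρ0, Real.norm_eq_abs]
      calc _ ≤ (5 * α * Real.exp (α * (r' - R))) * (4 * Real.exp (-γ * (r + r' - R))) :=
            mul_le_mul (radDens_le hα0 hR4 hr'.1.le hr'.2)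
              (abs_angleProb_sub_le hγ hγ1 hr hr'.1 hrR hr'.2) (abs_nonneg _) (by positivity)
        _ = 20 * α * (Real.exp (α * (r' - R)) * Real.exp (-γ * (r + r' - R))) := by ring
        _ = 20 * α * (Real.exp (-γ * r) * Real.exp ((α - γ) * (r' - R))) := by
            rw [← Real.exp_add, ← Real.exp_add]; congr 2; ring
        _ = _ := by ring
    refine (intervalIntegral.norm_integral_le_of_norm_le hR.le (ae_of_all _ hb)
      (Continuous.intervalIntegrable (by fun_prop) _ _)).trans ?_
    rw [intervalIntegral.integral_const_mul]
    calc _ ≤ 20 * α * Real.exp (-γ * r) * (1 / (α - γ)) := by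
          gcongr; exact integral_exp_mul_sub_le hαγ
      _ = _ := by ring
  have hexp : Real.exp (-α * r) ≤ Real.exp (-γ * r) := Real.exp_le_exp.2 (by nlinarith)
  -- the density is replaced by its leading term
  have hB : |(∫ r' in (0 : ℝ)..R, radDens α R r' * L r')
      - ∫ r' in (0 : ℝ)..R, α * Real.exp (α * (r' - R)) * L r'| ≤ 8 * α * Real.exp (-γ * r) := by
    rw [← intervalIntegral.integral_sub hI2 hI3, ← Real.norm_eq_abs]
    have hb : ∀ r' ∈ Ioc 0 R,
        ‖radDens α R r' * L r' - α * Real.exp (α * (r' - R)) * L r'‖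
        ≤ 4 * α * Real.exp (-(α * R) - r / 2) * Real.exp ((-1 / 2) * (r' - R)) := fun r' hr' => by
      rw [← sub_mul, norm_mul, Real.norm_eq_abs, Real.norm_eq_abs]
      have hLabs : |L r'| ≤ Real.exp (-(r + r' - R) / 2) := by
        simp only [hL]
        rw [abs_of_pos (by positivity)]
        exact mul_le_of_le_one_left (Real.exp_pos _).le h2pi
      calc _ ≤ (4 * α * Real.exp (-(α * R))) * Real.exp (-(r + r' - R) / 2) :=
            mul_le_mul (abs_radDens_sub_le hα0 hR4 hr'.1.le hr'.2) hLabs (abs_nonneg _)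
              (by positivity)
        _ = _ := by
            rw [mul_assoc (4 * α), ← Real.exp_add, mul_assoc (4 * α), ← Real.exp_add]; congr 2; ring
    refine (intervalIntegral.norm_integral_le_of_norm_le hR.le (ae_of_all _ hb)
      (Continuous.intervalIntegrable (by fun_prop) _ _)).trans ?_
    rw [intervalIntegral.integral_const_mul, integral_exp_mul_sub _ _ (by norm_num)]
    have h1 : (1 - Real.exp (-(-1 / 2 * R))) / (-1 / 2) ≤ 2 * Real.exp (R / 2) := by
      rw [show -(-1 / 2 * R) = R / 2 by ring]
      rw [div_le_iff_of_neg (by norm_num)]; linarith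
    calc _ ≤ 4 * α * Real.exp (-(α * R) - r / 2) * (2 * Real.exp (R / 2)) := by gcongr
      _ = 8 * α * Real.exp (-(α * R) - r / 2 + R / 2) := by rw [Real.exp_add]; ring
      _ ≤ 8 * α * Real.exp (-α * r) := by gcongr; nlinarith
      _ ≤ _ := by gcongr
  have hC : |(∫ r' in (0 : ℝ)..R, α * Real.exp (α * (r' - R)) * L r')
      - kappa α * Real.exp (-r / 2)| ≤ kappa α * Real.exp (-γ * r) := by
    have h1 : ∀ r', α * Real.exp (α * (r' - R)) * L r'
        = 2 * α / Real.pi * Real.exp (-r / 2) * Real.exp ((α - 1 / 2) * (r' - R)) := fun r' => by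
      simp only [hL]
      have : Real.exp (α * (r' - R)) * Real.exp (-(r + r' - R) / 2)
          = Real.exp (-r / 2) * Real.exp ((α - 1 / 2) * (r' - R)) := by
        rw [← Real.exp_add, ← Real.exp_add]; congr 1; ring
      linear_combination (2 * α / Real.pi) * this
    simp_rw [h1]
    rw [intervalIntegral.integral_const_mul, integral_exp_mul_sub _ _ hα2.ne']
    have h2 : 2 * α / Real.pi * Real.exp (-r / 2)
        * ((1 - Real.exp (-((α - 1 / 2) * R))) / (α - 1 / 2)) - kappa α * Real.exp (-r / 2)
        = -(kappa α * Real.exp (-r / 2 + -((α - 1 / 2) * R))) := by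
      rw [Real.exp_add]; unfold kappa; field_simp; ring
    rw [h2, abs_neg, abs_of_pos (by positivity)]
    gcongr
    nlinarith
  calc _ ≤ _ := abs_sub_le _ (∫ r' in (0 : ℝ)..R, radDens α R r' * L r') _
    _ ≤ _ := add_le_add le_rfl
      (abs_sub_le _ (∫ r' in (0 : ℝ)..R, α * Real.exp (α * (r' - R)) * L r') _)
    _ ≤ 20 * α / (α - γ) * Real.exp (-γ * r)
        + (8 * α * Real.exp (-γ * r) + kappa α * Real.exp (-γ * r)) :=
      add_le_add hA (add_le_add hB hC)
    _ = _ := by ring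

end Radial

/-! ### The limiting degree distribution as a mixture of Poisson laws -/

section Poisson

/-- The probability that a Poisson variable with mean `t` equals `k`. -/
noncomputable def poisWeight (k : ℕ) (t : ℝ) : ℝ := t ^ k / k.factorial * Real.exp (-t)

lemma continuous_poisWeight (k : ℕ) : Continuous (poisWeight k) := by
  unfold poisWeight; fun_prop

lemma poisWeight_nonneg {k : ℕ} {t : ℝ} (ht : 0 ≤ t) : 0 ≤ poisWeight k t := by
  unfold poisWeight; positivity

lemma poisWeight_le_exp {k : ℕ} {t : ℝ} (ht : 0 ≤ t) : poisWeight k t ≤ Real.exp (k - t / 2) := by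
  have h1 := Real.pow_div_factorial_le_exp (t / 2) (by positivity) k
  have h2 : (2 : ℝ) ≤ Real.exp 1 := by linarith [Real.add_one_le_exp 1]
  calc poisWeight k t = 2 ^ k * ((t / 2) ^ k / k.factorial) * Real.exp (-t) := by
        unfold poisWeight; rw [div_pow]; field_simp
    _ ≤ Real.exp 1 ^ k * Real.exp (t / 2) * Real.exp (-t) := by gcongr
    _ = Real.exp (k - t / 2) := by
        rw [← Real.exp_nat_mul, ← Real.exp_add, ← Real.exp_add]; congr 1; ring

lemma poisWeight_le_one {k : ℕ} {t : ℝ} (ht : 0 ≤ t) : poisWeight k t ≤ 1 := by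
  have h1 := Real.pow_div_factorial_le_exp t ht k
  calc poisWeight k t ≤ Real.exp t * Real.exp (-t) := by unfold poisWeight; gcongr
    _ = 1 := by rw [← Real.exp_add]; simp

lemma kappa_pos {α : ℝ} (hα : 1 / 2 < α) : 0 < kappa α := by
  have := Real.pi_pos
  have : 0 < α - 1 / 2 := by linarith
  unfold kappa; positivity

lemma xi_pos {α C : ℝ} (hα : 1 / 2 < α) : 0 < xi α C := mul_pos (kappa_pos hα) (Real.exp_pos _)

lemma exp_discRadius_half {C : ℝ} {n : ℕ} (hn : 0 < n) :
    Real.exp (discRadius C n / 2) = n * Real.exp (C / 2) := by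
  have hn' : (0 : ℝ) < n := Nat.cast_pos.2 hn
  rw [discRadius, show (2 * Real.log n + C) / 2 = Real.log n + C / 2 by ring, Real.exp_add,
    Real.exp_log hn']

lemma exp_mul_discRadius {C : ℝ} {n : ℕ} (hn : 0 < n) (a : ℝ) :
    Real.exp (a * discRadius C n) = (n : ℝ) ^ (2 * a) * Real.exp (a * C) := by
  have hn' : (0 : ℝ) < n := Nat.cast_pos.2 hn
  rw [discRadius, mul_add, Real.exp_add, Real.rpow_def_of_pos hn']
  ring_nf

/-- A vertex at radius `r` has a degree that is asymptotically Poisson with mean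
`κ n e^{-r/2}`; averaging over a radius with density `α e^{α (r - R)}` on `(-∞, R]` gives exactly
the limiting fraction. -/
theorem degEqLimit_eq_integral {α C : ℝ} (hα : 1 / 2 < α) {n : ℕ} (hn : 0 < n) (k : ℕ) :
    degEqLimit α C k = ∫ r in Iic (discRadius C n),
      α * Real.exp (α * (r - discRadius C n)) * poisWeight k (kappa α * n * Real.exp (-r / 2)) := by
  have hn' : (0 : ℝ) < n := Nat.cast_pos.2 hn
  have hκ := kappa_pos hα
  set R := discRadius C n with hR
  set f : ℝ → ℝ := fun r => kappa α * n * Real.exp (-r / 2) with hf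
  have hf0 : ∀ r, 0 < f r := fun r => by simp only [hf]; positivity
  have hξ : xi α C = f R := by
    have h1 : Real.exp (-R / 2) = (n * Real.exp (C / 2))⁻¹ := by
      rw [← exp_discRadius_half hn, ← Real.exp_neg]; congr 1; ring
    simp only [hf, h1, xi]
    rw [show -C / 2 = -(C / 2) by ring, Real.exp_neg]
    field_simp
  have hanti : StrictAnti f := fun a b hab => by
    simp only [hf]
    exact mul_lt_mul_of_pos_left (Real.exp_lt_exp.2 (by linarith)) (by positivity)
  have himage : f '' Iio R = Ioi (xi α C) := by
    ext t
    simp only [mem_image, mem_Iio, mem_Ioi]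
    constructor
    · rintro ⟨r, hr, rfl⟩
      rw [hξ]; exact hanti hr
    · intro ht
      have ht0 : 0 < t := (xi_pos hα).trans ht
      have hft : f (-2 * Real.log (t / (kappa α * n))) = t := by
        simp only [hf]
        rw [show -(-2 * Real.log (t / (kappa α * n))) / 2 = Real.log (t / (kappa α * n)) by ring,
          Real.exp_log (by positivity)]
        field_simp
      refine ⟨_, ?_, hft⟩
      rw [hξ, ← hft] at ht
      exact hanti.lt_iff_gt.1 ht
  have hderiv : ∀ r ∈ Iio R, HasDerivWithinAt f (-(f r) / 2) (Iio R) r := fun r _ => by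
    have h := (((hasDerivAt_id r).neg.div_const 2).exp.const_mul (kappa α * n))
    refine (h.congr_deriv ?_).hasDerivWithinAt
    simp only [hf, Pi.neg_apply, id]; ring
  have hpt : ∀ r, 2 * α * Real.exp (-α * C) / k.factorial * kappa α ^ (2 * α)
      * (|-(f r) / 2| • (f r ^ ((k : ℝ) - 2 * α - 1) * Real.exp (-(f r))))
      = α * Real.exp (α * (r - R)) * poisWeight k (f r) := fun r => by
    have h0 := hf0 r
    have h1 : |-(f r) / 2| = f r / 2 := by
      rw [abs_div, abs_neg, abs_of_pos h0, abs_two]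
    have h2 : f r ^ ((k : ℝ) - 2 * α - 1) = f r ^ k * f r ^ (-(2 * α)) * (f r)⁻¹ := by
      rw [← Real.rpow_natCast, ← Real.rpow_neg_one, ← Real.rpow_add h0, ← Real.rpow_add h0]
      congr 1
    have h3 : Real.exp (-α * C) * kappa α ^ (2 * α) * f r ^ (-(2 * α))
        = Real.exp (α * (r - R)) := by
      have e1 : f r = kappa α * Real.exp (Real.log n - r / 2) := by
        simp only [hf]
        rw [sub_eq_add_neg, Real.exp_add, Real.exp_log hn', neg_div]; ring
      rw [e1, Real.mul_rpow hκ.le (Real.exp_pos _).le, Real.rpow_neg hκ.le, ← Real.exp_mul,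
        mul_assoc, mul_inv_cancel_left₀ (by positivity), ← Real.exp_add, hR, discRadius]
      congr 1; ring
    rw [h1, h2, smul_eq_mul, ← h3, poisWeight]
    field_simp
  rw [degEqLimit, upperGamma, ← himage, integral_image_eq_integral_abs_deriv_smul measurableSet_Iio
    hderiv hanti.injective.injOn, ← integral_const_mul, ← integral_Iic_eq_integral_Iio]
  exact setIntegral_congr_fun measurableSet_Iic fun r _ => hpt r

lemma integrableOn_pow_mul_exp_neg (k : ℕ) :
    IntegrableOn (fun t : ℝ => t ^ k * Real.exp (-t)) (Ioi 0) := by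
  have h := Real.GammaIntegral_convergent (s := k + 1) (by positivity)
  refine h.congr_fun (fun t _ => ?_) measurableSet_Ioi
  simp [mul_comm]

lemma integral_pow_mul_exp_neg (k : ℕ) :
    ∫ t in Ioi (0 : ℝ), t ^ k * Real.exp (-t) = k.factorial := by
  rw [← Real.Gamma_nat_eq_factorial, Real.Gamma_eq_integral (by positivity)]
  refine setIntegral_congr_fun measurableSet_Ioi fun t _ => ?_
  simp [mul_comm]

lemma exp_neg_mul_factorial_le (k : ℕ) {x : ℝ} (hx : 0 ≤ x) :
    Real.exp (-x) * k.factorial ≤ ∫ t in Ioi x, t ^ k * Real.exp (-t) := by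
  have himage : (fun u => u + x) '' Ioi 0 = Ioi x := by simp
  have hderiv : ∀ u ∈ Ioi (0 : ℝ), HasDerivWithinAt (fun u => u + x) 1 (Ioi 0) u := fun u _ =>
    ((hasDerivAt_id u).add_const x).hasDerivWithinAt
  have hinj : InjOn (fun u : ℝ => u + x) (Ioi 0) := (add_left_injective x).injOn
  have hint : IntegrableOn (fun u => |(1 : ℝ)| • ((u + x) ^ k * Real.exp (-(u + x)))) (Ioi 0) := by
    rw [← integrableOn_image_iff_integrableOn_abs_deriv_smul measurableSet_Ioi hderiv hinj
      (fun t => t ^ k * Real.exp (-t)), himage]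
    exact (integrableOn_pow_mul_exp_neg k).mono_set (Ioi_subset_Ioi hx)
  rw [← himage, integral_image_eq_integral_abs_deriv_smul measurableSet_Ioi hderiv hinj,
    ← integral_pow_mul_exp_neg, ← integral_const_mul]
  refine setIntegral_mono_on ((integrableOn_pow_mul_exp_neg k).const_mul _) hint measurableSet_Ioi
    fun u hu => ?_
  have hu0 : 0 < u := hu
  rw [abs_one, one_smul, neg_add, Real.exp_add]
  calc Real.exp (-x) * (u ^ k * Real.exp (-u)) = u ^ k * (Real.exp (-u) * Real.exp (-x)) := by ring
    _ ≤ _ := by gcongr; linarith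

/-- The limiting fractions decay at most polynomially in the degree. -/
theorem exists_le_degEqLimit {α : ℝ} (C : ℝ) (hα : 1 / 2 < α) :
    ∃ c > 0, ∀ k : ℕ, c * ((k : ℝ) + 1) ^ (-(2 * α + 1)) ≤ degEqLimit α C k := by
  have hκ := kappa_pos hα
  set x := xi α C
  have hx : 0 < x := xi_pos hα
  set B := 2 * Real.exp x with hB
  have hB0 : 0 < B := by positivity
  set s := 2 * α + 1
  refine ⟨2 * α * Real.exp (-α * C) * kappa α ^ (2 * α) * (B ^ (-s) * (Real.exp (-x) / 2)),
    by positivity, fun k => ?_⟩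
  set M := B * ((k : ℝ) + 1) with hM
  have hM0 : 0 < M := by positivity
  have hI0 := (integrableOn_pow_mul_exp_neg k).mono_set (Ioi_subset_Ioi hx.le)
  have hI1 := (integrableOn_pow_mul_exp_neg (k + 1)).mono_set (Ioi_subset_Ioi hx.le)
  have hI2 : IntegrableOn (fun t : ℝ => t ^ ((k : ℝ) - 2 * α - 1) * Real.exp (-t)) (Ioi x) := by
    refine Integrable.mono' (hI0.const_mul (x ^ (-s))) ?_ ?_
    · refine (Measurable.mul ?_ ?_).aestronglyMeasurable <;> fun_prop
    · refine (ae_restrict_iff' measurableSet_Ioi).2 (ae_of_all _ fun t ht => ?_)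
      have ht0 : 0 < t := hx.trans ht
      rw [Real.norm_of_nonneg (by positivity), show (k : ℝ) - 2 * α - 1 = -s + k by
        simp only [s]; ring, Real.rpow_add ht0, Real.rpow_natCast, mul_assoc]
      gcongr ?_ * _
      exact Real.rpow_le_rpow_of_nonpos hx (le_of_lt ht) (by simp only [s]; linarith)
  have h1 : M ^ (-s) * ((∫ t in Ioi x, t ^ k * Real.exp (-t))
      - (∫ t in Ioi x, t ^ (k + 1) * Real.exp (-t)) / M) ≤ upperGamma (k - 2 * α) x := by
    rw [upperGamma, ← integral_div, ← integral_sub hI0 (hI1.div_const _), ← integral_const_mul]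
    refine setIntegral_mono_on ((hI0.sub (hI1.div_const _)).const_mul _) hI2 measurableSet_Ioi
      fun t ht => ?_
    have ht0 : 0 < t := hx.trans ht
    rw [show (k : ℝ) - 2 * α - 1 = -s + k by simp only [s]; ring, Real.rpow_add ht0,
      Real.rpow_natCast]
    -- `t ^ (-s) ≥ M ^ (-s) (1 - t / M)` holds for every `t > 0`
    have h2 : M ^ (-s) * (1 - t / M) ≤ t ^ (-s) := by
      rcases le_total t M with h | h
      · refine (mul_le_of_le_one_right (by positivity) ?_).trans
          (Real.rpow_le_rpow_of_nonpos ht0 h (by simp only [s]; linarith))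
        have : 0 < t / M := by positivity
        linarith
      · refine (mul_nonpos_of_nonneg_of_nonpos (by positivity) ?_).trans (by positivity)
        have : 1 ≤ t / M := (one_le_div hM0).2 h
        linarith
    calc _ = M ^ (-s) * (1 - t / M) * (t ^ k * Real.exp (-t)) := by ring
      _ ≤ t ^ (-s) * (t ^ k * Real.exp (-t)) := by gcongr
      _ = _ := by ring
  have h2 := exp_neg_mul_factorial_le k hx.le
  have h3 : (∫ t in Ioi x, t ^ (k + 1) * Real.exp (-t)) ≤ (k + 1).factorial := by
    rw [← integral_pow_mul_exp_neg]
    refine setIntegral_mono_set (integrableOn_pow_mul_exp_neg (k + 1)) ?_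
      (ae_of_all _ (Ioi_subset_Ioi hx.le))
    refine (ae_restrict_iff' measurableSet_Ioi).2 (ae_of_all _ fun t ht => ?_)
    have : (0 : ℝ) < t := ht
    simp only [Pi.zero_apply]; positivity
  have h4 : ((k + 1).factorial : ℝ) / M = k.factorial * (Real.exp (-x) / 2) := by
    rw [Nat.factorial_succ, hM, hB, Real.exp_neg]; push_cast; field_simp
  have h5 : M ^ (-s) * (k.factorial * (Real.exp (-x) / 2)) ≤ upperGamma (k - 2 * α) x := by
    refine le_trans ?_ h1
    gcongr
    have := div_le_div_of_nonneg_right h3 hM0.le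
    rw [h4] at this
    linarith
  have hMs : M ^ (-s) = B ^ (-s) * ((k : ℝ) + 1) ^ (-s) := by
    rw [hM, Real.mul_rpow hB0.le (by positivity)]
  have hfac : (0 : ℝ) < k.factorial := by positivity
  calc _ = 2 * α * Real.exp (-α * C) / k.factorial * kappa α ^ (2 * α)
        * (M ^ (-s) * (k.factorial * (Real.exp (-x) / 2))) := by
        rw [hMs]; field_simp
    _ ≤ _ := by unfold degEqLimit; gcongr

/-- `1 - y ≥ e^{-y-y²}` on `[0, 1/2]`. -/
lemma exp_neg_sub_sq_le {y : ℝ} (hy0 : 0 ≤ y) (hy : y ≤ 1 / 2) :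
    Real.exp (-y - y ^ 2) ≤ 1 - y := by
  have h1 := Real.quadratic_le_exp_of_nonneg (x := y + y ^ 2) (by positivity)
  rw [show -y - y ^ 2 = -(y + y ^ 2) by ring, Real.exp_neg]
  refine inv_le_of_inv_le₀ (by linarith) (le_trans ?_ h1)
  rw [inv_le_iff_one_le_mul₀ (by linarith)]
  have h2 : y + y ^ 2 + y ^ 3 ≤ 1 := by
    have : y ^ 2 ≤ (1 / 2) ^ 2 := by gcongr
    have : y ^ 3 ≤ (1 / 2) ^ 3 := by gcongr
    linarith
  nlinarith [mul_nonneg (sq_nonneg y) (sub_nonneg.2 h2)]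

lemma exp_neg_two_mul_le {y : ℝ} (hy0 : 0 ≤ y) (hy : y ≤ 1 / 2) :
    Real.exp (-(2 * y)) ≤ 1 - y :=
  (Real.exp_le_exp.2 (by nlinarith)).trans (exp_neg_sub_sq_le hy0 hy)

lemma binomWeight_le_poisWeight_mul_exp {m k : ℕ} {n p t η : ℝ} (hn : n = (m + 1 : ℕ))
    (hp0 : 0 ≤ p) (hp1 : p ≤ 1) (ht : 0 ≤ t) (hl : -(η * t) ≤ n * p - t)
    (hu : n * p - t ≤ η * t) :
    binomWeight m k p ≤ poisWeight k t * Real.exp (k * η + η * t + p * (k + 1)) := by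
  have hnm : n = m + 1 := by rw [hn]; push_cast; ring
  have hm0 : (0 : ℝ) ≤ m := Nat.cast_nonneg m
  have hn0 : 0 < n := by linarith
  have hfac : (0 : ℝ) < k.factorial := by positivity
  have hq : 0 ≤ 1 - p := by linarith
  have h1 : (m.choose k : ℝ) ≤ n ^ k / k.factorial :=
    (Nat.choose_le_pow_div k m).trans (by gcongr; linarith)
  have h2 : (n * p) ^ k ≤ t ^ k * Real.exp (k * η) := by
    rw [Real.exp_nat_mul, ← mul_pow]
    refine pow_le_pow_left₀ (by positivity) ?_ k
    nlinarith [Real.add_one_le_exp η]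
  have h3 : (1 - p) ^ (m - k) ≤ Real.exp (-t + η * t + p * (k + 1)) := by
    have h4 : (m : ℝ) - k ≤ ((m - k : ℕ) : ℝ) := by
      rw [sub_le_iff_le_add]; exact_mod_cast (by omega : m ≤ m - k + k)
    calc (1 - p) ^ (m - k) ≤ Real.exp (-p) ^ (m - k) := by
          gcongr; exact Real.one_sub_le_exp_neg p
      _ = Real.exp ((m - k : ℕ) * -p) := by rw [← Real.exp_nat_mul]
      _ ≤ _ := by
          refine Real.exp_le_exp.2 ?_
          nlinarith
  calc binomWeight m k p ≤ n ^ k / k.factorial * p ^ k * (1 - p) ^ (m - k) := by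
        unfold binomWeight; gcongr
    _ = (n * p) ^ k / k.factorial * (1 - p) ^ (m - k) := by rw [mul_pow]; ring
    _ ≤ t ^ k * Real.exp (k * η) / k.factorial * Real.exp (-t + η * t + p * (k + 1)) := by
        gcongr
    _ = t ^ k / k.factorial * (Real.exp (k * η) * Real.exp (-t + η * t + p * (k + 1))) := by ring
    _ = poisWeight k t * Real.exp (k * η + η * t + p * (k + 1)) := by
        rw [poisWeight, mul_assoc, ← Real.exp_add, ← Real.exp_add]; congr 2; ring

lemma poisWeight_mul_exp_le_binomWeight {m k : ℕ} {n p t η : ℝ} (hn : n = (m + 1 : ℕ))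
    (hp0 : 0 ≤ p) (hp : p ≤ 1 / 2) (ht : 0 ≤ t) (hη0 : 0 ≤ η) (hη : η ≤ 1 / 2)
    (hkn : 2 * (k : ℝ) ≤ n) (hl : -(η * t) ≤ n * p - t) (hu : n * p - t ≤ η * t) :
    poisWeight k t * Real.exp (-(2 * (k : ℝ) ^ 2 / n) + -(2 * k * η) + (-(η * t) - n * p ^ 2))
      ≤ binomWeight m k p := by
  have hnm : n = m + 1 := by rw [hn]; push_cast; ring
  have hm0 : (0 : ℝ) ≤ m := Nat.cast_nonneg m
  have hn0 : 0 < n := by linarith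
  have hk0 : (0 : ℝ) ≤ k := Nat.cast_nonneg k
  have hkm : k ≤ m + 1 := by
    have : (k : ℝ) ≤ (m + 1 : ℕ) := by rw [← hn]; linarith
    exact_mod_cast this
  have hfac : (0 : ℝ) < k.factorial := by positivity
  have hq : 0 ≤ 1 - p := by linarith
  have h1 : n ^ k * Real.exp (-(2 * (k : ℝ) ^ 2 / n)) / k.factorial ≤ m.choose k := by
    rw [div_le_iff₀ hfac]
    have e1 : (n - k) ^ k ≤ (m.choose k : ℝ) * k.factorial := by
      have h := Nat.pow_sub_le_descFactorial m k
      rw [Nat.descFactorial_eq_factorial_mul_choose] at h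
      have h' : (((m + 1 - k : ℕ) : ℝ)) ^ k ≤ k.factorial * m.choose k := by exact_mod_cast h
      rw [Nat.cast_sub (by omega), ← hn] at h'
      linarith
    have e2 : n * Real.exp (-(2 * (k / n))) ≤ n - k := by
      have := exp_neg_two_mul_le (y := k / n) (by positivity) (by rw [div_le_iff₀ hn0]; linarith)
      calc _ ≤ n * (1 - k / n) := by gcongr
        _ = n - k := by field_simp
    calc n ^ k * Real.exp (-(2 * (k : ℝ) ^ 2 / n)) = (n * Real.exp (-(2 * (k / n)))) ^ k := by
          rw [mul_pow, ← Real.exp_nat_mul]; congr 2; ring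
      _ ≤ (n - k) ^ k := by gcongr
      _ ≤ _ := e1
  have h2 : t ^ k * Real.exp (-(2 * k * η)) ≤ (n * p) ^ k := by
    rw [show -(2 * (k : ℝ) * η) = k * (-(2 * η)) by ring, Real.exp_nat_mul, ← mul_pow]
    refine pow_le_pow_left₀ (by positivity) ?_ k
    nlinarith [exp_neg_two_mul_le hη0 hη]
  have h3 : Real.exp (-t - η * t - n * p ^ 2) ≤ (1 - p) ^ (m - k) := by
    calc _ ≤ Real.exp ((m - k : ℕ) * (-p - p ^ 2)) := by
          refine Real.exp_le_exp.2 ?_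
          have h4 : ((m - k : ℕ) : ℝ) ≤ n := by
            rw [hn]; exact_mod_cast (Nat.sub_le m k).trans (Nat.le_succ m)
          have : ((m - k : ℕ) : ℝ) * (p + p ^ 2) ≤ n * (p + p ^ 2) := by gcongr
          nlinarith
      _ = Real.exp (-p - p ^ 2) ^ (m - k) := by rw [Real.exp_nat_mul]
      _ ≤ _ := by gcongr; exact exp_neg_sub_sq_le hp0 hp
  calc _ = Real.exp (-(2 * (k : ℝ) ^ 2 / n)) / k.factorial * (t ^ k * Real.exp (-(2 * k * η)))
          * Real.exp (-t - η * t - n * p ^ 2) := by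
        rw [Real.exp_add, Real.exp_add, poisWeight, show -t - η * t - n * p ^ 2
          = -t + (-(η * t) - n * p ^ 2) by ring, Real.exp_add (-t)]
        ring
    _ ≤ Real.exp (-(2 * (k : ℝ) ^ 2 / n)) / k.factorial * (n * p) ^ k * (1 - p) ^ (m - k) := by
        gcongr
    _ = n ^ k * Real.exp (-(2 * (k : ℝ) ^ 2 / n)) / k.factorial * p ^ k * (1 - p) ^ (m - k) := by
        rw [mul_pow]; ring
    _ ≤ _ := by unfold binomWeight; gcongr

/-- Comparison of a binomial weight with a Poisson weight whose mean is nearly the same. -/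
theorem abs_binomWeight_sub_poisWeight_le {m k : ℕ} {p t η : ℝ} (hp0 : 0 ≤ p) (hp : p ≤ 1 / 2)
    (ht : 0 ≤ t) (hη0 : 0 ≤ η) (hη : η ≤ 1 / 2) (hk : 2 * k ≤ m + 1)
    (hpt : |((m + 1 : ℕ) : ℝ) * p - t| ≤ η * t) :
    |binomWeight m k p - poisWeight k t|
      ≤ poisWeight k t * (Real.exp (2 * (k : ℝ) ^ 2 / (m + 1 : ℕ) + 2 * k * η + η * t
          + (m + 1 : ℕ) * p ^ 2 + p * (k + 1)) - 1) := by
  obtain ⟨n, hn⟩ : ∃ n : ℝ, n = (m + 1 : ℕ) := ⟨_, rfl⟩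
  have hnm : n = m + 1 := by rw [hn]; push_cast; ring
  have hm0 : (0 : ℝ) ≤ m := Nat.cast_nonneg m
  have hn0 : 0 < n := by linarith
  have hk0 : (0 : ℝ) ≤ k := Nat.cast_nonneg k
  have hkn : 2 * (k : ℝ) ≤ n := by rw [hn]; exact_mod_cast hk
  rw [← hn] at hpt ⊢
  obtain ⟨hl, hu⟩ := abs_le.1 hpt
  have hP := poisWeight_nonneg (k := k) ht
  set w := 2 * (k : ℝ) ^ 2 / n + 2 * k * η + η * t + n * p ^ 2 + p * (k + 1) with hw
  have w1 : 0 ≤ 2 * (k : ℝ) ^ 2 / n := by positivity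
  have w2 : 0 ≤ k * η := by positivity
  have w3 : 0 ≤ η * t := by positivity
  have w4 : 0 ≤ n * p ^ 2 := by positivity
  have w5 : 0 ≤ p * (k + 1) := by positivity
  have hw0 : 0 ≤ w := by linarith
  have hfac : (0 : ℝ) < k.factorial := by positivity
  have hq : 0 ≤ 1 - p := by linarith
  have upper : binomWeight m k p ≤ poisWeight k t * Real.exp w := by
    refine (binomWeight_le_poisWeight_mul_exp hn hp0 (by linarith) ht hl hu).trans
      (mul_le_mul_of_nonneg_left (Real.exp_le_exp.2 ?_) hP)
    linarith
  have lower : poisWeight k t * Real.exp (-w) ≤ binomWeight m k p := by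
    refine le_trans (mul_le_mul_of_nonneg_left (Real.exp_le_exp.2 ?_) hP)
      (poisWeight_mul_exp_le_binomWeight hn hp0 hp ht hη0 hη hkn hl hu)
    linarith
  have hew : 1 - Real.exp (-w) ≤ Real.exp w - 1 := by
    have h1 := Real.add_one_le_exp w
    have h2 := Real.add_one_le_exp (-w)
    linarith
  have h3 := mul_le_mul_of_nonneg_left hew hP
  rw [mul_sub, mul_sub, mul_one] at h3
  rw [mul_sub, mul_one, abs_le]
  constructor <;> linarith

end Poisson

/-! ### The degree distribution of a single vertex -/

section SingleVertex

lemma measurable_nbrProb_pointLaw {α R : ℝ} (hα : 0 < α) (hR : 0 < R) :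
    Measurable (nbrProb (pointLaw α R) (hypRel R)) := by
  have := isProbabilityMeasure_radialLaw hα hR
  have : IsProbabilityMeasure (pointLaw α R) := by unfold pointLaw; infer_instance
  exact measurable_nbrProb _ (measurableSet_hypRel R)

lemma isProbabilityMeasure_pointLaw {α R : ℝ} (hα : 0 < α) (hR : 0 < R) :
    IsProbabilityMeasure (pointLaw α R) := by
  have := isProbabilityMeasure_radialLaw hα hR
  unfold pointLaw; infer_instance

/-- The neighbourhood probability depends on the radius only, so averages of it reduce to integrals
over the radius. -/
lemma integral_pointLaw_comp {α R : ℝ} (hα : 0 < α) (hR : 0 < R) {g : ℝ → ℝ} (hg : Measurable g)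
    {c : ℝ} (hc : ∀ p, 0 ≤ p → p ≤ 1 → |g p| ≤ c) :
    ∫ a, g (nbrProb (pointLaw α R) (hypRel R) a) ∂(pointLaw α R)
      = ∫ r, g (nbrProb (pointLaw α R) (hypRel R) (r, 0)) ∂(radialLaw α R) := by
  have := isProbabilityMeasure_radialLaw hα hR
  have hP := isProbabilityMeasure_pointLaw hα hR
  have hI : Integrable (fun a => g (nbrProb (pointLaw α R) (hypRel R) a))
      ((radialLaw α R).prod angularLaw) :=
    integrable_of_abs_le (hg.comp (measurable_nbrProb_pointLaw hα hR))
      fun a => hc _ (nbrProb_nonneg _ _ _) (nbrProb_le_one _ _ _)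
  conv_lhs => rw [pointLaw]
  refine (integral_prod _ hI).trans (integral_congr_ae ?_)
  filter_upwards [radialLaw_ae_mem α R] with r hr
  have h : ∀ θ, nbrProb (pointLaw α R) (hypRel R) (r, θ)
      = nbrProb (pointLaw α R) (hypRel R) (r, 0) := fun θ => by
    rw [nbrProb_pointLaw hα hR hr.1 hr.2, nbrProb_pointLaw hα hR hr.1 hr.2]
  change ∫ θ, g (nbrProb (pointLaw α R) (hypRel R) (r, θ)) ∂angularLaw = _
  simp_rw [h]
  simp

lemma exists_nbrProb_pointLaw_le {α : ℝ} (hα : 1 / 2 < α) :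
    ∃ K > 0, ∀ R r θ : ℝ, 0 < R → 4 ≤ Real.exp (α * R) → 0 < r → r ≤ R →
      nbrProb (pointLaw α R) (hypRel R) (r, θ) ≤ K * Real.exp (-r / 2) := by
  have hα2 : 0 < α - 1 / 2 := by linarith
  have hα0 : 0 < α := by linarith
  have hκ := kappa_pos hα
  refine ⟨20 * α / (α - 1 / 2) + 8 * α + kappa α + kappa α, by positivity,
    fun R r θ hR hR4 hr hrR => ?_⟩
  have h := (abs_le.1 (abs_nbrProb_pointLaw_sub_le hα le_rfl (by norm_num) hα hR hR4 hr hrR θ)).2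
  rw [show -(1 / 2 : ℝ) * r = -r / 2 by ring] at h
  linarith

/-- The first and second moments of the probability of being joined to a given vertex. -/
lemma exists_integral_nbrProb_le {α : ℝ} (C : ℝ) {β : ℝ} (hα : 1 / 2 < α) (hβ1 : 1 ≤ β) (hβ2 : β ≤ 2)
    (hβ : β < 2 * α) :
    ∃ K > 0, ∀ n : ℕ, 0 < n → 0 < discRadius C n → 4 ≤ Real.exp (α * discRadius C n) →
      (∫ a, nbrProb (pointLaw α (discRadius C n)) (hypRel (discRadius C n)) a
        ∂(pointLaw α (discRadius C n)) ≤ K * (n : ℝ) ^ (-1 : ℝ)) ∧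
      (∫ a, nbrProb (pointLaw α (discRadius C n)) (hypRel (discRadius C n)) a ^ 2
        ∂(pointLaw α (discRadius C n)) ≤ K * (n : ℝ) ^ (-β)) := by
  obtain ⟨K, hK0, hK⟩ := exists_nbrProb_pointLaw_le hα
  have hα0 : 0 < α := by linarith
  have hα2 : 0 < α - 1 / 2 := by linarith
  have hβα : 0 < α - β / 2 := by linarith
  refine ⟨K * (5 * α / (α - 1 / 2)) * Real.exp (-C / 2)
    + K ^ 2 * (5 * α / (α - β / 2)) * Real.exp (-β * C / 2), by positivity,
    fun n hn hR hR4 => ?_⟩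
  set R := discRadius C n
  set p := nbrProb (pointLaw α R) (hypRel R)
  have := isProbabilityMeasure_radialLaw hα0 hR
  have hP := isProbabilityMeasure_pointLaw hα0 hR
  have hp0 : ∀ a, 0 ≤ p a := nbrProb_nonneg _ _
  have hexp : ∀ b : ℝ, Real.exp (-b * R / 2) = (n : ℝ) ^ (-b) * Real.exp (-b * C / 2) := fun b => by
    rw [show -b * R / 2 = (-b / 2) * R by ring, exp_mul_discRadius hn]
    ring_nf
  have hint : ∀ b : ℝ, 0 ≤ b → Integrable (fun r => Real.exp (-b * r / 2)) (radialLaw α R) :=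
    fun b hb => by
    refine Integrable.of_bound (by fun_prop) 1 ?_
    filter_upwards [radialLaw_ae_mem α R] with r hr
    rw [Real.norm_of_nonneg (Real.exp_pos _).le]
    exact Real.exp_le_one_iff.2 (by nlinarith [hr.1])
  have hn0 : (0 : ℝ) ≤ n := Nat.cast_nonneg n
  constructor
  · have h1 := integral_pointLaw_comp hα0 hR (g := id) measurable_id (c := 1) fun p h0 h1 => by
      rwa [id, abs_of_nonneg h0]
    refine h1.trans_le ?_
    have h2 : ∫ r, id (p (r, 0)) ∂(radialLaw α R)
        ≤ ∫ r, K * Real.exp (-1 * r / 2) ∂(radialLaw α R) := by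
      refine integral_mono_of_nonneg (ae_of_all _ fun r => hp0 _)
        ((hint 1 zero_le_one).const_mul _) ?_
      filter_upwards [radialLaw_ae_mem α R] with r hr
      simpa using hK R r 0 hR hR4 hr.1 hr.2
    refine h2.trans ?_
    rw [integral_const_mul]
    calc _ ≤ K * (5 * α / (α - 1 / 2) * Real.exp (-1 * R / 2)) := by
          gcongr
          exact integral_radialLaw_exp_le hα0 hR hR4 (by linarith)
      _ = K * (5 * α / (α - 1 / 2)) * Real.exp (-C / 2) * (n : ℝ) ^ (-1 : ℝ) := by
          rw [hexp 1]; ring_nf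
      _ ≤ _ := by
          refine mul_le_mul_of_nonneg_right ?_ (by positivity)
          exact le_add_of_nonneg_right (by positivity)
  · have h1 := integral_pointLaw_comp hα0 hR (g := fun p => p ^ 2) (by fun_prop) (c := 1)
      fun p h0 h1 => by
        rw [abs_of_nonneg (sq_nonneg _)]; exact pow_le_one₀ h0 h1
    refine h1.trans_le ?_
    have h2 : ∫ r, p (r, 0) ^ 2 ∂(radialLaw α R)
        ≤ ∫ r, K ^ 2 * Real.exp (-β * r / 2) ∂(radialLaw α R) := by
      refine integral_mono_of_nonneg (ae_of_all _ fun r => sq_nonneg _)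
        ((hint β (by linarith)).const_mul _) ?_
      filter_upwards [radialLaw_ae_mem α R] with r hr
      calc p (r, 0) ^ 2 ≤ (K * Real.exp (-r / 2)) ^ 2 :=
            pow_le_pow_left₀ (hp0 _) (hK R r 0 hR hR4 hr.1 hr.2) 2
        _ = K ^ 2 * Real.exp (-r) := by
            rw [mul_pow, ← Real.exp_nat_mul]; congr 2; push_cast; ring
        _ ≤ _ := by
            have := hr.1
            gcongr; nlinarith
    refine h2.trans ?_
    rw [integral_const_mul]
    calc _ ≤ K ^ 2 * (5 * α / (α - β / 2) * Real.exp (-β * R / 2)) := by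
          gcongr
          exact integral_radialLaw_exp_le hα0 hR hR4 hβ
      _ = K ^ 2 * (5 * α / (α - β / 2)) * Real.exp (-β * C / 2) * (n : ℝ) ^ (-β) := by
          rw [hexp β]; ring
      _ ≤ _ := by
          refine mul_le_mul_of_nonneg_right ?_ (by positivity)
          exact le_add_of_nonneg_left (by positivity)

/-- In the range of radii where the mean degree `κ n e^{-r/2}` is at most `T`, the binomial and the
Poisson mixtures have nearly the same integrand. -/
lemma abs_radDens_mul_binomWeight_sub_le {α R r p γ η T c₀ : ℝ} {m k : ℕ} (hα : 1 / 2 < α)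
    (hR4 : 4 ≤ Real.exp (α * R)) (hr : 0 < r) (hrR : r ≤ R) (hp0 : 0 ≤ p)
    (hp : |p - kappa α * Real.exp (-r / 2)| ≤ c₀ * Real.exp (-γ * r)) (hη0 : 0 ≤ η)
    (hη : c₀ / kappa α * Real.exp (-(γ - 1 / 2) * r) ≤ η) (hη2 : η ≤ 1 / 2)
    (hT : 1 ≤ T) (hkT : (k : ℝ) ≤ T) (hTm : 4 * T ≤ (m + 1 : ℕ))
    (ht : kappa α * (m + 1 : ℕ) * Real.exp (-r / 2) ≤ T) :
    |radDens α R r * binomWeight m k p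
        - α * Real.exp (α * (r - R)) * poisWeight k (kappa α * (m + 1 : ℕ) * Real.exp (-r / 2))|
      ≤ α * Real.exp (α * (r - R)) * poisWeight k (kappa α * (m + 1 : ℕ) * Real.exp (-r / 2))
        * (Real.exp (10 * T ^ 2 / (m + 1 : ℕ) + 3 * T * η) * (1 + 4 * Real.exp (-α * r)) - 1) := by
  have hα0 : 0 < α := by linarith
  have hκ := kappa_pos hα
  have hn0 : (0 : ℝ) < (m + 1 : ℕ) := by positivity
  have hk0 : (0 : ℝ) ≤ k := Nat.cast_nonneg k
  set t := kappa α * (m + 1 : ℕ) * Real.exp (-r / 2) with htdef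
  have ht0 : 0 < t := by positivity
  have hpt : |((m + 1 : ℕ) : ℝ) * p - t| ≤ η * t := by
    have h1 : ((m + 1 : ℕ) : ℝ) * p - t = (m + 1 : ℕ) * (p - kappa α * Real.exp (-r / 2)) := by
      rw [htdef]; ring
    rw [h1, abs_mul, abs_of_pos hn0]
    calc _ ≤ (m + 1 : ℕ) * (c₀ * Real.exp (-γ * r)) := by gcongr
      _ = (c₀ / kappa α * Real.exp (-(γ - 1 / 2) * r)) * t := by
          have : Real.exp (-γ * r) = Real.exp (-(γ - 1 / 2) * r) * Real.exp (-r / 2) := by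
            rw [← Real.exp_add]; congr 1; ring
          rw [htdef, this]; field_simp
      _ ≤ η * t := by gcongr
  have hpT : p ≤ 2 * T / (m + 1 : ℕ) := by
    rw [le_div_iff₀ hn0]
    nlinarith [(abs_le.1 hpt).2]
  have hp2 : p ≤ 1 / 2 := hpT.trans (by rw [div_le_iff₀ hn0]; linarith)
  have h2k : 2 * k ≤ m + 1 := by
    have : 2 * (k : ℝ) ≤ (m + 1 : ℕ) := by linarith
    exact_mod_cast this
  have hcmp := abs_binomWeight_sub_poisWeight_le hp0 hp2 ht0.le hη0 hη2 h2k hpt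
  obtain ⟨n, hn⟩ : ∃ n : ℝ, n = (m + 1 : ℕ) := ⟨_, rfl⟩
  rw [← hn] at hcmp hpT hn0 ⊢
  set w := 10 * T ^ 2 / n + 3 * T * η with hw
  have hw' : 2 * (k : ℝ) ^ 2 / n + 2 * k * η + η * t + n * p ^ 2 + p * (k + 1) ≤ w := by
    have e1 : 2 * (k : ℝ) ^ 2 / n ≤ 2 * T ^ 2 / n := by gcongr
    have e2 : 2 * (k : ℝ) * η ≤ 2 * T * η := by gcongr
    have e3 : η * t ≤ η * T := by gcongr
    have e4 : n * p ^ 2 ≤ 4 * T ^ 2 / n := by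
      calc n * p ^ 2 ≤ n * (2 * T / n) ^ 2 := by gcongr
        _ = _ := by field_simp; norm_num
    have e5 : p * (k + 1) ≤ 4 * T ^ 2 / n := by
      calc p * (k + 1) ≤ 2 * T / n * (T + T) := by gcongr
        _ = _ := by ring
    have e6 : w = 2 * T ^ 2 / n + 2 * T * η + η * T + 4 * T ^ 2 / n + 4 * T ^ 2 / n := by
      rw [hw]; ring
    linarith
  have hP := poisWeight_nonneg (k := k) ht0.le
  have hcmp' : |binomWeight m k p - poisWeight k t| ≤ poisWeight k t * (Real.exp w - 1) :=
    hcmp.trans (mul_le_mul_of_nonneg_left (by linarith [Real.exp_le_exp.2 hw']) hP)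
  have hb : binomWeight m k p ≤ poisWeight k t * Real.exp w := by
    have := (abs_le.1 hcmp').2
    linarith
  have hb0 : 0 ≤ binomWeight m k p := binomWeight_nonneg hp0 (by linarith)
  set e := α * Real.exp (α * (r - R)) with he
  have he0 : 0 < e := by positivity
  have hρ : |radDens α R r - e| ≤ 4 * e * Real.exp (-α * r) := by
    refine (abs_radDens_sub_le hα0 hR4 hr.le hrR).trans_eq ?_
    rw [he, mul_assoc, mul_assoc, mul_assoc, ← Real.exp_add]
    congr 3; ring
  calc _ = |(radDens α R r - e) * binomWeight m k p
        + e * (binomWeight m k p - poisWeight k t)| := by congr 1; ring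
    _ ≤ |radDens α R r - e| * binomWeight m k p
        + e * |binomWeight m k p - poisWeight k t| := by
        refine (abs_add_le _ _).trans_eq ?_
        rw [abs_mul, abs_mul, abs_of_nonneg hb0, abs_of_pos he0]
    _ ≤ 4 * e * Real.exp (-α * r) * (poisWeight k t * Real.exp w)
        + e * (poisWeight k t * (Real.exp w - 1)) := by gcongr
    _ = _ := by ring

/-- A crude bound for radii at which the mean degree is large. -/
lemma abs_radDens_mul_binomWeight_sub_le_exp {α R r p T : ℝ} {m k : ℕ} (hα : 0 < α) (hR : 0 < R)
    (hR4 : 4 ≤ Real.exp (α * R)) (hr : 0 < r) (hrR : r ≤ R) (hp0 : 0 ≤ p) (hp1 : p ≤ 1) {t : ℝ}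
    (hkT : (k : ℝ) ≤ T / 16) (hT : 16 ≤ T) (hpT : T ≤ 2 * ((m + 1 : ℕ) * p)) (ht : T ≤ t) :
    |radDens α R r * binomWeight m k p - α * Real.exp (α * (r - R)) * poisWeight k t|
      ≤ 6 * (α * Real.exp (α * (r - R))) * Real.exp (-T / 8) := by
  have hρ0 := radDens_nonneg hα hR hr.le
  have hρ := radDens_le hα hR4 hr.le hrR
  have hb0 : 0 ≤ binomWeight m k p := binomWeight_nonneg hp0 hp1
  have hb : binomWeight m k p ≤ Real.exp (-T / 8) :=
    (binomWeight_le_exp hp0 hp1).trans (Real.exp_le_exp.2 (by push_cast at hpT; linarith))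
  have hP0 := poisWeight_nonneg (k := k) (by linarith : 0 ≤ t)
  have hP : poisWeight k t ≤ Real.exp (-T / 8) :=
    (poisWeight_le_exp (by linarith)).trans (Real.exp_le_exp.2 (by linarith))
  have h1 : radDens α R r * binomWeight m k p
      ≤ 5 * α * Real.exp (α * (r - R)) * Real.exp (-T / 8) := by gcongr
  have h2 : α * Real.exp (α * (r - R)) * poisWeight k t
      ≤ α * Real.exp (α * (r - R)) * Real.exp (-T / 8) := by gcongr
  have h3 : 0 ≤ radDens α R r * binomWeight m k p := by positivity
  have h4 : 0 ≤ α * Real.exp (α * (r - R)) * poisWeight k t := by positivity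
  rw [abs_le]
  constructor <;> linarith

/-- The trivial bound, for radii so close to the centre that the estimate of the neighbourhood
probability says nothing. -/
lemma abs_radDens_mul_binomWeight_sub_le_six {α R r p : ℝ} {m k : ℕ} (hα : 0 < α) (hR : 0 < R)
    (hR4 : 4 ≤ Real.exp (α * R)) (hr : 0 < r) (hrR : r ≤ R) (hp0 : 0 ≤ p) (hp1 : p ≤ 1) {t : ℝ}
    (ht : 0 ≤ t) :
    |radDens α R r * binomWeight m k p - α * Real.exp (α * (r - R)) * poisWeight k t|
      ≤ 6 * (α * Real.exp (α * (r - R))) := by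
  have hρ0 := radDens_nonneg hα hR hr.le
  have hρ := radDens_le hα hR4 hr.le hrR
  have hb0 : 0 ≤ binomWeight m k p := binomWeight_nonneg hp0 hp1
  have hb : binomWeight m k p ≤ 1 := binomWeight_le_one hp0 hp1
  have hP0 := poisWeight_nonneg (k := k) ht
  have hP : poisWeight k t ≤ 1 := poisWeight_le_one ht
  have h1 : radDens α R r * binomWeight m k p ≤ 5 * α * Real.exp (α * (r - R)) * 1 := by gcongr
  have h2 : α * Real.exp (α * (r - R)) * poisWeight k t ≤ α * Real.exp (α * (r - R)) * 1 := by
    gcongr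
  have h3 : 0 ≤ radDens α R r * binomWeight m k p := by positivity
  have h4 : 0 ≤ α * Real.exp (α * (r - R)) * poisWeight k t := by positivity
  rw [abs_le]
  constructor <;> linarith

end SingleVertex

/-! ### Asymptotics of the degree law of a single vertex -/

section SingleVertexLimit

lemma tendsto_discRadius (C : ℝ) : Tendsto (fun n : ℕ => discRadius C n) atTop atTop :=
  tendsto_atTop_add_const_right _ _
    ((Real.tendsto_log_atTop.comp tendsto_natCast_atTop_atTop).const_mul_atTop two_pos)

lemma tendsto_rpow_zero_of_neg {a : ℝ} (ha : a < 0) :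
    Tendsto (fun x : ℝ => x ^ a) atTop (𝓝 0) := by
  simpa using tendsto_rpow_neg_atTop (neg_pos.2 ha)

/-- The relative error of the Poisson approximation tends to zero when the mean degrees are at most
`x ^ d`, where `x` is the number of vertices. -/
lemma eventually_exp_error_le {α κ c d γ ε : ℝ} (hα : 0 < α) (hκ : 0 < κ)
    (hd : d < 1 / 2) (hγ : 1 / 2 < γ) (hγd : 1 < 2 * γ * (1 - d)) (hε : 0 < ε) :
    ∀ᶠ x : ℝ in atTop, c * (x ^ d / (κ * x)) ^ (2 * γ - 1) ≤ 1 / 2 ∧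
      Real.exp (10 * (x ^ d) ^ 2 / x + 3 * x ^ d * (c * (x ^ d / (κ * x)) ^ (2 * γ - 1)))
        * (1 + 4 * (x ^ d / (κ * x)) ^ (2 * α)) - 1 ≤ ε := by
  have hpow : ∀ b : ℝ, ∀ x : ℝ, 0 < x →
      (x ^ d / (κ * x)) ^ b = κ⁻¹ ^ b * x ^ ((d - 1) * b) := fun b x hx => by
    have h1 : x ^ d / (κ * x) = κ⁻¹ * x ^ (d - 1) := by
      rw [Real.rpow_sub hx, Real.rpow_one]; field_simp
    rw [h1, Real.mul_rpow (by positivity) (by positivity), ← Real.rpow_mul hx.le]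
  have hlim : ∀ b : ℝ, 0 < b → Tendsto (fun x : ℝ => (x ^ d / (κ * x)) ^ b) atTop (𝓝 0) :=
    fun b hb => by
    have h1 := (tendsto_rpow_zero_of_neg (a := (d - 1) * b) (by nlinarith)).const_mul (κ⁻¹ ^ b)
    rw [mul_zero] at h1
    refine h1.congr' ?_
    filter_upwards [eventually_gt_atTop 0] with x hx using (hpow b x hx).symm
  have h1 : Tendsto (fun x : ℝ => c * (x ^ d / (κ * x)) ^ (2 * γ - 1)) atTop (𝓝 0) := by
    simpa using (hlim (2 * γ - 1) (by linarith)).const_mul c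
  have h2 : Tendsto (fun x : ℝ => 10 * (x ^ d) ^ 2 / x) atTop (𝓝 0) := by
    have h := (tendsto_rpow_zero_of_neg (a := 2 * d - 1) (by linarith)).const_mul 10
    rw [mul_zero] at h
    refine h.congr' ?_
    filter_upwards [eventually_gt_atTop 0] with x hx
    rw [Real.rpow_sub hx, Real.rpow_one, mul_comm 2 d, Real.rpow_mul hx.le, Real.rpow_two]; ring
  have h3 : Tendsto (fun x : ℝ => 3 * x ^ d * (c * (x ^ d / (κ * x)) ^ (2 * γ - 1))) atTop
      (𝓝 0) := by
    have h := (tendsto_rpow_zero_of_neg (a := d + (d - 1) * (2 * γ - 1)) (by nlinarith)).const_mul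
      (3 * c * κ⁻¹ ^ (2 * γ - 1))
    rw [mul_zero] at h
    refine h.congr' ?_
    filter_upwards [eventually_gt_atTop 0] with x hx
    rw [hpow _ x hx, Real.rpow_add hx]; ring
  have h4 := ((Real.continuous_exp.tendsto _).comp (h2.add h3)).mul
    (((hlim (2 * α) (by linarith)).const_mul 4).const_add 1) |>.sub_const 1
  simp only [add_zero, mul_zero, Real.exp_zero, mul_one, sub_self] at h4
  filter_upwards [h1.eventually_le_const (by norm_num : (0 : ℝ) < 1 / 2),
    h4.eventually_le_const hε] with x e1 e2 using ⟨e1, e2⟩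

/-- Radii at which the mean degree exceeds `x ^ d` contribute a negligible amount. -/
lemma eventually_tail_error_le {α d' d c c' : ℝ} (hd : 0 < d) (h2 : d' * (2 * α + 1) < 2 * α)
    (hc : 0 < c) : ∀ᶠ x : ℝ in atTop,
      6 * Real.exp (-x ^ d / 8) + 6 * (c' * x ^ (-(2 * α)))
        ≤ c * (2 * x ^ d') ^ (-(2 * α + 1)) := by
  have h1 : Tendsto (fun x : ℝ => x ^ (d' * (2 * α + 1)) * Real.exp (-x ^ d / 8)) atTop (𝓝 0) := by
    have h := (tendsto_rpow_mul_exp_neg_mul_atTop_nhds_zero (d' * (2 * α + 1) / d) (1 / 8)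
      (by norm_num)).comp (tendsto_rpow_atTop hd)
    refine h.congr' ?_
    filter_upwards [eventually_gt_atTop 0] with x hx
    simp only [Function.comp]
    rw [← Real.rpow_mul hx.le, mul_div_cancel₀ _ hd.ne']
    ring_nf
  have h3 : Tendsto (fun x : ℝ => x ^ (d' * (2 * α + 1) - 2 * α)) atTop (𝓝 0) :=
    tendsto_rpow_zero_of_neg (by linarith)
  have h4 := (h1.const_mul 6).add ((h3.const_mul c').const_mul 6)
  simp only [mul_zero, add_zero] at h4
  have h5 : 0 < c * 2 ^ (-(2 * α + 1)) := by positivity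
  filter_upwards [h4.eventually_le_const h5, eventually_gt_atTop 0] with x e1 hx
  have e2 : (2 * x ^ d') ^ (-(2 * α + 1)) = 2 ^ (-(2 * α + 1)) * (x ^ (d' * (2 * α + 1)))⁻¹ := by
    rw [Real.mul_rpow (by norm_num) (by positivity), ← Real.rpow_mul hx.le, ← Real.rpow_neg hx.le]
    congr 2; ring
  have e3 : 0 < x ^ (d' * (2 * α + 1)) := by positivity
  rw [e2, ← mul_assoc c, ← div_eq_mul_inv, le_div_iff₀ e3]
  rw [Real.rpow_sub hx] at e1
  rw [Real.rpow_neg hx.le]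
  refine le_trans (le_of_eq ?_) e1
  field_simp

lemma integrableOn_exp_mul_sub_Iic {α R : ℝ} (hα : 0 < α) (c : ℝ) :
    IntegrableOn (fun r => α * Real.exp (α * (r - R))) (Iic c) := by
  have h := ((integrableOn_exp_mul_Iic hα c).const_mul (α * Real.exp (-(α * R))))
  refine IntegrableOn.congr_fun h (fun r _ => ?_) measurableSet_Iic
  rw [mul_assoc, ← Real.exp_add]; congr 2; ring

lemma integral_exp_mul_sub_Iic {α R : ℝ} (hα : 0 < α) (c : ℝ) :
    ∫ r in Iic c, α * Real.exp (α * (r - R)) = Real.exp (α * (c - R)) := by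
  have h : ∀ r, α * Real.exp (α * (r - R)) = α * Real.exp (-(α * R)) * Real.exp (α * r) :=
    fun r => by rw [mul_assoc, ← Real.exp_add]; congr 2; ring
  simp_rw [h]
  rw [integral_const_mul, integral_exp_mul_Iic hα, mul_sub, sub_eq_add_neg, Real.exp_add]
  field_simp

/-- A pointwise comparison of integrands, with a relative error `ε`, a relative error `6 e₁` of the
density, and a crude bound below the radius `r₀`, gives a comparison of the mixtures. -/
lemma abs_integral_binomWeight_sub_le {α C r₀ e₁ ε : ℝ} (hα : 1 / 2 < α) {m k : ℕ}
    (hR : 0 < discRadius C (m + 1)) (hr₀ : 0 < r₀)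
    (hε : 0 ≤ ε) (he₁ : 0 ≤ e₁) {p : ℝ → ℝ} (hpm : Measurable p) (hp0 : ∀ r, 0 ≤ p r)
    (hp1 : ∀ r, p r ≤ 1)
    (hpt : ∀ r ∈ Ioc 0 (discRadius C (m + 1)),
      |radDens α (discRadius C (m + 1)) r * binomWeight m k (p r)
          - α * Real.exp (α * (r - discRadius C (m + 1)))
            * poisWeight k (kappa α * (m + 1 : ℕ) * Real.exp (-r / 2))|
        ≤ ε * (α * Real.exp (α * (r - discRadius C (m + 1)))
            * poisWeight k (kappa α * (m + 1 : ℕ) * Real.exp (-r / 2)))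
          + 6 * e₁ * (α * Real.exp (α * (r - discRadius C (m + 1))))
          + 6 * (Iic r₀).indicator (fun r => α * Real.exp (α * (r - discRadius C (m + 1)))) r) :
    |∫ r, binomWeight m k (p r) ∂(radialLaw α (discRadius C (m + 1))) - degEqLimit α C k|
      ≤ ε * degEqLimit α C k + 6 * e₁ + 6 * Real.exp (α * (r₀ - discRadius C (m + 1))) := by
  have hα0 : 0 < α := by linarith
  have hκ := kappa_pos hα
  set R := discRadius C (m + 1)
  set e : ℝ → ℝ := fun r => α * Real.exp (α * (r - R))
  set g : ℝ → ℝ := fun r => e r * poisWeight k (kappa α * (m + 1 : ℕ) * Real.exp (-r / 2)) with hg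
  set f : ℝ → ℝ := (Ioc 0 R).indicator fun r => radDens α R r * binomWeight m k (p r) with hf
  have he0 : ∀ r, 0 < e r := fun r => by positivity
  have ht0 : ∀ r, 0 ≤ kappa α * (m + 1 : ℕ) * Real.exp (-r / 2) := fun r => by positivity
  have hg0 : ∀ r, 0 ≤ g r := fun r => mul_nonneg (he0 r).le (poisWeight_nonneg (ht0 r))
  have hge : ∀ r, g r ≤ e r := fun r =>
    mul_le_of_le_one_right (he0 r).le (poisWeight_le_one (ht0 r))
  have hL : degEqLimit α C k = ∫ r in Iic R, g r :=
    degEqLimit_eq_integral hα (Nat.succ_pos m) k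
  have heI : IntegrableOn e (Iic R) := integrableOn_exp_mul_sub_Iic hα0 R
  have hgc : Continuous g := by
    have := continuous_poisWeight k
    simp only [hg, e]; fun_prop
  have hgI : IntegrableOn g (Iic R) := heI.mono' hgc.aestronglyMeasurable
    (ae_of_all _ fun r => by rw [Real.norm_of_nonneg (hg0 r)]; exact hge r)
  have hbm : Measurable fun r => binomWeight m k (p r) := (measurable_binomWeight m k).comp hpm
  have hfI' : IntegrableOn (fun r => radDens α R r * binomWeight m k (p r)) (Ioc 0 R) := by
    refine Integrable.mono' ((continuous_radDens α R).integrableOn_Ioc)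
      (((continuous_radDens α R).measurable.mul hbm).aestronglyMeasurable) ?_
    refine (ae_restrict_iff' measurableSet_Ioc).2 (ae_of_all _ fun r hr => ?_)
    have hρ := radDens_nonneg hα0 hR hr.1.le
    have hb := binomWeight_nonneg (m := m) (j := k) (hp0 r) (hp1 r)
    rw [Real.norm_of_nonneg (by positivity)]
    exact mul_le_of_le_one_right hρ (binomWeight_le_one (hp0 r) (hp1 r))
  have hfI : IntegrableOn f (Iic R) :=
    ((integrable_indicator_iff measurableSet_Ioc).2 hfI').integrableOn
  have hP : ∫ r, binomWeight m k (p r) ∂(radialLaw α R) = ∫ r in Iic R, f r := by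
    rw [integral_radialLaw hα0 hR, intervalIntegral.integral_of_le hR.le, hf,
      setIntegral_indicator measurableSet_Ioc,
      inter_eq_right.2 Ioc_subset_Iic_self]
  set q : ℝ → ℝ := (Iic r₀).indicator e
  have hqI : IntegrableOn q (Iic R) :=
    ((integrable_indicator_iff measurableSet_Iic).2
      (integrableOn_exp_mul_sub_Iic hα0 r₀)).integrableOn
  have hq0 : ∀ r, 0 ≤ q r := fun r => indicator_nonneg (fun r _ => (he0 r).le) r
  have hqint : ∫ r in Iic R, q r ≤ Real.exp (α * (r₀ - R)) := by
    have h : ∫ r, q r = Real.exp (α * (r₀ - R)) := by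
      rw [integral_indicator measurableSet_Iic, integral_exp_mul_sub_Iic hα0]
    rw [← h]
    exact setIntegral_le_integral ((integrable_indicator_iff measurableSet_Iic).2
      (integrableOn_exp_mul_sub_Iic hα0 r₀)) (ae_of_all _ hq0)
  have heint : ∫ r in Iic R, e r = 1 := by
    rw [integral_exp_mul_sub_Iic hα0]; simp
  rw [hP, hL, ← integral_sub hfI hgI, ← Real.norm_eq_abs]
  have hbound : ∀ r ∈ Iic R, ‖f r - g r‖ ≤ ε * g r + 6 * e₁ * e r + 6 * q r := fun r hr => by
    rw [Real.norm_eq_abs]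
    rcases lt_or_ge 0 r with h | h
    · have hfr : f r = radDens α R r * binomWeight m k (p r) :=
        indicator_of_mem (show r ∈ Ioc 0 R from ⟨h, hr⟩) _
      rw [hfr]; exact hpt r ⟨h, hr⟩
    · have hfr : f r = 0 := indicator_of_notMem (fun h' => absurd h'.1 (not_lt.2 h)) _
      have hqr : q r = e r := indicator_of_mem (show r ∈ Iic r₀ from h.trans hr₀.le) _
      rw [hfr, hqr, zero_sub, abs_neg, abs_of_nonneg (hg0 r)]
      have := hge r
      have := he0 r
      have : 0 ≤ ε * g r := mul_nonneg hε (hg0 r)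
      have : 0 ≤ 6 * e₁ * e r := by positivity
      linarith
  have hI1 : IntegrableOn (fun r => ε * g r + 6 * e₁ * e r) (Iic R) :=
    (hgI.const_mul _).add (heI.const_mul _)
  have h1 := norm_integral_le_of_norm_le (hI1.add (hqI.const_mul 6))
    ((ae_restrict_iff' measurableSet_Iic).2 (ae_of_all _ hbound))
  refine h1.trans ?_
  have h2 : ∫ r in Iic R, (ε * g r + 6 * e₁ * e r + 6 * q r)
      = ε * (∫ r in Iic R, g r) + 6 * e₁ + 6 * ∫ r in Iic R, q r := by
    rw [integral_add hI1 (hqI.const_mul 6), integral_add (hgI.const_mul _) (heI.const_mul _),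
      integral_const_mul ε, integral_const_mul (6 * e₁), integral_const_mul 6, heint, mul_one]
  refine h2.le.trans ?_
  linarith

/-- The probability that a given vertex has degree `k` agrees with the limiting fraction up to a
factor `1 + o(1)`, uniformly for `k` up to a small power of the number of vertices. -/
theorem eventually_abs_integral_binomWeight_sub_le {α d' d ε : ℝ} (C : ℝ) (hα : 1 / 2 < α)
    (hd' : 0 < d') (hdd : d' < d) (hd : d < 1 / 2) (hdα : 1 < 2 * α * (1 - d))
    (h2 : d' * (2 * α + 1) < 2 * α) (hε : 0 < ε) :
    ∀ᶠ m : ℕ in atTop, ∀ k : ℕ, (k : ℝ) ≤ ((m + 1 : ℕ) : ℝ) ^ d' →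
      |∫ a, binomWeight m k
          (nbrProb (pointLaw α (discRadius C (m + 1))) (hypRel (discRadius C (m + 1))) a)
          ∂(pointLaw α (discRadius C (m + 1))) - degEqLimit α C k| ≤ ε * degEqLimit α C k := by
  have hα0 : 0 < α := by linarith
  have hκ := kappa_pos hα
  have hd0 : 0 < d := hd'.trans hdd
  have h1d : 0 < 1 - d := by linarith
  -- an exponent strictly between `1 / 2` and `min α 1` for the error of the neighbourhood estimate
  obtain ⟨γ, hγl, hγu⟩ : ∃ γ, 1 / (2 * (1 - d)) < γ ∧ γ < min α 1 := by
    refine exists_between (lt_min ?_ ?_)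
    · rw [div_lt_iff₀ (by linarith)]; linarith
    · rw [div_lt_iff₀ (by linarith)]; linarith
  have hγα : γ < α := hγu.trans_le (min_le_left _ _)
  have hγ1 : γ < 1 := hγu.trans_le (min_le_right _ _)
  have hγd : 1 < 2 * γ * (1 - d) := by
    rw [div_lt_iff₀ (by linarith)] at hγl; linarith
  have hγ : 1 / 2 < γ := by nlinarith
  have hαγ : 0 < α - γ := by linarith
  obtain ⟨c₀, hc₀def⟩ : ∃ c₀, c₀ = 20 * α / (α - γ) + 8 * α + kappa α := ⟨_, rfl⟩
  have hc₀ : 0 < c₀ := by rw [hc₀def]; positivity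
  -- beyond `r₀` the neighbourhood probability is at least half of its leading term
  obtain ⟨r₀, hr₀pos, hr₀⟩ : ∃ r₀ > 0, ∀ r, r₀ ≤ r →
      c₀ / kappa α * Real.exp (-(γ - 1 / 2) * r) ≤ 1 / 2 := by
    have h : Tendsto (fun r : ℝ => c₀ / kappa α * Real.exp (-(γ - 1 / 2) * r)) atTop (𝓝 0) := by
      have h1 : Tendsto (fun r : ℝ => -(γ - 1 / 2) * r) atTop atBot :=
        tendsto_id.const_mul_atTop_of_neg (by linarith)
      simpa using (Real.tendsto_exp_atBot.comp h1).const_mul (c₀ / kappa α)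
    obtain ⟨r₁, hr₁⟩ := eventually_atTop.1 (h.eventually_le_const (by norm_num : (0 : ℝ) < 1 / 2))
    exact ⟨max r₁ 1, lt_max_of_lt_right one_pos, fun r hr => hr₁ r ((le_max_left _ _).trans hr)⟩
  obtain ⟨c, hc, hcL⟩ := exists_le_degEqLimit C hα
  have hN : Tendsto (fun m : ℕ => ((m + 1 : ℕ) : ℝ)) atTop atTop :=
    tendsto_natCast_atTop_atTop.comp (tendsto_add_atTop_nat 1)
  have hRt := (tendsto_discRadius C).comp (tendsto_add_atTop_nat 1)
  have E1 := hN.eventually (eventually_exp_error_le (c := c₀ / kappa α) hα0 hκ hd hγ hγd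
    (half_pos hε))
  have E2 := hN.eventually (eventually_tail_error_le (c' := Real.exp (α * r₀ - α * C)) hd0 h2
    (mul_pos (half_pos hε) hc))
  have E3 := hRt.eventually (eventually_gt_atTop 0)
  have E4 := (Real.tendsto_exp_atTop.comp (hRt.const_mul_atTop hα0)).eventually
    (eventually_ge_atTop 4)
  have E5 := hN.eventually ((tendsto_rpow_atTop (sub_pos.2 hdd)).eventually (eventually_ge_atTop 16))
  have E6 := hN.eventually ((tendsto_rpow_atTop hd0).eventually (eventually_ge_atTop 16))
  have E7 := hN.eventually ((tendsto_rpow_atTop h1d).eventually (eventually_ge_atTop 4))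
  filter_upwards [E1, E2, E3, E4, E5, E6, E7] with m e1 e2 hR hR4 e5 e6 e7 k hk
  simp only [Function.comp] at hR hR4
  obtain ⟨e1a, e1b⟩ := e1
  have hx0 : (0 : ℝ) < (m + 1 : ℕ) := by positivity
  have hx1 : (1 : ℝ) ≤ (m + 1 : ℕ) := by exact_mod_cast Nat.succ_pos m
  set R := discRadius C (m + 1) with hRdef
  set x : ℝ := ((m + 1 : ℕ) : ℝ) with hx
  -- `T` separates small from large mean degrees, `s` bounds `e^{-r/2}` where the mean degree is at
  -- most `T`, and `η` is the relative error of the neighbourhood probability there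
  set T := x ^ d with hTdef
  set s := T / (kappa α * x) with hs
  set η := c₀ / kappa α * s ^ (2 * γ - 1) with hη
  have hT0 : 0 < T := by positivity
  have hs0 : 0 < s := by positivity
  have hkT : (k : ℝ) ≤ T / 16 := by
    have : T = x ^ d' * x ^ (d - d') := by rw [hTdef, ← Real.rpow_add hx0]; congr 1; ring
    have h0 : 0 ≤ x ^ d' := by positivity
    nlinarith
  have hTx : 4 * T ≤ x := by
    have : x = T * x ^ (1 - d) := by
      rw [hTdef, ← Real.rpow_add hx0, add_sub_cancel, Real.rpow_one]
    nlinarith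
  set p : ℝ → ℝ := fun r => nbrProb (pointLaw α R) (hypRel R) (r, 0) with hp
  have := isProbabilityMeasure_pointLaw hα0 hR
  have hpm : Measurable p :=
    (measurable_nbrProb_pointLaw hα0 hR).comp (measurable_id.prodMk measurable_const)
  have hp0 : ∀ r, 0 ≤ p r := fun r => nbrProb_nonneg _ _ _
  have hp1 : ∀ r, p r ≤ 1 := fun r => nbrProb_le_one _ _ _
  have hpκ : ∀ r ∈ Ioc 0 R, |p r - kappa α * Real.exp (-r / 2)| ≤ c₀ * Real.exp (-γ * r) :=
    fun r hr => by
    rw [hc₀def]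
    exact abs_nbrProb_pointLaw_sub_le hα hγ.le hγ1.le hγα hR hR4 hr.1 hr.2 0
  rw [integral_pointLaw_comp hα0 hR (measurable_binomWeight m k) (c := 1) fun q h0 h1 => by
    rw [abs_of_nonneg (binomWeight_nonneg h0 h1)]; exact binomWeight_le_one h0 h1]
  have hL0 : 0 ≤ degEqLimit α C k := le_trans (by positivity) (hcL k)
  have main := abs_integral_binomWeight_sub_le (C := C) (r₀ := r₀) (e₁ := Real.exp (-T / 8))
    (ε := ε / 2) hα (m := m) (k := k) hR hr₀pos (half_pos hε).le (Real.exp_pos _).le hpm hp0 hp1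
    fun r hr => by
      have he0 : 0 < α * Real.exp (α * (r - R)) := by positivity
      have ht0 : 0 < kappa α * x * Real.exp (-r / 2) := by positivity
      have hP0 := mul_nonneg he0.le (poisWeight_nonneg (k := k) ht0.le)
      have hi0 : 0 ≤ (Iic r₀).indicator (fun r => α * Real.exp (α * (r - R))) r :=
        indicator_nonneg (fun r _ => by positivity) r
      rcases le_or_gt (kappa α * x * Real.exp (-r / 2)) T with hcase | hcase
      · -- small mean degree: the integrands agree up to a relative error
        have hes : Real.exp (-r / 2) ≤ s := by
          rw [hs, le_div_iff₀ (by positivity)]; linarith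
        have hpow : ∀ b : ℝ, 0 ≤ b → Real.exp (-(b / 2) * r) ≤ s ^ b := fun b hb => by
          have : Real.exp (-(b / 2) * r) = Real.exp (-r / 2) ^ b := by
            rw [← Real.exp_mul]; congr 1; ring
          rw [this]
          exact Real.rpow_le_rpow (Real.exp_pos _).le hes hb
        have hη1 : c₀ / kappa α * Real.exp (-(γ - 1 / 2) * r) ≤ η := by
          have := hpow (2 * γ - 1) (by linarith)
          rw [show (2 * γ - 1) / 2 = γ - 1 / 2 by ring] at this
          rw [hη]; gcongr
        have hαs : Real.exp (-α * r) ≤ s ^ (2 * α) := by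
          have := hpow (2 * α) (by linarith)
          rwa [show 2 * α / 2 = α by ring] at this
        have h := abs_radDens_mul_binomWeight_sub_le (k := k) hα hR4 hr.1 hr.2 (hp0 r) (hpκ r hr)
          (by positivity) hη1 e1a (by linarith) (by linarith) hTx hcase
        refine h.trans ?_
        have h3 : Real.exp (10 * T ^ 2 / x + 3 * T * η) * (1 + 4 * Real.exp (-α * r)) - 1
            ≤ ε / 2 := by
          refine le_trans ?_ e1b
          gcongr
        have h4 := mul_le_mul_of_nonneg_left h3 hP0
        have h5 : 0 ≤ 6 * Real.exp (-T / 8) * (α * Real.exp (α * (r - R))) := by positivity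
        linarith
      · have hP1 : 0 ≤ ε / 2 * (α * Real.exp (α * (r - R))
            * poisWeight k (kappa α * x * Real.exp (-r / 2))) := mul_nonneg (half_pos hε).le hP0
        -- large mean degree: both weights are tiny, except perhaps near the centre
        rcases le_or_gt r r₀ with hrr | hrr
        · have h := abs_radDens_mul_binomWeight_sub_le_six (m := m) (k := k) hα0 hR hR4 hr.1 hr.2
            (hp0 r) (hp1 r) ht0.le
          rw [indicator_of_mem (show r ∈ Iic r₀ from hrr)]
          have : 0 ≤ 6 * Real.exp (-T / 8) * (α * Real.exp (α * (r - R))) := by positivity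
          linarith
        · have hpT : T ≤ 2 * (((m + 1 : ℕ) : ℝ) * p r) := by
            have h3 := (abs_le.1 (hpκ r hr)).1
            have h4 := hr₀ r hrr.le
            have h5 : c₀ * Real.exp (-γ * r) ≤ 1 / 2 * (kappa α * Real.exp (-r / 2)) := by
              have : c₀ * Real.exp (-γ * r)
                  = c₀ / kappa α * Real.exp (-(γ - 1 / 2) * r) * (kappa α * Real.exp (-r / 2)) := by
                have : Real.exp (-γ * r) = Real.exp (-(γ - 1 / 2) * r) * Real.exp (-r / 2) := by
                  rw [← Real.exp_add]; congr 1; ring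
                rw [this]; field_simp
              rw [this]; gcongr
            have h6 : kappa α * Real.exp (-r / 2) ≤ 2 * p r := by linarith
            have h7 := mul_le_mul_of_nonneg_left h6 hx0.le
            linarith
          have h := abs_radDens_mul_binomWeight_sub_le_exp (m := m) hα0 hR hR4 hr.1 hr.2
            (hp0 r) (hp1 r) hkT e6 hpT hcase.le
          linarith
  refine main.trans ?_
  have hexp : Real.exp (α * (r₀ - R)) = Real.exp (α * r₀ - α * C) * x ^ (-(2 * α)) := by
    have h := exp_mul_discRadius (C := C) (Nat.succ_pos m) (-α)
    rw [mul_sub, sub_eq_add_neg, Real.exp_add, ← neg_mul, h, sub_eq_add_neg, Real.exp_add]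
    rw [show 2 * -α = -(2 * α) by ring, show -α * C = -(α * C) by ring]
    ring
  have hkL : ε / 2 * c * (2 * x ^ d') ^ (-(2 * α + 1)) ≤ ε / 2 * degEqLimit α C k := by
    rw [mul_assoc]
    refine mul_le_mul_of_nonneg_left (le_trans ?_ (hcL k)) (half_pos hε).le
    refine mul_le_mul_of_nonneg_left ?_ hc.le
    refine Real.rpow_le_rpow_of_nonpos (by positivity) ?_ (by linarith)
    have : 1 ≤ x ^ d' := Real.one_le_rpow hx1 hd'.le
    linarith
  rw [hexp]
  linarith

end SingleVertexLimit

/-! ### The number of vertices of a given degree -/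

section DegreeEq

lemma degree_graph {C : ℝ} {n : ℕ} (x : Fin n → ℝ × ℝ) (v : Fin n)
    [Fintype ((graph C n x).neighborSet v)] :
    (graph C n x).degree v = degCount (hypRel (discRadius C n)) x v := by
  classical
  unfold degCount
  rw [← SimpleGraph.card_neighborFinset_eq_degree]
  congr 1
  ext w
  rw [SimpleGraph.mem_neighborFinset]
  simp [graph, hypRel, ne_comm]

lemma fracDegEq_graph {C : ℝ} {n : ℕ} (x : Fin n → ℝ × ℝ) (k : ℕ) :
    fracDegEq (graph C n x) k = degEqCount (hypRel (discRadius C n)) k x / n := by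
  unfold fracDegEq degEqCount
  simp_rw [degree_graph]

lemma coordLaw_eq_pi (α C : ℝ) (n : ℕ) :
    coordLaw α C n = Measure.pi fun _ : Fin n => pointLaw α (discRadius C n) := rfl

/-- To prove that a property holds with high probability it is enough to find exceptional sets of
positions whose probability tends to zero. The number of vertices is written `m + 1`. -/
lemma whp_of_tendsto_bad {α C : ℝ} (hα : 0 < α) {P : (n : ℕ) → SimpleGraph (Fin n) → Prop}
    (bad : (m : ℕ) → Set (Fin (m + 1) → ℝ × ℝ))
    (hP : ∀ᶠ m in atTop, ∀ x, x ∉ bad m → P (m + 1) (graph C (m + 1) x))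
    (hbad : Tendsto (fun m => coordLaw α C (m + 1) (bad m)) atTop (𝓝 0)) : WHP α C P := by
  unfold WHP
  rw [← tendsto_add_atTop_iff_nat 1]
  have hR := ((tendsto_discRadius C).comp (tendsto_add_atTop_nat 1)).eventually
    (eventually_gt_atTop 0)
  have h1 : Tendsto (fun m => 1 - coordLaw α C (m + 1) (bad m)) atTop (𝓝 1) := by
    simpa using ENNReal.Tendsto.sub (tendsto_const_nhds (x := (1 : ENNReal))) hbad
      (Or.inl ENNReal.one_ne_top)
  refine tendsto_of_tendsto_of_tendsto_of_le_of_le' h1 tendsto_const_nhds ?_ ?_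
  · filter_upwards [hP, hR] with m hm hRm
    have := isProbabilityMeasure_pointLaw hα hRm
    simp only [Function.comp] at this
    rw [tsub_le_iff_right, coordLaw_eq_pi]
    calc (1 : ENNReal) = (Measure.pi fun _ : Fin (m + 1) => pointLaw α (discRadius C (m + 1))) univ :=
          measure_univ.symm
      _ ≤ _ := measure_mono fun x _ => ?_
      _ ≤ _ := measure_union_le _ (bad m)
    by_cases hx : x ∈ bad m
    · exact Or.inr hx
    · exact Or.inl (hm x hx)
  · filter_upwards [hR] with m hRm
    have := isProbabilityMeasure_pointLaw hα hRm
    simp only [Function.comp] at this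
    rw [coordLaw_eq_pi]
    exact prob_le_one

/-- The inequalities satisfied by the exponent `δ`. -/
lemma delta_bounds {α : ℝ} (hα : 1 / 2 < α) :
    0 < delta α ∧ delta α < 1 / 2 ∧ 1 < 2 * α * (1 - delta α) ∧
      delta α * (4 * α + 3) < 1 ∧ delta α * (4 * α + 3) < 2 * α - 1 := by
  have h1 : delta α * (4 * (2 * α + 1) * α) ≤ 2 * α - 1 := by
    rw [← le_div_iff₀ (by positivity)]; exact min_le_left _ _
  have h2 : delta α * (5 * (2 * α + 1)) ≤ 2 * (2 * α - 1) := by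
    rw [← le_div_iff₀ (by positivity)]; exact min_le_right _ _
  have h0 : 0 < delta α := by
    have : 0 < 2 * α - 1 := by linarith
    exact lt_min (by positivity) (by positivity)
  generalize delta α = d at *
  have h3 : d * (4 * α + 3) < 1 := by
    have : d * (4 * (2 * α + 1) * α) < 4 * α * (2 * α + 1) / (4 * α + 3) := by
      refine h1.trans_lt ?_
      rw [lt_div_iff₀ (by positivity)]; nlinarith
    rw [lt_div_iff₀ (by positivity)] at this
    have h5 : 0 < 4 * α * (2 * α + 1) := by positivity
    by_contra hcon
    push Not at hcon
    nlinarith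
  have h4 : d * (4 * α + 3) < 2 * α - 1 := by nlinarith
  exact ⟨h0, by nlinarith, by nlinarith, h3, h4⟩

/-- The fraction of vertices of degree `k` agrees with the limiting fraction up to a factor
`1 + o(1)`, for all `k` up to a power `d'` of the number of vertices. The union over `k` of the
deviations controlled by Chebyshev's inequality has a small probability since
`d' (4 α + 3) < min 1 (2 α - 1)`. -/
theorem whp_fracDegEq {α d' : ℝ} (C : ℝ) (hα : 1 / 2 < α) (hd' : 0 < d') (hdd : d' < delta α) {ε : ℝ}
    (hε : 0 < ε) :
    WHP α C fun n G => ∀ k : ℕ, (k : ℝ) ≤ (n : ℝ) ^ d' →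
      |fracDegEq G k - degEqLimit α C k| ≤ ε * degEqLimit α C k := by
  obtain ⟨hδ0, hδ1, hδ2, hδ3, hδ4⟩ := delta_bounds hα
  have hα0 : 0 < α := by linarith
  obtain ⟨c, hc, hcL⟩ := exists_le_degEqLimit C hα
  -- `β ≤ 2` and `β < 2 α`, so the second moment of the neighbourhood probability is `O(n^{-β})`
  obtain ⟨β, hβ⟩ : ∃ β, β = 1 + delta α * (4 * α + 3) := ⟨_, rfl⟩
  have hβ1 : 1 ≤ β := by rw [hβ]; nlinarith
  obtain ⟨K, hK0, hK⟩ := exists_integral_nbrProb_le C (β := β) hα hβ1 (by linarith) (by linarith)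
  set μ : ℕ → Measure (ℝ × ℝ) := fun m => pointLaw α (discRadius C (m + 1))
  set A : ℕ → Set ((ℝ × ℝ) × (ℝ × ℝ)) := fun m => hypRel (discRadius C (m + 1))
  set P : ℕ → ℕ → ℝ := fun m k => ∫ a, binomWeight m k (nbrProb (μ m) (A m) a) ∂(μ m)
  set L : ℕ → ℝ := degEqLimit α C
  have hL0 : ∀ k, 0 < L k := fun k => lt_of_lt_of_le (by positivity) (hcL k)
  -- some degree count deviates from its mean by more than a third of the allowed error
  set bad : (m : ℕ) → Set (Fin (m + 1) → ℝ × ℝ) := fun m =>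
    ⋃ k ∈ Finset.range (⌊((m + 1 : ℕ) : ℝ) ^ d'⌋₊ + 1),
      {x | (m + 1 : ℕ) * (ε / 3 * L k) ≤ |(degEqCount (A m) k x : ℝ) - (m + 1 : ℕ) * P m k|} with hbad
  have hN : Tendsto (fun m : ℕ => ((m + 1 : ℕ) : ℝ)) atTop atTop :=
    tendsto_natCast_atTop_atTop.comp (tendsto_add_atTop_nat 1)
  have hRt := (tendsto_discRadius C).comp (tendsto_add_atTop_nat 1)
  have E3 := hRt.eventually (eventually_gt_atTop 0)
  have E4 := (Real.tendsto_exp_atTop.comp (hRt.const_mul_atTop hα0)).eventually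
    (eventually_ge_atTop 4)
  refine whp_of_tendsto_bad hα0 bad ?_ ?_
  · filter_upwards [eventually_abs_integral_binomWeight_sub_le C hα hd' hdd hδ1 hδ2 (by nlinarith)
      (div_pos hε three_pos)] with m hm x hx k hk
    have hn : (0 : ℝ) < (m + 1 : ℕ) := by positivity
    have hkr : k ∈ Finset.range (⌊((m + 1 : ℕ) : ℝ) ^ d'⌋₊ + 1) := by
      rw [Finset.mem_range, Nat.lt_succ_iff]; exact Nat.le_floor hk
    have hx' : |(degEqCount (A m) k x : ℝ) - (m + 1 : ℕ) * P m k| < (m + 1 : ℕ) * (ε / 3 * L k) := by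
      by_contra hcon
      exact hx (mem_iUnion₂.2 ⟨k, hkr, not_lt.1 hcon⟩)
    rw [fracDegEq_graph]
    have h1 : |(degEqCount (A m) k x : ℝ) / (m + 1 : ℕ) - P m k| < ε / 3 * L k := by
      have : (degEqCount (A m) k x : ℝ) / (m + 1 : ℕ) - P m k
          = ((degEqCount (A m) k x : ℝ) - (m + 1 : ℕ) * P m k) / (m + 1 : ℕ) := by field_simp
      rw [this, abs_div, abs_of_pos hn, div_lt_iff₀ hn]
      linarith
    have h2 : |P m k - L k| ≤ ε / 3 * L k := hm k hk
    refine (abs_sub_le _ (P m k) _).trans ?_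
    have := mul_pos hε (hL0 k)
    have h3 : ε * degEqLimit α C k = ε / 3 * L k + ε / 3 * L k + ε * L k / 3 := by
      simp only [L]; ring
    rw [h3]
    linarith
  · -- the exponent of the number of vertices in the union bound is negative
    set Q : ℝ := 2 * (2 + 4 * K) / ((ε / 3 * c * 2 ^ (-(2 * α + 1))) ^ 2) with hQ
    have hlim : Tendsto (fun m : ℕ => ENNReal.ofReal
        (Q * ((m + 1 : ℕ) : ℝ) ^ (1 - β + d' * (4 * α + 3)))) atTop (𝓝 0) := by
      have h1 := ((tendsto_rpow_zero_of_neg (a := 1 - β + d' * (4 * α + 3))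
        (by rw [hβ]; nlinarith)).comp hN).const_mul Q
      rw [mul_zero] at h1
      simpa using ENNReal.tendsto_ofReal h1
    refine tendsto_of_tendsto_of_tendsto_of_le_of_le' tendsto_const_nhds hlim
      (Eventually.of_forall fun m => zero_le) ?_
    filter_upwards [E3, E4] with m hR hR4
    simp only [Function.comp] at hR hR4
    have hprob : IsProbabilityMeasure (μ m) := isProbabilityMeasure_pointLaw hα0 hR
    obtain ⟨hK1, hK2⟩ := hK (m + 1) (Nat.succ_pos m) hR hR4
    change ∫ a, nbrProb (μ m) (A m) a ∂(μ m) ≤ _ at hK1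
    change ∫ a, nbrProb (μ m) (A m) a ^ 2 ∂(μ m) ≤ _ at hK2
    obtain ⟨x, hx⟩ : ∃ x : ℝ, x = (m + 1 : ℕ) := ⟨_, rfl⟩
    have hx0 : 0 < x := by rw [hx]; positivity
    have hx1 : 1 ≤ x := by rw [hx]; exact_mod_cast Nat.succ_pos m
    have hxd : 1 ≤ x ^ d' := Real.one_le_rpow hx1 hd'.le
    have hxβ : 1 ≤ x ^ (2 - β) := Real.one_le_rpow hx1 (by linarith)
    simp only [hbad]
    rw [← hx] at hK1 hK2 ⊢
    have hnum : 2 + 2 * (x * ∫ a, nbrProb (μ m) (A m) a ∂(μ m))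
        + 2 * (x ^ 2 * ∫ a, nbrProb (μ m) (A m) a ^ 2 ∂(μ m)) ≤ (2 + 4 * K) * x ^ (2 - β) := by
      have e1 : x * ∫ a, nbrProb (μ m) (A m) a ∂(μ m) ≤ K := by
        calc _ ≤ x * (K * x ^ (-1 : ℝ)) := by gcongr
          _ = K := by rw [Real.rpow_neg_one]; field_simp
      have e2 : x ^ 2 * ∫ a, nbrProb (μ m) (A m) a ^ 2 ∂(μ m) ≤ K * x ^ (2 - β) := by
        calc _ ≤ x ^ 2 * (K * x ^ (-β)) := by gcongr
          _ = K * x ^ (2 - β) := by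
            rw [sub_eq_add_neg, Real.rpow_add hx0, Real.rpow_two]; ring
      nlinarith
    have hk : ∀ k ∈ Finset.range (⌊x ^ d'⌋₊ + 1), coordLaw α C (m + 1)
        {y | x * (ε / 3 * L k) ≤ |(degEqCount (A m) k y : ℝ) - x * P m k|}
        ≤ ENNReal.ofReal ((2 + 4 * K) / ((ε / 3 * c * 2 ^ (-(2 * α + 1))) ^ 2)
          * x ^ (1 - β + d' * (4 * α + 2))) := fun k hk => by
      have hkd : (k : ℝ) ≤ x ^ d' := by
        rw [Finset.mem_range, Nat.lt_succ_iff] at hk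
        exact (Nat.le_floor_iff (by positivity)).1 hk
      have hLk : c * (2 ^ (-(2 * α + 1)) * x ^ (-(d' * (2 * α + 1)))) ≤ L k := by
        refine le_trans ?_ (hcL k)
        rw [show -(d' * (2 * α + 1)) = d' * -(2 * α + 1) by ring, Real.rpow_mul hx0.le,
          ← Real.mul_rpow (by norm_num) (by positivity)]
        refine mul_le_mul_of_nonneg_left ?_ hc.le
        exact Real.rpow_le_rpow_of_nonpos (by positivity) (by linarith) (by linarith)
      have ht : 0 < x * (ε / 3 * L k) := by
        have := hL0 k
        positivity
      have h := measureReal_degEqCount_sub_ge_le (μ m) (m := m) (measurableSet_hypRel _)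
        (hypRel_symm (discRadius C (m + 1))) k ht
      rw [← hx] at h
      rw [coordLaw_eq_pi, ← ofReal_measureReal]
      refine ENNReal.ofReal_le_ofReal (h.trans ?_)
      set B := ε / 3 * c * 2 ^ (-(2 * α + 1)) with hB
      have hB0 : 0 < B := by positivity
      have hden : (x * (B * x ^ (-(d' * (2 * α + 1))))) ^ 2 ≤ (x * (ε / 3 * L k)) ^ 2 := by
        refine pow_le_pow_left₀ (by positivity) (mul_le_mul_of_nonneg_left ?_ hx0.le) 2
        calc B * x ^ (-(d' * (2 * α + 1)))
            = ε / 3 * (c * (2 ^ (-(2 * α + 1)) * x ^ (-(d' * (2 * α + 1))))) := by rw [hB]; ring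
          _ ≤ ε / 3 * L k := mul_le_mul_of_nonneg_left hLk (by positivity)
      calc _ ≤ x * ((2 + 4 * K) * x ^ (2 - β)) / (x * (B * x ^ (-(d' * (2 * α + 1))))) ^ 2 := by
            gcongr
        _ = (2 + 4 * K) / B ^ 2 * (x * x ^ (2 - β) / (x * x ^ (-(d' * (2 * α + 1)))) ^ 2) := by
            rw [mul_pow, mul_pow, mul_pow]; field_simp
        _ = _ := by
            congr 1
            have e1 : x * x ^ (2 - β) = x ^ (3 - β) := by
              nth_rw 1 [← Real.rpow_one x]; rw [← Real.rpow_add hx0]; congr 1; ring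
            have e2 : (x * x ^ (-(d' * (2 * α + 1)))) ^ 2 = x ^ (2 - d' * (4 * α + 2)) := by
              nth_rw 1 [← Real.rpow_one x]
              rw [← Real.rpow_add hx0, ← Real.rpow_mul_natCast hx0.le]; congr 1; push_cast; ring
            rw [e1, e2, ← Real.rpow_sub hx0]; congr 1; ring
    refine (measure_biUnion_finset_le _ _).trans ((Finset.sum_le_card_nsmul _ _ _ hk).trans ?_)
    rw [Finset.card_range, nsmul_eq_mul, ← ENNReal.ofReal_natCast,
      ← ENNReal.ofReal_mul (Nat.cast_nonneg _)]
    refine ENNReal.ofReal_le_ofReal ?_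
    have hcard : ((⌊x ^ d'⌋₊ + 1 : ℕ) : ℝ) ≤ 2 * x ^ d' := by
      have := Nat.floor_le (by positivity : 0 ≤ x ^ d')
      push_cast; linarith
    calc _ ≤ 2 * x ^ d' * ((2 + 4 * K) / ((ε / 3 * c * 2 ^ (-(2 * α + 1))) ^ 2)
          * x ^ (1 - β + d' * (4 * α + 2))) := by gcongr
      _ = Q * (x ^ d' * x ^ (1 - β + d' * (4 * α + 2))) := by rw [hQ]; ring
      _ = _ := by rw [← Real.rpow_add hx0]; congr 2; ring

end DegreeEq

/-! ### The number of vertices of large degree -/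

section DegreeGe

lemma fracDegGe_graph {C : ℝ} {n : ℕ} (x : Fin n → ℝ × ℝ) (k : ℕ)
    [DecidablePred fun v => k ≤ degCount (hypRel (discRadius C n)) x v] :
    fracDegGe (graph C n x) k
      = ((Finset.univ.filter fun v => k ≤ degCount (hypRel (discRadius C n)) x v).card : ℝ) / n := by
  unfold fracDegGe
  simp_rw [degree_graph]

/-- Away from the centre, the neighbourhood probability at radius `r` is `κ e^{-r/2}` up to a small
relative error. -/
lemma exists_abs_nbrProb_sub_le {α η : ℝ} (hα : 1 / 2 < α) (hη : 0 < η) :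
    ∃ r₀ > 0, ∀ R r θ : ℝ, 0 < R → 4 ≤ Real.exp (α * R) → r₀ ≤ r → r ≤ R →
      |nbrProb (pointLaw α R) (hypRel R) (r, θ) - kappa α * Real.exp (-r / 2)|
        ≤ η * (kappa α * Real.exp (-r / 2)) := by
  have hκ := kappa_pos hα
  obtain ⟨γ, hγ, hγu⟩ : ∃ γ, 1 / 2 < γ ∧ γ < min α 1 :=
    exists_between (lt_min hα (by norm_num))
  have hγα : γ < α := hγu.trans_le (min_le_left _ _)
  have hγ1 : γ < 1 := hγu.trans_le (min_le_right _ _)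
  set c₀ := 20 * α / (α - γ) + 8 * α + kappa α
  have h : Tendsto (fun r : ℝ => c₀ * Real.exp (-(γ - 1 / 2) * r)) atTop (𝓝 0) := by
    have h1 : Tendsto (fun r : ℝ => -(γ - 1 / 2) * r) atTop atBot :=
      tendsto_id.const_mul_atTop_of_neg (by linarith)
    simpa using (Real.tendsto_exp_atBot.comp h1).const_mul c₀
  obtain ⟨r₁, hr₁⟩ := eventually_atTop.1 (h.eventually_le_const (mul_pos hη hκ))
  refine ⟨max r₁ 1, lt_max_of_lt_right one_pos, fun R r θ hR hR4 hr hrR => ?_⟩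
  have hr0 : 0 < r := one_pos.trans_le ((le_max_right _ _).trans hr)
  refine (abs_nbrProb_pointLaw_sub_le hα hγ.le hγ1.le hγα hR hR4 hr0 hrR θ).trans ?_
  have h2 := hr₁ r ((le_max_left _ _).trans hr)
  have h3 : Real.exp (-γ * r) = Real.exp (-(γ - 1 / 2) * r) * Real.exp (-r / 2) := by
    rw [← Real.exp_add]; congr 1; ring
  rw [h3, ← mul_assoc, ← mul_assoc]
  gcongr

lemma radialLaw_real_Iic {α R r : ℝ} (hα : 0 < α) (hR : 0 < R) (hr : 0 ≤ r) (hrR : r ≤ R) :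
    (radialLaw α R).real (Iic r) = (Real.cosh (α * r) - 1) / (Real.cosh (α * R) - 1) := by
  rw [measureReal_def, radialLaw_Iic hα hR hr hrR, ENNReal.toReal_ofReal]
  exact div_nonneg (sub_nonneg.2 (Real.one_le_cosh _)) (cosh_sub_one_pos hα hR).le

lemma cosh_sub_one_eq (y : ℝ) : Real.cosh y - 1 = Real.exp y * (1 - Real.exp (-y)) ^ 2 / 2 := by
  have h : Real.exp y * Real.exp (-y) = 1 := by rw [← Real.exp_add]; simp
  rw [Real.cosh_eq]
  linear_combination (1 - Real.exp (-y) / 2) * h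

/-- The distribution function of the radial law is close to `e^{α (r - R)}`. -/
lemma radialLaw_real_Iic_bounds {α R r : ℝ} (hα : 0 < α) (hR : 0 < R) (hr : 0 ≤ r) (hrR : r ≤ R) :
    (1 - 2 * Real.exp (-(α * r))) * Real.exp (α * (r - R)) ≤ (radialLaw α R).real (Iic r) ∧
      (radialLaw α R).real (Iic r) ≤ Real.exp (α * (r - R)) := by
  rw [radialLaw_real_Iic hα hR hr hrR]
  have hpos := cosh_sub_one_pos hα hR
  have hE : Real.exp (α * (r - R)) * Real.exp (α * R) = Real.exp (α * r) := by
    rw [← Real.exp_add]; congr 1; ring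
  have h1 : Real.exp (-(α * R)) ≤ Real.exp (-(α * r)) := Real.exp_le_exp.2 (by nlinarith)
  have h2 : Real.exp (-(α * r)) ≤ 1 := Real.exp_le_one_iff.2 (by nlinarith)
  have h3 := Real.exp_pos (-(α * R))
  rw [le_div_iff₀ hpos, div_le_iff₀ hpos, cosh_sub_one_eq, cosh_sub_one_eq, ← hE]
  have h4 := Real.exp_pos (α * (r - R))
  have h5 := Real.exp_pos (α * R)
  generalize Real.exp (-(α * R)) = u at *
  generalize Real.exp (-(α * r)) = w at *
  have hu : (1 - u) ^ 2 ≤ 1 := pow_le_one₀ (by linarith) (by linarith)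
  constructor
  · have : (1 - 2 * w) * (1 - u) ^ 2 ≤ (1 - w) ^ 2 := by
      rcases le_total (1 - 2 * w) 0 with h | h
      · exact (mul_nonpos_of_nonpos_of_nonneg h (sq_nonneg _)).trans (sq_nonneg _)
      · nlinarith
    have h6 := mul_le_mul_of_nonneg_left this (mul_pos h4 h5).le
    linarith
  · have : (1 - w) ^ 2 ≤ (1 - u) ^ 2 := pow_le_pow_left₀ (by linarith) (by linarith) 2
    have h6 := mul_le_mul_of_nonneg_left this (mul_pos h4 h5).le
    linarith

lemma pointLaw_fst {α R : ℝ} (S : Set ℝ) :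
    (pointLaw α R).real {a | a.1 ∈ S} = (radialLaw α R).real S := by
  have h : {a : ℝ × ℝ | a.1 ∈ S} = S ×ˢ univ := by ext a; simp
  have : SFinite (radialLaw α R) := by unfold radialLaw; infer_instance
  rw [h, measureReal_def, measureReal_def, pointLaw, Measure.prod_prod, measure_univ, mul_one]

/-- The radius at which the mean degree `κ n e^{-r/2}` equals `b`. -/
noncomputable def meanDegRadius (α : ℝ) (n : ℕ) (b : ℝ) : ℝ := 2 * Real.log (kappa α * n / b)

lemma mul_exp_meanDegRadius {α : ℝ} (hα : 1 / 2 < α) {n : ℕ} (hn : 0 < n) {b : ℝ} (hb : 0 < b) :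
    kappa α * n * Real.exp (-meanDegRadius α n b / 2) = b := by
  have hκ := kappa_pos hα
  have hn' : (0 : ℝ) < n := Nat.cast_pos.2 hn
  rw [meanDegRadius, show -(2 * Real.log (kappa α * n / b)) / 2 = -Real.log (kappa α * n / b) by ring,
    Real.exp_neg, Real.exp_log (by positivity)]
  field_simp

/-- The approximate distribution function `e^{α (r - R)}` of the radius, at the radius of mean degree
`b k`, is `b^{-2α}` times the limiting fraction of vertices of degree at least `k`. -/
lemma exp_meanDegRadius_sub {α C : ℝ} (hα : 1 / 2 < α) {n : ℕ} (hn : 0 < n) {k : ℕ} (hk : 0 < k)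
    {b : ℝ} (hb : 0 < b) :
    Real.exp (α * (meanDegRadius α n (b * k) - discRadius C n))
      = b ^ (-(2 * α)) * degGeLimit α C k := by
  have hκ := kappa_pos hα
  have hn' : (0 : ℝ) < n := Nat.cast_pos.2 hn
  have hk' : (0 : ℝ) < k := Nat.cast_pos.2 hk
  have h1 : α * (meanDegRadius α n (b * k) - discRadius C n)
      = Real.log (kappa α) * (2 * α) + -α * C + Real.log k * (-2 * α)
        + Real.log b * (-(2 * α)) := by
    rw [meanDegRadius, discRadius, Real.log_div (by positivity) (by positivity),
      Real.log_mul hκ.ne' hn'.ne', Real.log_mul hb.ne' hk'.ne']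
    ring
  rw [h1, Real.exp_add, Real.exp_add, Real.exp_add, degGeLimit, Real.rpow_def_of_pos hκ,
    Real.rpow_def_of_pos hk', Real.rpow_def_of_pos hb]
  ring

/-- A Chernoff bound for the binomial lower tail, with exponent `-ρ / 2`. -/
lemma sum_binomWeight_lt_le {m k : ℕ} {p ρ : ℝ} (hp0 : 0 ≤ p) (hp1 : p ≤ 1) (hρ0 : 0 < ρ)
    (hρ : ρ ≤ 1 / 2) (h : (1 + ρ) * k ≤ m * p) :
    ∑ j ∈ Finset.range (m + 1) with j ∈ {j | j < k}, binomWeight m j p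
      ≤ Real.exp (-(ρ ^ 3 / 8) * k) := by
  have hk0 : (0 : ℝ) ≤ k := Nat.cast_nonneg k
  refine (sum_binomWeight_le_exp (k := k) hp0 hp1 (-(ρ / 2)) (Finset.filter_subset _ _)
    fun j hj => ?_).trans (Real.exp_le_exp.2 ?_)
  · have hjk : j < k := (Finset.mem_filter.1 hj).2
    have : (j : ℝ) ≤ k := by exact_mod_cast hjk.le
    nlinarith
  · have h1 := (abs_le.1 (Real.abs_exp_sub_one_sub_id_le (x := -(ρ / 2))
      (by rw [abs_neg, abs_of_pos (by positivity)]; linarith))).2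
    have h2 : Real.exp (-(ρ / 2)) - 1 ≤ -(ρ / 2) + ρ ^ 2 / 4 := by nlinarith
    have h3 : -(ρ / 2) + ρ ^ 2 / 4 ≤ 0 := by nlinarith
    have hmp : 0 ≤ (m : ℝ) * p := by positivity
    calc (m : ℝ) * p * (Real.exp (-(ρ / 2)) - 1) - -(ρ / 2) * k
        ≤ (m : ℝ) * p * (-(ρ / 2) + ρ ^ 2 / 4) - -(ρ / 2) * k := by gcongr
      _ ≤ (1 + ρ) * k * (-(ρ / 2) + ρ ^ 2 / 4) - -(ρ / 2) * k := by nlinarith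
      _ = -(ρ ^ 2 / 4 * (1 - ρ)) * k := by ring
      _ ≤ _ := by
          gcongr
          nlinarith [sq_nonneg ρ, pow_pos hρ0 3]

/-- A Chernoff bound for the binomial upper tail, with exponent `ρ`. -/
lemma sum_binomWeight_ge_le {m k : ℕ} {p ρ : ℝ} (hp0 : 0 ≤ p) (hp1 : p ≤ 1) (hρ0 : 0 < ρ)
    (hρ : ρ ≤ 1 / 2) (h : m * p ≤ (1 - ρ) * k) :
    ∑ j ∈ Finset.range (m + 1) with j ∈ {j | k ≤ j}, binomWeight m j p
      ≤ Real.exp (-(ρ ^ 3 / 8) * k) := by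
  have hk0 : (0 : ℝ) ≤ k := Nat.cast_nonneg k
  refine (sum_binomWeight_le_exp (k := k) hp0 hp1 ρ (Finset.filter_subset _ _)
    fun j hj => ?_).trans (Real.exp_le_exp.2 ?_)
  · have hjk : k ≤ j := (Finset.mem_filter.1 hj).2
    gcongr
  · have h1 := (abs_le.1 (Real.abs_exp_sub_one_sub_id_le (x := ρ)
      (by rw [abs_of_pos hρ0]; linarith))).2
    have h2 : Real.exp ρ - 1 ≤ ρ + ρ ^ 2 := by linarith
    have hmp : 0 ≤ (m : ℝ) * p := by positivity
    calc (m : ℝ) * p * (Real.exp ρ - 1) - ρ * k ≤ (m : ℝ) * p * (ρ + ρ ^ 2) - ρ * k := by gcongr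
      _ ≤ (1 - ρ) * k * (ρ + ρ ^ 2) - ρ * k := by gcongr
      _ = -ρ ^ 3 * k := by ring
      _ ≤ _ := by
          gcongr
          nlinarith [pow_pos hρ0 3]

section Asymptotics

variable {α C : ℝ} {k : ℕ → ℕ}

lemma tendsto_succ_cast : Tendsto (fun m : ℕ => ((m + 1 : ℕ) : ℝ)) atTop atTop :=
  tendsto_natCast_atTop_atTop.comp (tendsto_add_atTop_nat 1)

lemma tendsto_cast_of_rpow_le {d : ℝ} (hd : 0 < d)
    (hk : ∀ᶠ m : ℕ in atTop, ((m + 1 : ℕ) : ℝ) ^ d ≤ k m) :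
    Tendsto (fun m => (k m : ℝ)) atTop atTop :=
  tendsto_atTop_mono' _ hk ((tendsto_rpow_atTop hd).comp tendsto_succ_cast)

lemma tendsto_mul_exp_neg {d a : ℝ} (hd : 0 < d) (ha : 0 < a)
    (hk : ∀ᶠ m : ℕ in atTop, ((m + 1 : ℕ) : ℝ) ^ d ≤ k m) :
    Tendsto (fun m => ((m + 1 : ℕ) : ℝ) * Real.exp (-a * k m)) atTop (𝓝 0) := by
  have h := ((tendsto_rpow_mul_exp_neg_mul_atTop_nhds_zero (1 / d) a ha).comp
    (tendsto_rpow_atTop hd)).comp tendsto_succ_cast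
  refine tendsto_of_tendsto_of_tendsto_of_le_of_le' tendsto_const_nhds h
    (Eventually.of_forall fun m => by positivity) ?_
  filter_upwards [hk] with m hm
  have hx : (0 : ℝ) < (m + 1 : ℕ) := by positivity
  simp only [Function.comp]
  rw [← Real.rpow_mul hx.le, mul_one_div_cancel hd.ne', Real.rpow_one]
  exact mul_le_mul_of_nonneg_left (Real.exp_le_exp.2 (by nlinarith)) hx.le

/-- The expected number of vertices of degree at least `k` is unbounded; this is where the upper
limit `n^{1/(2α)} / log n` for `k` comes from. -/
lemma tendsto_mul_degGeLimit (hα : 1 / 2 < α) (hk0 : ∀ᶠ m in atTop, 0 < k m)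
    (hk : ∀ᶠ m : ℕ in atTop,
      (k m : ℝ) ≤ ((m + 1 : ℕ) : ℝ) ^ (1 / (2 * α)) / Real.log (m + 1 : ℕ)) :
    Tendsto (fun m => ((m + 1 : ℕ) : ℝ) * degGeLimit α C (k m)) atTop atTop := by
  have hκ := kappa_pos hα
  have hlog := Real.tendsto_log_atTop.comp tendsto_succ_cast
  have h := ((tendsto_rpow_atTop (by linarith : 0 < 2 * α)).comp hlog).const_mul_atTop
    (by positivity : 0 < kappa α ^ (2 * α) * Real.exp (-α * C))
  refine tendsto_atTop_mono' _ ?_ h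
  filter_upwards [hk, hk0, hlog.eventually (eventually_gt_atTop 0)] with m hm hm0 hl
  have hx : (0 : ℝ) < (m + 1 : ℕ) := by positivity
  have hm0' : (0 : ℝ) < k m := Nat.cast_pos.2 hm0
  simp only [Function.comp] at hl ⊢
  have h1 := Real.rpow_le_rpow_of_nonpos hm0' hm (by linarith : -2 * α ≤ 0)
  rw [Real.div_rpow (by positivity) hl.le, ← Real.rpow_mul hx.le,
    show 1 / (2 * α) * (-2 * α) = -1 by field_simp, Real.rpow_neg_one, neg_mul,
    Real.rpow_neg hl.le, div_inv_eq_mul] at h1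
  unfold degGeLimit
  calc _ = (m + 1 : ℕ) * (kappa α ^ (2 * α) * Real.exp (-α * C)
        * ((((m + 1 : ℕ) : ℝ))⁻¹ * Real.log (m + 1 : ℕ) ^ (2 * α))) := by field_simp
    _ ≤ _ := by
        gcongr
        rwa [neg_mul]

lemma tendsto_meanDegRadius (hα : 1 / 2 < α) (hk0 : ∀ᶠ m in atTop, 0 < k m)
    (hk : ∀ᶠ m : ℕ in atTop,
      (k m : ℝ) ≤ ((m + 1 : ℕ) : ℝ) ^ (1 / (2 * α)) / Real.log (m + 1 : ℕ)) {b : ℝ} (hb : 0 < b) :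
    Tendsto (fun m => meanDegRadius α (m + 1) (b * k m)) atTop atTop := by
  have hκ := kappa_pos hα
  refine (Real.tendsto_log_atTop.comp ?_).const_mul_atTop two_pos
  have hlog := Real.tendsto_log_atTop.comp tendsto_succ_cast
  have he : 0 < 1 - 1 / (2 * α) := by
    rw [sub_pos, div_lt_one (by linarith)]; linarith
  have h := ((tendsto_rpow_atTop he).comp tendsto_succ_cast).const_mul_atTop
    (by positivity : 0 < kappa α / b)
  refine tendsto_atTop_mono' _ ?_ h
  filter_upwards [hk, hk0, hlog.eventually (eventually_ge_atTop 1)] with m hm hm0 hl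
  have hx : (0 : ℝ) < (m + 1 : ℕ) := by positivity
  have hm0' : (0 : ℝ) < k m := Nat.cast_pos.2 hm0
  simp only [Function.comp] at hl ⊢
  have h1 : (k m : ℝ) ≤ ((m + 1 : ℕ) : ℝ) ^ (1 / (2 * α)) :=
    hm.trans (div_le_self (by positivity) hl)
  rw [Real.rpow_sub hx, Real.rpow_one]
  calc kappa α / b * (((m + 1 : ℕ) : ℝ) / ((m + 1 : ℕ) : ℝ) ^ (1 / (2 * α)))
      = kappa α * (m + 1 : ℕ) / (b * ((m + 1 : ℕ) : ℝ) ^ (1 / (2 * α))) := by field_simp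
    _ ≤ _ := by gcongr

/-- The radius at which the mean degree is a large number lies inside the disc. -/
lemma meanDegRadius_le_discRadius (hα : 1 / 2 < α) {n : ℕ} (hn : 0 < n) {b : ℝ} (hb : 0 < b)
    (hξ : xi α C ≤ b) : meanDegRadius α n b ≤ discRadius C n := by
  have hκ := kappa_pos hα
  have hn' : (0 : ℝ) < n := Nat.cast_pos.2 hn
  have h1 : Real.log (xi α C) ≤ Real.log b := Real.log_le_log (xi_pos hα) hξ
  rw [xi, Real.log_mul hκ.ne' (Real.exp_pos _).ne', Real.log_exp] at h1
  rw [meanDegRadius, discRadius, Real.log_div (by positivity) hb.ne', Real.log_mul hκ.ne' hn'.ne']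
  linarith

open Classical in
/-- The number of vertices of mean degree at least `b k` is concentrated around
`n b ^ (-2α)` times the limiting fraction. -/
lemma tendsto_coordLaw_card_meanDegRadius (hα : 1 / 2 < α)
    (hk : Tendsto (fun m => (k m : ℝ)) atTop atTop)
    (hL : Tendsto (fun m => ((m + 1 : ℕ) : ℝ) * degGeLimit α C (k m)) atTop atTop) {b ρ : ℝ}
    (hb : 0 < b) (hr : Tendsto (fun m => meanDegRadius α (m + 1) (b * k m)) atTop atTop)
    (hρ : 0 < ρ) :
    Tendsto (fun m => coordLaw α C (m + 1)
      {x | ρ * ((m + 1 : ℕ) * (b ^ (-(2 * α)) * degGeLimit α C (k m)))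
        ≤ |((Finset.univ.filter fun v =>
            x v ∈ {a : ℝ × ℝ | a.1 ∈ Iic (meanDegRadius α (m + 1) (b * k m))}).card : ℝ)
          - (m + 1 : ℕ) * (b ^ (-(2 * α)) * degGeLimit α C (k m))|}) atTop (𝓝 0) := by
  have hα0 : 0 < α := by linarith
  have hb2 : 0 < b ^ (-(2 * α)) := by positivity
  have hM : Tendsto (fun m => ((m + 1 : ℕ) : ℝ) * (b ^ (-(2 * α)) * degGeLimit α C (k m)))
      atTop atTop := by
    refine (hL.const_mul_atTop hb2).congr fun m => by ring
  have hlim : Tendsto (fun m => ENNReal.ofReal (4 / ρ ^ 2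
      * (((m + 1 : ℕ) : ℝ) * (b ^ (-(2 * α)) * degGeLimit α C (k m)))⁻¹)) atTop (𝓝 0) := by
    have h1 := (tendsto_inv_atTop_zero.comp hM).const_mul (4 / ρ ^ 2)
    rw [mul_zero] at h1
    simpa using ENNReal.tendsto_ofReal h1
  refine tendsto_of_tendsto_of_tendsto_of_le_of_le' tendsto_const_nhds hlim
    (Eventually.of_forall fun m => zero_le) ?_
  have hRt := (tendsto_discRadius C).comp (tendsto_add_atTop_nat 1)
  have hexp : Tendsto (fun m => 2 * Real.exp (-(α * meanDegRadius α (m + 1) (b * k m)))) atTop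
      (𝓝 0) := by
    have h1 := (Real.tendsto_exp_neg_atTop_nhds_zero.comp (hr.const_mul_atTop hα0)).const_mul 2
    simpa using h1
  filter_upwards [hRt.eventually (eventually_gt_atTop 0), hr.eventually (eventually_ge_atTop 0),
    hk.eventually (eventually_gt_atTop 0), (hk.const_mul_atTop hb).eventually
      (eventually_ge_atTop (xi α C)), hM.eventually (eventually_gt_atTop 0),
    hexp.eventually_le_const (half_pos hρ)] with m hR hr0 hk0 hξ hM0 he
  simp only [Function.comp] at hR
  have hk0' : 0 < k m := Nat.cast_pos.1 hk0
  set r := meanDegRadius α (m + 1) (b * k m)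
  have hrR : r ≤ discRadius C (m + 1) :=
    meanDegRadius_le_discRadius hα (Nat.succ_pos m) (by positivity) hξ
  obtain ⟨hF1, hF2⟩ := radialLaw_real_Iic_bounds hα0 hR hr0 hrR
  rw [exp_meanDegRadius_sub hα (Nat.succ_pos m) hk0' hb] at hF1 hF2
  have hx : (0 : ℝ) < (m + 1 : ℕ) := by positivity
  set F := (radialLaw α (discRadius C (m + 1))).real (Iic r)
  set M := ((m + 1 : ℕ) : ℝ) * (b ^ (-(2 * α)) * degGeLimit α C (k m))
  have hG0 : 0 < b ^ (-(2 * α)) * degGeLimit α C (k m) := pos_of_mul_pos_right hM0 hx.le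
  have hFM : (m + 1 : ℕ) * F ≤ M := mul_le_mul_of_nonneg_left hF2 hx.le
  have hFM' : M - ρ / 2 * M ≤ (m + 1 : ℕ) * F := by
    have h1 : (1 - ρ / 2) * (b ^ (-(2 * α)) * degGeLimit α C (k m)) ≤ F :=
      (mul_le_mul_of_nonneg_right (by linarith) hG0.le).trans hF1
    have h2 := mul_le_mul_of_nonneg_left h1 hx.le
    refine le_trans (le_of_eq ?_) h2
    simp only [M]; ring
  have := isProbabilityMeasure_pointLaw hα0 hR
  have hmeas : MeasurableSet {a : ℝ × ℝ | a.1 ∈ Iic r} := measurable_fst measurableSet_Iic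
  have h := measureReal_card_sub_ge_le (pointLaw α (discRadius C (m + 1))) (n := m + 1) hmeas
    (mul_pos (half_pos hρ) hM0)
  rw [pointLaw_fst] at h
  rw [coordLaw_eq_pi, ← ofReal_measureReal]
  refine ENNReal.ofReal_le_ofReal ((measureReal_mono ?_).trans (h.trans ?_))
  · intro x hx
    simp only [mem_ofPred_eq] at hx ⊢
    have h3 : |(m + 1 : ℕ) * F - M| ≤ ρ / 2 * M := by
      rw [abs_le]; constructor <;> linarith [mul_pos (half_pos hρ) hM0]
    have h4 := abs_sub_le ((Finset.univ.filter fun v => x v ∈ {a : ℝ × ℝ | a.1 ∈ Iic r}).card : ℝ)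
      ((m + 1 : ℕ) * F) M
    simp only [mem_ofPred_eq] at h4
    linarith
  · calc (m + 1 : ℕ) * F / (ρ / 2 * M) ^ 2 ≤ M / (ρ / 2 * M) ^ 2 := by gcongr
      _ = _ := by field_simp; norm_num

end Asymptotics

end DegreeGe

section LargeDegree

variable {α C : ℝ}

/-- With probability tending to one there is no vertex near the centre of the disc. -/
lemma tendsto_coordLaw_exists_near_centre (hα : 1 / 2 < α) {r₀ : ℝ} (hr₀ : 0 < r₀) :
    Tendsto (fun m => coordLaw α C (m + 1)
      {x | ∃ v, (x v).1 ∉ Ioc r₀ (discRadius C (m + 1))}) atTop (𝓝 0) := by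
  have hα0 : 0 < α := by linarith
  have hRt := (tendsto_discRadius C).comp (tendsto_add_atTop_nat 1)
  have hlim : Tendsto (fun m : ℕ => ENNReal.ofReal
      (Real.exp (α * r₀ - α * C) * ((m + 1 : ℕ) : ℝ) ^ (1 - 2 * α))) atTop (𝓝 0) := by
    have h1 := ((tendsto_rpow_zero_of_neg (a := 1 - 2 * α) (by linarith)).comp
      tendsto_succ_cast).const_mul (Real.exp (α * r₀ - α * C))
    rw [mul_zero] at h1
    simpa using ENNReal.tendsto_ofReal h1
  refine tendsto_of_tendsto_of_tendsto_of_le_of_le' tendsto_const_nhds hlim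
    (Eventually.of_forall fun m => zero_le) ?_
  filter_upwards [hRt.eventually (eventually_gt_atTop r₀)] with m hR
  simp only [Function.comp] at hR
  set R := discRadius C (m + 1)
  have hR0 : 0 < R := hr₀.trans hR
  have hprob := isProbabilityMeasure_pointLaw hα0 hR0
  have hprob' := isProbabilityMeasure_radialLaw hα0 hR0
  have hx : (0 : ℝ) < (m + 1 : ℕ) := by positivity
  have hset : {x : Fin (m + 1) → ℝ × ℝ | ∃ v, (x v).1 ∉ Ioc r₀ R}
      = ⋃ v, Function.eval v ⁻¹' {a : ℝ × ℝ | a.1 ∈ (Ioc r₀ R)ᶜ} := by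
    ext x; simp
  have hmeas : MeasurableSet {a : ℝ × ℝ | a.1 ∈ (Ioc r₀ R)ᶜ} :=
    measurable_fst measurableSet_Ioc.compl
  have hcompl : (radialLaw α R).real (Ioc r₀ R)ᶜ = (radialLaw α R).real (Iic r₀) := by
    refine measureReal_congr ?_
    filter_upwards [radialLaw_ae_mem α R] with r hr
    refine propext ⟨fun h => ?_, fun h h' => absurd h (not_le.2 h'.1)⟩
    exact le_of_not_gt fun h' => h ⟨h', hr.2⟩
  have hv : ∀ v : Fin (m + 1), (Measure.pi fun _ : Fin (m + 1) => pointLaw α R)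
      (Function.eval v ⁻¹' {a : ℝ × ℝ | a.1 ∈ (Ioc r₀ R)ᶜ})
      ≤ ENNReal.ofReal (Real.exp (α * (r₀ - R))) := fun v => by
    rw [(measurePreserving_eval (fun _ : Fin (m + 1) => pointLaw α R) v).measure_preimage
      hmeas.nullMeasurableSet, ← ofReal_measureReal, pointLaw_fst, hcompl]
    exact ENNReal.ofReal_le_ofReal (radialLaw_real_Iic_bounds hα0 hR0 hr₀.le hR.le).2
  rw [coordLaw_eq_pi, hset]
  refine (measure_iUnion_le _).trans ((ENNReal.tsum_le_tsum hv).trans ?_)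
  rw [tsum_fintype, Finset.sum_const, Finset.card_univ, Fintype.card_fin, nsmul_eq_mul,
    ← ENNReal.ofReal_natCast, ← ENNReal.ofReal_mul (Nat.cast_nonneg _)]
  refine ENNReal.ofReal_le_ofReal (le_of_eq ?_)
  have h := exp_mul_discRadius (C := C) (Nat.succ_pos m) (-α)
  rw [mul_sub, sub_eq_add_neg, Real.exp_add, ← neg_mul, h, sub_eq_add_neg, Real.exp_add,
    sub_eq_add_neg, Real.rpow_add hx, Real.rpow_one, show 2 * -α = -(2 * α) by ring,
    show -α * C = -(α * C) by ring]
  ring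

/-- The mean degree at radius `r`, compared with the mean degree `b` at `meanDegRadius α n b`. -/
lemma le_meanDegRadius_iff (hα : 1 / 2 < α) {n : ℕ} (hn : 0 < n) {b r : ℝ} (hb : 0 < b) :
    r ≤ meanDegRadius α n b ↔ b ≤ kappa α * n * Real.exp (-r / 2) := by
  have hκ := kappa_pos hα
  have hn' : (0 : ℝ) < n := Nat.cast_pos.2 hn
  have hpos : 0 < kappa α * n := by positivity
  conv_rhs => lhs; rw [← mul_exp_meanDegRadius hα hn hb]
  rw [mul_le_mul_iff_right₀ hpos, Real.exp_le_exp]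
  constructor <;> intro h <;> linarith

/-- With high probability every vertex of mean degree below `(1 - ρ) k` has degree below `k`, and
every vertex of mean degree above `(1 + ρ) k`, apart from those near the centre, has degree at
least `k`. -/
lemma exists_tendsto_coordLaw_exists_atypical (hα : 1 / 2 < α) {ρ d : ℝ} (hρ : 0 < ρ)
    (hρ1 : ρ ≤ 1 / 2) (hd : 0 < d) {k : ℕ → ℕ}
    (hk : ∀ᶠ m : ℕ in atTop, ((m + 1 : ℕ) : ℝ) ^ d ≤ k m) :
    ∃ r₀ > 0,
      Tendsto (fun m => coordLaw α C (m + 1) {x | ∃ v, x v ∈ {a : ℝ × ℝ | r₀ < a.1 ∧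
          a.1 ≤ discRadius C (m + 1) ∧ meanDegRadius α (m + 1) ((1 - ρ) * k m) < a.1} ∧
        degCount (hypRel (discRadius C (m + 1))) x v ∈ {j | k m ≤ j}}) atTop (𝓝 0) ∧
      Tendsto (fun m => coordLaw α C (m + 1) {x | ∃ v, x v ∈ {a : ℝ × ℝ | r₀ < a.1 ∧
          a.1 ≤ discRadius C (m + 1) ∧ a.1 ≤ meanDegRadius α (m + 1) ((1 + ρ) * k m)} ∧
        degCount (hypRel (discRadius C (m + 1))) x v ∈ {j | j < k m}}) atTop (𝓝 0) := by
  have hα0 : 0 < α := by linarith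
  have hκ := kappa_pos hα
  obtain ⟨r₀, hr₀, hr⟩ := exists_abs_nbrProb_sub_le hα (by positivity : 0 < ρ / 4)
  refine ⟨r₀, hr₀, ?_⟩
  -- `σ` is both the relative error of the neighbourhood probability and the margin of the Chernoff
  -- bound; with `σ = ρ / 4` they fit together within the gap `ρ`
  set σ := ρ / 4
  have hσ0 : 0 < σ := by positivity
  have hσ1 : σ ≤ 1 / 2 := by simp only [σ]; linarith
  have hkt := tendsto_cast_of_rpow_le hd hk
  have hlim : Tendsto (fun m : ℕ => ENNReal.ofReal
      (((m + 1 : ℕ) : ℝ) * Real.exp (-(σ ^ 3 / 8) * k m))) atTop (𝓝 0) := by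
    simpa using ENNReal.tendsto_ofReal
      (tendsto_mul_exp_neg hd (by positivity : 0 < σ ^ 3 / 8) hk)
  have hRt := (tendsto_discRadius C).comp (tendsto_add_atTop_nat 1)
  have E3 := hRt.eventually (eventually_gt_atTop 0)
  have E4 := (Real.tendsto_exp_atTop.comp (hRt.const_mul_atTop hα0)).eventually
    (eventually_ge_atTop 4)
  have E5 := hkt.eventually (eventually_ge_atTop (1 / σ))
  constructor
  · refine tendsto_of_tendsto_of_tendsto_of_le_of_le' tendsto_const_nhds hlim
      (Eventually.of_forall fun m => zero_le) ?_
    filter_upwards [E3, E4, E5] with m hR hR4 hkσ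
    simp only [Function.comp] at hR hR4
    have hprob := isProbabilityMeasure_pointLaw hα0 hR
    have hk0 : (0 : ℝ) < k m := lt_of_lt_of_le (by positivity) hkσ
    rw [coordLaw_eq_pi]
    refine measure_exists_degCount_mem_le (pointLaw α (discRadius C (m + 1)))
      (measurableSet_hypRel (discRadius C (m + 1)))
      (E := {a : ℝ × ℝ | r₀ < a.1 ∧ a.1 ≤ discRadius C (m + 1) ∧
        meanDegRadius α (m + 1) ((1 - ρ) * k m) < a.1}) ?_ {j | k m ≤ j} ?_
    · exact (measurableSet_lt measurable_const measurable_fst).inter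
        ((measurableSet_le measurable_fst measurable_const).inter
          (measurableSet_lt measurable_const measurable_fst))
    · rintro ⟨r, θ⟩ ⟨h1, h2, h3⟩
      simp only at h1 h2 h3
      have hp := (abs_le.1 (hr _ r θ hR hR4 h1.le h2)).2
      have hp0 := nbrProb_nonneg (pointLaw α (discRadius C (m + 1))) (hypRel (discRadius C (m + 1)))
        (r, θ)
      have hp1 := nbrProb_le_one (pointLaw α (discRadius C (m + 1))) (hypRel (discRadius C (m + 1)))
        (r, θ)
      refine sum_binomWeight_ge_le hp0 hp1 hσ0 hσ1 ?_
      rw [← not_le, le_meanDegRadius_iff hα (Nat.succ_pos m) (mul_pos (by linarith) hk0),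
        not_le] at h3
      generalize nbrProb (pointLaw α (discRadius C (m + 1))) (hypRel (discRadius C (m + 1)))
        (r, θ) = p at *
      have hm0 : (0 : ℝ) ≤ m := Nat.cast_nonneg m
      push_cast at h3
      have h4 : (m : ℝ) * p ≤ (m + 1) * ((1 + σ) * (kappa α * Real.exp (-r / 2))) := by
        calc (m : ℝ) * p ≤ (m + 1) * p := by nlinarith
          _ ≤ _ := by gcongr; linarith
      have h5 : ((m : ℝ) + 1) * ((1 + σ) * (kappa α * Real.exp (-r / 2)))
          ≤ (1 + σ) * ((1 - ρ) * k m) := by nlinarith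
      have h6 : (1 + σ) * (1 - ρ) ≤ 1 - σ := by simp only [σ]; nlinarith
      nlinarith
  · refine tendsto_of_tendsto_of_tendsto_of_le_of_le' tendsto_const_nhds hlim
      (Eventually.of_forall fun m => zero_le) ?_
    filter_upwards [E3, E4, E5] with m hR hR4 hkσ
    simp only [Function.comp] at hR hR4
    have hprob := isProbabilityMeasure_pointLaw hα0 hR
    have hk0 : (0 : ℝ) < k m := lt_of_lt_of_le (by positivity) hkσ
    rw [coordLaw_eq_pi]
    refine measure_exists_degCount_mem_le (pointLaw α (discRadius C (m + 1)))
      (measurableSet_hypRel (discRadius C (m + 1)))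
      (E := {a : ℝ × ℝ | r₀ < a.1 ∧ a.1 ≤ discRadius C (m + 1) ∧
        a.1 ≤ meanDegRadius α (m + 1) ((1 + ρ) * k m)}) ?_ {j | j < k m} ?_
    · exact (measurableSet_lt measurable_const measurable_fst).inter
        ((measurableSet_le measurable_fst measurable_const).inter
          (measurableSet_le measurable_fst measurable_const))
    · rintro ⟨r, θ⟩ ⟨h1, h2, h3⟩
      simp only at h1 h2 h3
      have hp := (abs_le.1 (hr _ r θ hR hR4 h1.le h2)).1
      have hp0 := nbrProb_nonneg (pointLaw α (discRadius C (m + 1))) (hypRel (discRadius C (m + 1)))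
        (r, θ)
      have hp1 := nbrProb_le_one (pointLaw α (discRadius C (m + 1))) (hypRel (discRadius C (m + 1)))
        (r, θ)
      refine sum_binomWeight_lt_le hp0 hp1 hσ0 hσ1 ?_
      rw [le_meanDegRadius_iff hα (Nat.succ_pos m) (mul_pos (by linarith) hk0)] at h3
      generalize nbrProb (pointLaw α (discRadius C (m + 1))) (hypRel (discRadius C (m + 1)))
        (r, θ) = p at *
      have hm0 : (0 : ℝ) ≤ m := Nat.cast_nonneg m
      push_cast at h3
      have h4 : ((m : ℝ) + 1) * ((1 - σ) * (kappa α * Real.exp (-r / 2))) ≤ (m + 1) * p := by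
        gcongr; linarith
      have h5 : (1 - σ) * ((1 + ρ) * k m)
          ≤ ((m : ℝ) + 1) * ((1 - σ) * (kappa α * Real.exp (-r / 2))) := by nlinarith
      have h6 : 1 + 2 * σ ≤ (1 - σ) * (1 + ρ) := by simp only [σ]; nlinarith
      have h7 : 1 ≤ σ * k m := by rw [div_le_iff₀ hσ0] at hkσ; linarith
      nlinarith

lemma exists_small_relative_error (a : ℝ) {ε : ℝ} (hε : 0 < ε) :
    ∃ ρ > 0, ρ ≤ 1 / 2 ∧ (1 + ρ) * (1 - ρ) ^ (-a) ≤ 1 + ε ∧ 1 - ε ≤ (1 - ρ) * (1 + ρ) ^ (-a) := by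
  have h1 : Tendsto (fun ρ : ℝ => (1 + ρ) * (1 - ρ) ^ (-a)) (𝓝 0) (𝓝 1) := by
    have : ContinuousAt (fun ρ : ℝ => (1 + ρ) * (1 - ρ) ^ (-a)) 0 :=
      (continuousAt_const.add continuousAt_id).mul
        ((continuousAt_const.sub continuousAt_id).rpow_const (Or.inl (by simp)))
    simpa [ContinuousAt] using this
  have h2 : Tendsto (fun ρ : ℝ => (1 - ρ) * (1 + ρ) ^ (-a)) (𝓝 0) (𝓝 1) := by
    have : ContinuousAt (fun ρ : ℝ => (1 - ρ) * (1 + ρ) ^ (-a)) 0 :=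
      (continuousAt_const.sub continuousAt_id).mul
        ((continuousAt_const.add continuousAt_id).rpow_const (Or.inl (by simp)))
    simpa [ContinuousAt] using this
  have h3 := (h1.eventually_le_const (by linarith : 1 < 1 + ε)).and
    (h2.eventually_const_le (by linarith : 1 - ε < 1))
  obtain ⟨η, hη, hball⟩ := Metric.eventually_nhds_iff.1 h3
  have hpos : 0 < min (η / 2) (1 / 2) := lt_min (by positivity) (by norm_num)
  have hlt : min (η / 2) (1 / 2) < η := (min_le_left _ _).trans_lt (by linarith)
  have h4 := hball (y := min (η / 2) (1 / 2)) (by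
    rw [Real.dist_eq, sub_zero, abs_of_pos hpos]; exact hlt)
  exact ⟨_, hpos, min_le_right _ _, h4.1, h4.2⟩

/-- The fraction of vertices of degree at least `k` agrees with the limiting fraction up to a
factor `1 + o(1)`, for `k` between a small power of the number of vertices and the order of the
largest degrees. -/
theorem whp_fracDegGe (hα : 1 / 2 < α) {d : ℝ} (hd : 0 < d) {k : ℕ → ℕ}
    (hk : ∀ᶠ n : ℕ in atTop, (n : ℝ) ^ d ≤ (k n : ℝ) ∧
      (k n : ℝ) ≤ (n : ℝ) ^ (1 / (2 * α)) / Real.log n) {ε : ℝ} (hε : 0 < ε) :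
    WHP α C fun n G => |fracDegGe G (k n) - degGeLimit α C (k n)| ≤ ε * degGeLimit α C (k n) := by
  classical
  have hα0 : 0 < α := by linarith
  obtain ⟨ρ, hρ, hρ1, hρu, hρl⟩ := exists_small_relative_error (2 * α) hε
  have hks := (tendsto_add_atTop_nat 1).eventually hk
  have hkl : ∀ᶠ m : ℕ in atTop, ((m + 1 : ℕ) : ℝ) ^ d ≤ k (m + 1) := hks.mono fun m h => h.1
  have hku : ∀ᶠ m : ℕ in atTop, (k (m + 1) : ℝ)
      ≤ ((m + 1 : ℕ) : ℝ) ^ (1 / (2 * α)) / Real.log (m + 1 : ℕ) := hks.mono fun m h => h.2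
  have hkt := tendsto_cast_of_rpow_le (k := fun m => k (m + 1)) hd hkl
  have hk0 : ∀ᶠ m in atTop, 0 < k (m + 1) :=
    (hkt.eventually (eventually_gt_atTop 0)).mono fun m h => Nat.cast_pos.1 h
  have hL := tendsto_mul_degGeLimit (C := C) (k := fun m => k (m + 1)) hα hk0 hku
  obtain ⟨r₀, hr₀, hbad1, hbad2⟩ := exists_tendsto_coordLaw_exists_atypical (C := C)
    (k := fun m => k (m + 1)) hα hρ hρ1 hd hkl
  have hbad3 := tendsto_coordLaw_exists_near_centre (C := C) hα hr₀
  have hm : (0 : ℝ) < 1 - ρ := by linarith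
  have hp : (0 : ℝ) < 1 + ρ := by linarith
  have hbad4 := tendsto_coordLaw_card_meanDegRadius (C := C) (k := fun m => k (m + 1)) hα hkt hL hm
    (tendsto_meanDegRadius hα hk0 hku hm) hρ
  have hbad5 := tendsto_coordLaw_card_meanDegRadius (C := C) (k := fun m => k (m + 1)) hα hkt hL hp
    (tendsto_meanDegRadius hα hk0 hku hp) hρ
  -- outside five unlikely events the count is squeezed between two counts of radii
  have hsum := hbad1.add (hbad2.add (hbad3.add (hbad4.add hbad5)))
  simp only [add_zero] at hsum
  refine whp_of_tendsto_bad hα0 (fun m => _ ∪ (_ ∪ (_ ∪ (_ ∪ _)))) ?_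
    (tendsto_of_tendsto_of_tendsto_of_le_of_le' tendsto_const_nhds hsum
      (Eventually.of_forall fun m => zero_le)
      (Eventually.of_forall fun m => (measure_union_le _ _).trans (add_le_add le_rfl
        ((measure_union_le _ _).trans (add_le_add le_rfl
          ((measure_union_le _ _).trans (add_le_add le_rfl (measure_union_le _ _))))))))
  filter_upwards [hL.eventually (eventually_gt_atTop 0)] with m hL0 x hx
  simp only [mem_union, mem_ofPred_eq, mem_Iic, not_or, not_exists, not_and, not_not, not_le] at hx
  obtain ⟨hx1, hx2, hx3, hx4, hx5⟩ := hx
  have hn : (0 : ℝ) < (m + 1 : ℕ) := by positivity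
  have hl0 : 0 < degGeLimit α C (k (m + 1)) := pos_of_mul_pos_right hL0 hn.le
  rw [fracDegGe_graph]
  set l := degGeLimit α C (k (m + 1))
  set n : ℝ := ((m + 1 : ℕ) : ℝ)
  set N := (Finset.univ.filter fun v =>
    k (m + 1) ≤ degCount (hypRel (discRadius C (m + 1))) x v).card
  have hupper : N ≤ (Finset.univ.filter fun v =>
      (x v).1 ≤ meanDegRadius α (m + 1) ((1 - ρ) * k (m + 1))).card := by
    refine Finset.card_le_card fun v hv => ?_
    simp only [Finset.mem_filter, Finset.mem_univ, true_and] at hv ⊢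
    by_contra hcon
    exact absurd (hx1 v ⟨(hx3 v).1, (hx3 v).2, not_le.1 hcon⟩) (not_lt.2 hv)
  have hlower : (Finset.univ.filter fun v =>
      (x v).1 ≤ meanDegRadius α (m + 1) ((1 + ρ) * k (m + 1))).card ≤ N := by
    refine Finset.card_le_card fun v hv => ?_
    simp only [Finset.mem_filter, Finset.mem_univ, true_and] at hv ⊢
    exact not_lt.1 (hx2 v ⟨(hx3 v).1, (hx3 v).2, hv⟩)
  have hupper' : (N : ℝ) ≤ (1 + ρ) * (n * ((1 - ρ) ^ (-(2 * α)) * l)) := by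
    have h1 := (abs_lt.1 hx4).2
    have h2 : (N : ℝ) ≤ _ := Nat.cast_le.2 hupper
    linarith
  have hlower' : (1 - ρ) * (n * ((1 + ρ) ^ (-(2 * α)) * l)) ≤ N := by
    have h1 := (abs_lt.1 hx5).1
    have h2 : _ ≤ (N : ℝ) := Nat.cast_le.2 hlower
    linarith
  have hu : (N : ℝ) / n ≤ (1 + ε) * l := by
    rw [div_le_iff₀ hn]
    calc (N : ℝ) ≤ (1 + ρ) * (1 - ρ) ^ (-(2 * α)) * (l * n) := by linarith
      _ ≤ (1 + ε) * (l * n) := by gcongr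
      _ = _ := by ring
  have hlo : (1 - ε) * l ≤ (N : ℝ) / n := by
    rw [le_div_iff₀ hn]
    calc (1 - ε) * l * n = (1 - ε) * (l * n) := by ring
      _ ≤ (1 - ρ) * (1 + ρ) ^ (-(2 * α)) * (l * n) := by gcongr
      _ ≤ N := by linarith
  rw [abs_le]
  constructor <;> linarith

end LargeDegree

end HypGraph

theorem theorem2 (α C : ℝ) (hα : 1 / 2 < α) :
    (∀ δ' : ℝ, δ' < HypGraph.delta α → ∀ ε : ℝ, 0 < ε →
      HypGraph.WHP α C fun n G => ∀ k : ℕ, (k : ℝ) ≤ (n : ℝ) ^ δ' →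
        |HypGraph.fracDegEq G k - HypGraph.degEqLimit α C k| ≤ ε * HypGraph.degEqLimit α C k) ∧
    (∀ k : ℕ → ℕ,
      (∀ᶠ n : ℕ in atTop, (n : ℝ) ^ HypGraph.delta α ≤ (k n : ℝ) ∧
        (k n : ℝ) ≤ (n : ℝ) ^ (1 / (2 * α)) / Real.log n) →
      ∀ ε : ℝ, 0 < ε →
        HypGraph.WHP α C fun n G =>
          |HypGraph.fracDegGe G (k n) - HypGraph.degGeLimit α C (k n)|
            ≤ ε * HypGraph.degGeLimit α C (k n)) := by
  have hδ := (HypGraph.delta_bounds hα).1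
  refine ⟨fun δ' hδ' ε hε => ?_, fun k hk ε hε => HypGraph.whp_fracDegGe hα hδ hk hε⟩
  -- a nonpositive exponent may be replaced by a positive one, which only allows more degrees
  have h := HypGraph.whp_fracDegEq (d' := max δ' (HypGraph.delta α / 2)) C hα
    (lt_max_of_lt_right (half_pos hδ)) (max_lt hδ' (half_lt_self hδ)) hε
  have hα0 : 0 < α := by linarith
  have hR := (HypGraph.tendsto_discRadius C).eventually (eventually_gt_atTop 0)
  refine tendsto_of_tendsto_of_tendsto_of_le_of_le' h tendsto_const_nhds ?_ ?_
  · filter_upwards [eventually_ge_atTop 1] with n hn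
    refine measure_mono fun x hx k hk => hx k (hk.trans ?_)
    exact Real.rpow_le_rpow_of_exponent_le (by exact_mod_cast hn) (le_max_left _ _)
  · filter_upwards [hR] with n hRn
    have := HypGraph.isProbabilityMeasure_pointLaw hα0 hRn
    rw [HypGraph.coordLaw_eq_pi]
    exact prob_le_one
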